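/- **Graphs.** All graphs are finite, simple and connected; $P_k$, $C_k$, $K_k$ denote the path, the cycle and the complete graph on $k$ vertices, and "$G$ contains $H$" means as an induced subgraph. $N(v)$ is the set of neighbours of $v$; for a set $K$ of vertices, $N(K)$ is the set of vertices outside $K$ with a neighbour in $K$. A $7$-antihole of $G$ is a set $C=\{v_0,\dots,v_6\}$ of seven vertices with $v_iv_j\in E(G)$ iff $2\le |i-j|\le 5$ (indices modulo $7$); a $9$-antihole is an induced subgraph isomorphic to the complement of $C_9$. A $7$-antihole $C$ is *clean* if (C1) no vertex is complete to $C$, (C2) any two vertices with exactly $6$ neighbours in $C$ have the same neighbours in $C$, and (C3) for each connected component $K$ of $G-(C\cup N(C))$, either $N(K)$ is a clique or some vertex is complete to $K$. $G$ is *clean* if it contains no $K_5$ and no $9$-antihole and each of its $7$-antiholes is clean. A clique cutset is a clique $S$ such that $G-S$ is disconnected. **Input.** A clean graph $G$ on $n$ vertices that contains neither $P_6$ nor $C_5$ and has no clique cutset, and a $7$-antihole $C=\{v_0,\dots,v_6\}$ of $G$. Let $X=N(C)$ and $Y=V(G)\setminus(C\cup X)$. A vertex of $X$ is a *leaf* if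 it has exactly one neighbour in $C$, *big* if it is complete to a triangle of $C$, and *small* otherwise. Let $Z$ be the set of leaves and $S$ the set of small vertices with a neighbour in $Y\cup Z$. **Phase II algorithm.** 1. Start with $R=\emptyset$. For each $i\in\{0,\dots,6\}$: if some vertex of $S$ is complete to $\{v_i,v_{i+1},v_{i+2}\}$ and non-adjacent to $v_{i-1}$, put one such vertex $u$ into $R$, chosen with $v_{i+3}\notin N(u)$ if possible. 2. Consider a $4$-coloring $c$ of $G[C\cup R]$. Set $L(v)=\{c(v)\}$ for $v\in C\cup R$ and $L(v)=\{1,2,3,4\}$ for all other $v$. 3. As long as this changes the lists: if $L(v)=\{i\}$ for some $v$, remove $i$ from $L(u)$ for each $u\in N(v)$. 4. For each vertex $v$ let $Q(v)$ be the set of those $i\in L(v)$ for which $G[N(v)]$ has no coloring respecting the lists $L'(w)=L(w)\setminus\{i\}$. 5. For each pair of distinct vertices $u,v$ let $Q(u,v)$ be the set of those $(i,j)$ with $i\in L(u)$, $j\in L(v)$, $i\ne j$ for which $G[N(u)\cap N(v)]$ has no coloring respecting the lists $L'(w)=L(w)\setminus\{i,j\}$. 6. Test whether $G'=G[C\cup(X\setminus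 Z)]$ has a $4$-coloring $c$ with $c(u)\in L(u)\setminus Q(u)$ for all $u$ and $(c(u),c(v))\notin Q(u,v)$ for all distinct $u,v$. If so, answer "$G$ is $4$-colorable". 7. If no coloring $c$ in Step 2 leads to success in Step 6 (in particular if there is none), answer "$G$ is not $4$-colorable". In Step 2 the colorings $c$ are taken up to permutations of the colors. **Lemma.** The Phase II algorithm has a polynomial-time implementation: there are one program and one polynomial $p$ such that, for every input as above, given by the adjacency matrix of $G$ and the list $v_0,\dots,v_6$, the program halts within time $p(n)$ and outputs the record of a correct execution of the algorithm (the vertices chosen in Step 1; for each iteration of Steps 2–6 the coloring $c$, the lists $L$, the sets $Q(v)$ and $Q(u,v)$, and the result of Step 6; and the answer), with at most $7\cdot 2^6$ iterations. (Programs are those of a WHILE language on binary trees, each executed instruction being charged the size of the tree it is applied to; up to a polynomial this is Turing machine time.) Moreover, for every such input and every correct choice in Step 1: * up to permutations of the colors there are at most $7\cdot 2^6$ $4$-colorings of $G[C\cup R]$; and in every iteration of Steps 2–6: * each test of Step 4 is a list coloring problem on a $P_6$-free graph in which only three colors occur in the lists; * each test of Step 5, and the test of Step 6, succeeds if and only if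 the following 2SAT instance is satisfiable. To color $G[U]$ from lists $L$, with the colors in $Q(x)$ forbidden at $x$ and the pairs in $Q(x,y)$ forbidden at $(x,y)$, it has a variable $x_i$ for each vertex $x$ and color $i$, and the clauses $(x_i\vee x_j)$ for $x\in U$ and all colors $i,j$, possibly equal, with $L(x)\subseteq\{i,j\}$; $(\neg x_i\vee\neg x_j)$ for $x\in U$ and $i\neq j$; $(\neg x_i\vee\neg y_i)$ for adjacent $x,y\in U$; $(\neg x_i)$ for $x\in U$ and $i\in Q(x)$; and $(\neg x_i\vee\neg y_j)$ for distinct $x,y\in U$ and $(i,j)\in Q(x,y)$. In Step 5, for distinct $u,v$ and colors $i\neq j$, it is taken with $U=N(u)\cap N(v)$, the lists $L'$ and all sets $Q$ empty; in Step 6 with $U=V(G')$, $L$ and the sets $Q$. -/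

import Mathlib

namespace PhaseTwo

/-! ### The machine model

Programs of a WHILE language over binary trees.  A program transforms one tree into one tree, and
every executed instruction is charged the size of the tree it is applied to (so a program can never
build data larger than its running time).  Up to a polynomial this is Turing machine time. -/

/-- Binary trees, the data of the machine model. -/
inductive Data : Type
  | leaf : Data
  | node : Data → Data → Data

/-- The number of nodes and leaves of a tree. -/
def Data.size : Data → ℕ
  | .leaf => 1
  | .node a b => 1 + a.size + b.size

/-- Programs. The conditional and the loop branch on whether the value of the condition is a leaf
(read as false) or a node (read as true). -/
inductive Prog : Type
  | skip : Prog
  | nil : Prog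
  | hd : Prog
  | tl : Prog
  | pair : Prog → Prog → Prog
  | seq : Prog → Prog → Prog
  | ite : Prog → Prog → Prog → Prog
  | loop : Prog → Prog → Prog

/-- `Prog.Eval P x y t`: on input `x` the program `P` halts with output `y` at cost exactly `t`. -/
inductive Prog.Eval : Prog → Data → Data → ℕ → Prop
  | skip (x : Data) : Prog.Eval .skip x x x.size
  | nil (x : Data) : Prog.Eval .nil x .leaf x.size
  | hd_leaf : Prog.Eval .hd .leaf .leaf 1
  | hd_node (a b : Data) : Prog.Eval .hd (.node a b) a (Data.node a b).size
  | tl_leaf : Prog.Eval .tl .leaf .leaf 1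
  | tl_node (a b : Data) : Prog.Eval .tl (.node a b) b (Data.node a b).size
  | pair {P Q : Prog} {x a b : Data} {s t : ℕ} :
      Prog.Eval P x a s → Prog.Eval Q x b t →
      Prog.Eval (.pair P Q) x (.node a b) (s + t + x.size)
  | seq {P Q : Prog} {x y z : Data} {s t : ℕ} :
      Prog.Eval P x y s → Prog.Eval Q y z t → Prog.Eval (.seq P Q) x z (s + t + x.size)
  | ite_true {B P Q : Prog} {x a b y : Data} {s t : ℕ} :
      Prog.Eval B x (.node a b) s → Prog.Eval P x y t →
      Prog.Eval (.ite B P Q) x y (s + t + x.size)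
  | ite_false {B P Q : Prog} {x y : Data} {s t : ℕ} :
      Prog.Eval B x .leaf s → Prog.Eval Q x y t → Prog.Eval (.ite B P Q) x y (s + t + x.size)
  | loop_done {B P : Prog} {x : Data} {s : ℕ} :
      Prog.Eval B x .leaf s → Prog.Eval (.loop B P) x x (s + x.size)
  | loop_step {B P : Prog} {x a b y z : Data} {s t u : ℕ} :
      Prog.Eval B x (.node a b) s → Prog.Eval P x y t → Prog.Eval (.loop B P) y z u →
      Prog.Eval (.loop B P) x z (s + t + u + x.size)

/-! ### Encodings -/

def encodeList : List Data → Data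
  | [] => .leaf
  | a :: l => .node a (encodeList l)

/-- Unary numerals. -/
def encodeNat (k : ℕ) : Data := encodeList (List.replicate k .leaf)

def encodeBool : Bool → Data
  | false => .leaf
  | true => .node .leaf .leaf

def encodeOption {α : Type} (e : α → Data) : Option α → Data
  | none => .leaf
  | some a => .node (e a) .leaf

/-- A table, listed entry by entry. -/
def encodeFun {m : ℕ} (e : Fin m → Data) : Data := encodeList (List.ofFn e)

/-! ### The class of graphs -/

section Graphs

variable {V : Type}

/-- A 7-antihole of `G`, with its vertices `v 0, …, v 6` in the cyclic order in which
`v i` and `v j` are adjacent in `G` exactly if they are distinct and not consecutive. -/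
abbrev Antihole (G : SimpleGraph V) : Type := (SimpleGraph.cycleGraph 7)ᶜ ↪g G

/-- `N(K)`: the vertices outside `K` with a neighbour in `K`. -/
def nbhd (G : SimpleGraph V) (K : Set V) : Set V := {x | x ∉ K ∧ ∃ u ∈ K, G.Adj u x}

/-- `K` is (the vertex set of) a connected component of `G[U]`. -/
def IsComponent (G : SimpleGraph V) (U K : Set V) : Prop :=
  Maximal (fun K' : Set V => K' ⊆ U ∧ (G.induce K').Connected) K

/-- The 7-antihole `v` is clean. -/
structure IsCleanAntihole (G : SimpleGraph V) (v : Antihole G) : Prop where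
  no_complete : ¬ ∃ x, ∀ i, G.Adj x (v i)
  six : ∀ x y, (G.neighborSet x ∩ Set.range v).ncard = 6 →
    (G.neighborSet y ∩ Set.range v).ncard = 6 →
    G.neighborSet x ∩ Set.range v = G.neighborSet y ∩ Set.range v
  component : ∀ K, IsComponent G (Set.range v ∪ nbhd G (Set.range v))ᶜ K →
    G.IsClique (nbhd G K) ∨ ∃ x, ∀ k ∈ K, G.Adj x k

/-- `G` is clean: no `K₅`, no 9-antihole, and every 7-antihole is clean. -/
structure IsClean (G : SimpleGraph V) : Prop where
  no_K5 : G.CliqueFree 5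
  no_antihole9 : ¬ (SimpleGraph.cycleGraph 9)ᶜ.IsIndContained G
  antihole : ∀ v : Antihole G, IsCleanAntihole G v

def IsCliqueCutset (G : SimpleGraph V) (S : Set V) : Prop :=
  G.IsClique S ∧ G.Connected ∧ ¬ (G.induce Sᶜ).Preconnected

/-- The graphs to which the algorithm is applied (together with a 7-antihole). -/
structure IsAdmissible (G : SimpleGraph V) : Prop where
  connected : G.Connected
  P6_free : ¬ (SimpleGraph.pathGraph 6).IsIndContained G
  C5_free : ¬ (SimpleGraph.cycleGraph 5).IsIndContained G
  clean : IsClean G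
  no_clique_cutset : ¬ ∃ S, IsCliqueCutset G S

/-! ### Vertex types with respect to a 7-antihole `C = {v 0, …, v 6}` -/

/-- `X = N(C)`. -/
def setX (G : SimpleGraph V) (v : Antihole G) : Set V := nbhd G (Set.range v)

/-- `Y = V(G) \ (C ∪ X)`. -/
def setY (G : SimpleGraph V) (v : Antihole G) : Set V := (Set.range v ∪ setX G v)ᶜ

/-- `Z`, the set of leaves: vertices of `X` with exactly one neighbour in `C`. -/
def setZ (G : SimpleGraph V) (v : Antihole G) : Set V :=
  {x | x ∈ setX G v ∧ ∃ i, ∀ j, G.Adj x (v j) ↔ j = i}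

/-- Big vertices: vertices of `X` complete to a triangle of `C`. -/
def setBig (G : SimpleGraph V) (v : Antihole G) : Set V :=
  {x | x ∈ setX G v ∧ ∃ i j k, G.Adj (v i) (v j) ∧ G.Adj (v j) (v k) ∧ G.Adj (v i) (v k) ∧
    G.Adj x (v i) ∧ G.Adj x (v j) ∧ G.Adj x (v k)}

/-- Small vertices: vertices of `X` that are neither leaves nor big. -/
def setSmall (G : SimpleGraph V) (v : Antihole G) : Set V :=
  {x | x ∈ setX G v ∧ x ∉ setZ G v ∧ x ∉ setBig G v}

/-- `S`, the set of small vertices having a neighbour in `Y ∪ Z`. -/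
def setS (G : SimpleGraph V) (v : Antihole G) : Set V :=
  {x | x ∈ setSmall G v ∧ ∃ y ∈ setY G v ∪ setZ G v, G.Adj x y}

/-- The vertex set `C ∪ (X \ Z)` of the graph coloured in Step 6. -/
def setG' (G : SimpleGraph V) (v : Antihole G) : Set V := Set.range v ∪ (setX G v \ setZ G v)

/-! ### The steps of the algorithm -/

/-- `u ∈ S` is complete to `{v i, v (i+1), v (i+2)}` and non-adjacent to `v (i-1)`
(indices modulo 7). -/
def IsCandidate (G : SimpleGraph V) (v : Antihole G) (i : Fin 7) (u : V) : Prop :=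
  u ∈ setS G v ∧ G.Adj u (v i) ∧ G.Adj u (v (i + 1)) ∧ G.Adj u (v (i + 2)) ∧
    ¬ G.Adj u (v (i - 1))

/-- Step 1. `r i` is the vertex put into `R` for the index `i`, if there is a candidate;
candidates that are non-adjacent to `v (i+3)` have priority. -/
def IsStep1 (G : SimpleGraph V) (v : Antihole G) (r : Fin 7 → Option V) : Prop :=
  ∀ i,
    (r i = none → ∀ u, ¬ IsCandidate G v i u) ∧
    (∀ u, r i = some u → IsCandidate G v i u ∧
      ((∃ w, IsCandidate G v i w ∧ ¬ G.Adj w (v (i + 3))) → ¬ G.Adj u (v (i + 3))))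

/-- `C ∪ R`. -/
def setCR (G : SimpleGraph V) (v : Antihole G) (r : Fin 7 → Option V) : Set V :=
  Set.range v ∪ {u | ∃ i, r i = some u}

/-- The partial colouring `c` is a 4-colouring of `G[U]` (and colours nothing else). -/
def IsColoringOf (G : SimpleGraph V) (U : Set V) (c : V → Option (Fin 4)) : Prop :=
  (∀ x, (c x).isSome = true ↔ x ∈ U) ∧ ∀ x ∈ U, ∀ y ∈ U, G.Adj x y → c x ≠ c y

/-- `c'` arises from `c` by permuting colours. -/
def SameUpToColors (c c' : V → Option (Fin 4)) : Prop :=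
  ∃ σ : Equiv.Perm (Fin 4), ∀ x, c' x = (c x).map σ

/-- Step 2: the initial lists. -/
def initLists (c : V → Option (Fin 4)) (x : V) : Finset (Fin 4) :=
  match c x with
  | some i => {i}
  | none => Finset.univ

/-- One application, changing the lists, of the rule of Step 3: if `L x = {i}`, remove `i` from the
lists of the neighbours of `x`. -/
def PropagationStep (G : SimpleGraph V) (L L' : V → Finset (Fin 4)) : Prop :=
  L' ≠ L ∧ ∃ x i, L x = {i} ∧ (∀ u, G.Adj x u → L' u = (L u).erase i) ∧
    ∀ u, ¬ G.Adj x u → L' u = L u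

/-- Step 3: the rule has been applied, in some order, until it no longer changes the lists. -/
def IsStep3 (G : SimpleGraph V) (L₀ L : V → Finset (Fin 4)) : Prop :=
  Relation.ReflTransGen (PropagationStep G) L₀ L ∧ ∀ L', ¬ PropagationStep G L L'

/-- (The values on `U` of) `f` form a colouring of `G[U]` that respects the lists `L`. -/
def IsListColoring (G : SimpleGraph V) (U : Set V) (L : V → Finset (Fin 4)) (f : V → Fin 4) :
    Prop :=
  (∀ x ∈ U, f x ∈ L x) ∧ ∀ x ∈ U, ∀ y ∈ U, G.Adj x y → f x ≠ f y

/-- The test of Step 4 for the vertex `x` and the colour `i` succeeds. -/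
def Test4 (G : SimpleGraph V) (L : V → Finset (Fin 4)) (x : V) (i : Fin 4) : Prop :=
  ∃ f, IsListColoring G (G.neighborSet x) (fun w => L w \ {i}) f

/-- Step 4. -/
def IsStep4 (G : SimpleGraph V) (L Q₁ : V → Finset (Fin 4)) : Prop :=
  ∀ x i, i ∈ Q₁ x ↔ i ∈ L x ∧ ¬ Test4 G L x i

/-- The test of Step 5 for the vertices `x`, `y` and the colours `i`, `j` succeeds. -/
def Test5 (G : SimpleGraph V) (L : V → Finset (Fin 4)) (x y : V) (i j : Fin 4) : Prop :=
  ∃ f, IsListColoring G (G.neighborSet x ∩ G.neighborSet y) (fun w => L w \ {i, j}) f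

/-- Step 5 (with the convention `Q₂ x x = ∅`). -/
def IsStep5 (G : SimpleGraph V) (L : V → Finset (Fin 4))
    (Q₂ : V → V → Finset (Fin 4 × Fin 4)) : Prop :=
  ∀ x y i j, (i, j) ∈ Q₂ x y ↔
    x ≠ y ∧ i ∈ L x ∧ j ∈ L y ∧ i ≠ j ∧ ¬ Test5 G L x y i j

/-- The test of Step 6 succeeds. -/
def Test6 (G : SimpleGraph V) (v : Antihole G) (L Q₁ : V → Finset (Fin 4))
    (Q₂ : V → V → Finset (Fin 4 × Fin 4)) : Prop :=
  ∃ f, IsListColoring G (setG' G v) L f ∧ (∀ x ∈ setG' G v, f x ∉ Q₁ x) ∧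
    ∀ x ∈ setG' G v, ∀ y ∈ setG' G v, x ≠ y → (f x, f y) ∉ Q₂ x y

/-- The data of one iteration of Steps 2-6: the colouring chosen in Step 2, the lists after Step 3,
the sets of Steps 4 and 5, and the result of the test of Step 6. -/
structure Iteration (V : Type) where
  c : V → Option (Fin 4)
  L : V → Finset (Fin 4)
  Q₁ : V → Finset (Fin 4)
  Q₂ : V → V → Finset (Fin 4 × Fin 4)
  passed : Bool

/-- `it` records a correct execution of Steps 2-6. -/
structure IsIteration (G : SimpleGraph V) (v : Antihole G) (r : Fin 7 → Option V)
    (it : Iteration V) : Prop where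
  step2 : IsColoringOf G (setCR G v r) it.c
  step3 : IsStep3 G (initLists it.c) it.L
  step4 : IsStep4 G it.L it.Q₁
  step5 : IsStep5 G it.L it.Q₂
  step6 : it.passed = true ↔ Test6 G v it.L it.Q₁ it.Q₂

/-- The record of an execution of the algorithm: the choices of Step 1, the iterations of
Steps 2-6, and the answer (`true` for "`G` is 4-colorable"). -/
structure Run (V : Type) where
  r : Fin 7 → Option V
  iterations : List (Iteration V)
  answer : Bool

/-- `ρ` records a correct execution of the algorithm on `G` and the 7-antihole `v`. The colourings
of Step 2 are taken up to permutations of the colours, each at most once; a negative answer is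
given only after all of them have been tried. -/
structure IsRun (G : SimpleGraph V) (v : Antihole G) (ρ : Run V) : Prop where
  step1 : IsStep1 G v ρ.r
  iteration : ∀ it ∈ ρ.iterations, IsIteration G v ρ.r it
  distinct : ρ.iterations.Pairwise fun it it' => ¬ SameUpToColors it.c it'.c
  answer : ρ.answer = true ↔ ∃ it ∈ ρ.iterations, it.passed = true
  exhaustive : ρ.answer = false →
    ∀ c, IsColoringOf G (setCR G v ρ.r) c → ∃ it ∈ ρ.iterations, SameUpToColors it.c c

/-! ### 2SAT -/

/-- A literal is a variable with a sign. -/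
abbrev Literal (W : Type) : Type := W × Bool

/-- A 2CNF formula is a set of clauses of two (possibly equal) literals. -/
abbrev TwoCNF (W : Type) : Type := Set (Literal W × Literal W)

def TwoCNF.Satisfiable {W : Type} (φ : TwoCNF W) : Prop :=
  ∃ a : W → Bool, ∀ cl ∈ φ, a cl.1.1 = cl.1.2 ∨ a cl.2.1 = cl.2.2

/-- The 2SAT instance with a variable `(x, i)` ("`x` has colour `i`") for every vertex and colour,
for colouring `G[U]` from lists `L` of size at most two, with the colours in `Q₁ x` forbidden at `x`
and the pairs of colours in `Q₂ x y` forbidden at `x, y`. -/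
def coloringFormula (G : SimpleGraph V) (U : Set V) (L Q₁ : V → Finset (Fin 4))
    (Q₂ : V → V → Finset (Fin 4 × Fin 4)) : TwoCNF (V × Fin 4) :=
  {cl | ∃ x ∈ U, ∃ i j, L x ⊆ {i, j} ∧ cl = (((x, i), true), ((x, j), true))} ∪
  {cl | ∃ x ∈ U, ∃ i j, i ≠ j ∧ cl = (((x, i), false), ((x, j), false))} ∪
  {cl | ∃ x ∈ U, ∃ y ∈ U, G.Adj x y ∧ ∃ i, cl = (((x, i), false), ((y, i), false))} ∪
  {cl | ∃ x ∈ U, ∃ i ∈ Q₁ x, cl = (((x, i), false), ((x, i), false))} ∪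
  {cl | ∃ x ∈ U, ∃ y ∈ U, x ≠ y ∧ ∃ i j, (i, j) ∈ Q₂ x y ∧
    cl = (((x, i), false), ((y, j), false))}

end Graphs

/-! ### Input and output of the implementation -/

open Classical in
/-- The adjacency matrix of `G`, followed by the list of the vertices of the 7-antihole. -/
noncomputable def encodeInput {n : ℕ} (G : SimpleGraph (Fin n)) (v : Antihole G) : Data :=
  .node (encodeFun fun x => encodeFun fun y => encodeBool (decide (G.Adj x y)))
    (encodeFun fun i : Fin 7 => encodeNat (v i))

def encodeColors (s : Finset (Fin 4)) : Data :=
  encodeFun fun i : Fin 4 => encodeBool (decide (i ∈ s))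

def encodePairs (s : Finset (Fin 4 × Fin 4)) : Data :=
  encodeFun fun i : Fin 4 => encodeFun fun j : Fin 4 => encodeBool (decide ((i, j) ∈ s))

def encodeIteration {n : ℕ} (it : Iteration (Fin n)) : Data :=
  encodeList
    [encodeFun fun x => encodeOption (fun i : Fin 4 => encodeNat i) (it.c x),
     encodeFun fun x => encodeColors (it.L x),
     encodeFun fun x => encodeColors (it.Q₁ x),
     encodeFun fun x => encodeFun fun y => encodePairs (it.Q₂ x y),
     encodeBool it.passed]

def encodeRun {n : ℕ} (ρ : Run (Fin n)) : Data :=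
  encodeList
    [encodeFun fun i : Fin 7 => encodeOption (fun x : Fin n => encodeNat x) (ρ.r i),
     encodeList (ρ.iterations.map encodeIteration),
     encodeBool ρ.answer]

end PhaseTwo

/-!
The algorithm is implemented in a small library of polynomial-time maps. `Poly e d` says that one
program turns `e γ` into `d γ` for every instance `γ`, in time polynomial in the size of `e γ`, and
`Dec e p` that a predicate is decided in this sense. Both are closed under composition, case
distinctions, bounded loops and bounded quantifiers, so that a step of the algorithm is computed by
following its definition. Colours, and the `7 * 4 ^ 7` possible parameters of the colourings of
`C ∪ R`, are constants of the program text. A 4-colouring of the antihole has one class of size one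
and three classes of two consecutive vertices (`exists_col`), which leaves at most two colours for
each vertex of `R`, and a single one for some index of Step 1; this gives the bound `7 * 2 ^ 6`
(`card_validCols_le`).

The tests of Steps 5 and 6 are constraint problems with binary constraints and lists of at most two
colours: in Step 6 a vertex has two adjacent neighbours in the antihole, as it would be on a `C₅`
otherwise, and propagation deletes their colours from its list. Such problems are equivalent to their
2SAT instances (`exists_coloring_iff_satisfiable`), and they are decided by following forced values
(`binary_constraints_iff`, `Dec.binary_constraints`).

The test of Step 4 is a list 3-colouring problem on the neighbourhood `N(x)` of a vertex. Instead of
an algorithm for all `P₆`-free graphs, a reduction special to the situation is used. Delete the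
excluded colour and the colours of vertices with a single colour from the lists of their neighbours.
The vertices that are left with two colours at most form the core; the other ones are free, and they
have at most one neighbour in the antihole. Every 3-colouring of `N(x)` gives adjacent vertices of
the core different colours, and it gives vertices of the core the same colour if they have two
adjacent common neighbours in `N(x)`. Conversely, a colouring of the core with these two properties,
which is a binary constraint problem again, extends to the free vertices
(`test4_of_exists_coreColour`). This rests on three facts.

* A vertex of the core adjacent to one of two adjacent free vertices is adjacent to both
  (`Propagated.adj_of_full`). The point is that the list of a weak vertex (one with at most one
  neighbour in the antihole), with a weak neighbour whose list is full, is reduced only by a big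
  neighbour with a single colour (`Propagated.exists_forbids`), and such a vertex separates weak
  vertices only in a controlled way, because of `P₆`-freeness.
* Two neighbours of a free vertex with different lists of two colours are adjacent
  (`Propagated.adj_of_card_eq_two`). Since there is no `K₅`, a free vertex sees at most two colours in
  the core.
* A graph without induced `P₆`, `C₅`, `K₄` and complement of `C₇` is 3-colourable
  (`exists_properOn_three`); it applies to free components without neighbours in the core, since no
  vertex is complete to a 7-antihole.

For the last fact consider a vertex-critical counterexample. By an exchange of colours, triangle-free
graphs without `P₆` and `C₅` are bipartite, so every stable set misses a triangle, and Lovász's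
matrix argument for perfect graphs applies: the classes of the colourings of the graphs `G - v`
correspond to triangles, every vertex is in exactly three of these, and the colouring of `G - v` is
unique (`IsCritical.exists_lovaszSystem`, `IsCritical.colour_eq`). Hence the edges in the
neighbourhood of each vertex form a path on four vertices, and the triangles line up in a strip
`w 0, w 1, …` in which vertices at distance one and two are adjacent (`IsCritical.exists_strip`). The
strip closes up, and each possible period gives a forbidden subgraph (`IsCritical.elim`).
-/

namespace PhaseTwo

/-! ### Polynomial-time maps between encodings -/

theorem Data.size_pos (x : Data) : 1 ≤ x.size := by
  cases x <;> simp only [Data.size] <;> omega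

/-- A program cannot write more data than it is charged for. -/
theorem Prog.Eval.size_le {P : Prog} {x y : Data} {t : ℕ} (h : Prog.Eval P x y t) :
    y.size ≤ t := by
  induction h with
  | skip x => exact le_rfl
  | nil x => exact x.size_pos
  | hd_leaf => exact le_rfl
  | hd_node a b => simp [Data.size]; omega
  | tl_leaf => exact le_rfl
  | tl_node a b => simp [Data.size]
  | pair _ _ h1 h2 => rename_i x _ _ _ _ _ _; have := x.size_pos; simp [Data.size]; omega
  | seq _ _ h1 h2 => omega
  | ite_true _ _ _ h => omega
  | ite_false _ _ _ h => omega
  | loop_done _ _ => omega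
  | loop_step _ _ _ _ _ h => omega

theorem eval_mono_nat (p : Polynomial ℕ) {a b : ℕ} (h : a ≤ b) : p.eval a ≤ p.eval b := by
  induction p using Polynomial.induction_on' with
  | add p q hp hq => simp only [Polynomial.eval_add]; omega
  | monomial n c => simp only [Polynomial.eval_monomial]; gcongr

/-- `Poly e d`: one program transforms `e γ` into `d γ`, for every `γ`, in time polynomial in the
size of `e γ`. The values `e γ` and `d γ` are thought of as encodings of objects that depend on the
instance `γ`; so the semantic content of a computation stays in the index type. -/
def Poly {Γ : Type} (e d : Γ → Data) : Prop :=
  ∃ (P : Prog) (p : Polynomial ℕ), ∀ γ, ∃ t, t ≤ p.eval (e γ).size ∧ Prog.Eval P (e γ) (d γ) t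

namespace Poly

variable {Γ : Type} {e d d₁ d₂ d₃ : Γ → Data}

theorem size_le (h : Poly e d) : ∃ p : Polynomial ℕ, ∀ γ, (d γ).size ≤ p.eval (e γ).size := by
  obtain ⟨P, p, h⟩ := h
  refine ⟨p, fun γ => ?_⟩
  obtain ⟨t, ht, hE⟩ := h γ
  exact hE.size_le.trans ht

theorem id (e : Γ → Data) : Poly e e :=
  ⟨.skip, .X, fun γ => ⟨_, by simp, .skip _⟩⟩

theorem leaf (e : Γ → Data) : Poly e fun _ => .leaf :=
  ⟨.nil, .X, fun γ => ⟨_, by simp, .nil _⟩⟩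

theorem comp (h₁ : Poly e d₁) (h₂ : Poly d₁ d₂) : Poly e d₂ := by
  obtain ⟨P, p, hP⟩ := h₁
  obtain ⟨Q, q, hQ⟩ := h₂
  refine ⟨.seq P Q, p + q.comp p + .X, fun γ => ?_⟩
  obtain ⟨s, hs, hEs⟩ := hP γ
  obtain ⟨t, ht, hEt⟩ := hQ γ
  refine ⟨_, ?_, .seq hEs hEt⟩
  have := eval_mono_nat q (hEs.size_le.trans hs)
  simp only [Polynomial.eval_add, Polynomial.eval_comp, Polynomial.eval_X]
  omega

theorem node (h₁ : Poly e d₁) (h₂ : Poly e d₂) : Poly e fun γ => .node (d₁ γ) (d₂ γ) := by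
  obtain ⟨P, p, hP⟩ := h₁
  obtain ⟨Q, q, hQ⟩ := h₂
  refine ⟨.pair P Q, p + q + .X, fun γ => ?_⟩
  obtain ⟨s, hs, hEs⟩ := hP γ
  obtain ⟨t, ht, hEt⟩ := hQ γ
  refine ⟨_, ?_, .pair hEs hEt⟩
  simp only [Polynomial.eval_add, Polynomial.eval_X]
  omega

theorem fst (h : Poly e fun γ => .node (d₁ γ) (d₂ γ)) : Poly e d₁ :=
  h.comp ⟨.hd, .X, fun γ => ⟨_, by simp, .hd_node _ _⟩⟩

theorem snd (h : Poly e fun γ => .node (d₁ γ) (d₂ γ)) : Poly e d₂ :=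
  h.comp ⟨.tl, .X, fun γ => ⟨_, by simp, .tl_node _ _⟩⟩

theorem const (e : Γ → Data) (c : Data) : Poly e fun _ => c := by
  induction c with
  | leaf => exact leaf e
  | node a b ha hb => exact ha.node hb

/-- Reading an instance through a map of index types. -/
theorem reindex {Δ : Type} (f : Δ → Γ) (h : Poly e d) : Poly (e ∘ f) (d ∘ f) := by
  obtain ⟨P, p, hP⟩ := h
  exact ⟨P, p, fun δ => hP (f δ)⟩

/-- A computation may store an intermediate result `d₁ γ` and use it. -/
theorem store (h₁ : Poly e d₁) (h₂ : Poly (fun γ => .node (e γ) (d₁ γ)) d₂) : Poly e d₂ :=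
  ((id e).node h₁).comp h₂

open Classical in
theorem ite {p : Γ → Prop} (hp : Poly e fun γ => encodeBool (decide (p γ)))
    (h₁ : Poly e d₁) (h₂ : Poly e d₂) : Poly e fun γ => if p γ then d₁ γ else d₂ γ := by
  obtain ⟨B, b, hB⟩ := hp
  obtain ⟨P, p, hP⟩ := h₁
  obtain ⟨Q, q, hQ⟩ := h₂
  refine ⟨.ite B P Q, b + p + q + .X, fun γ => ?_⟩
  obtain ⟨r, hr, hEr⟩ := hB γ
  obtain ⟨s, hs, hEs⟩ := hP γ
  obtain ⟨t, ht, hEt⟩ := hQ γ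
  simp only [Polynomial.eval_add, Polynomial.eval_X]
  split_ifs with h
  · simp only [h, decide_true, encodeBool] at hEr
    exact ⟨_, by omega, .ite_true hEr hEs⟩
  · simp only [h, decide_false, encodeBool] at hEr
    exact ⟨_, by omega, .ite_false hEr hEt⟩

theorem encodeNat_succ (k : ℕ) : encodeNat (k + 1) = .node .leaf (encodeNat k) := by
  simp [encodeNat, List.replicate_succ, encodeList]

theorem size_encodeNat (k : ℕ) : (encodeNat k).size = 2 * k + 1 := by
  induction k with
  | zero => simp [encodeNat, encodeList, Data.size]
  | succ k ih => rw [encodeNat_succ]; simp only [Data.size, ih]; omega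

/-- The basic loop: the state `st γ k` is computed for `k = n γ, …, 1, 0`, each time from the
previous state and the unary numeral `k`, provided that all states have polynomial size. -/
theorem loopDown {n : Γ → ℕ} {st : Γ → ℕ → Data} (hn : Poly e fun γ => encodeNat (n γ))
    (hinit : Poly e fun γ => st γ (n γ))
    (hstep : Poly (Γ := (γ : Γ) × Fin (n γ))
      (fun p => .node (.node (e p.1) (encodeNat p.2)) (st p.1 (p.2 + 1))) fun p => st p.1 p.2)
    (hsize : ∃ q : Polynomial ℕ, ∀ γ, ∀ k ≤ n γ, (st γ k).size ≤ q.eval (e γ).size) :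
    Poly e fun γ => st γ 0 := by
  obtain ⟨q, hq⟩ := hsize
  obtain ⟨m, hm⟩ := hn.size_le
  obtain ⟨Q, r, hQ⟩ := hstep
  -- the loop runs on `(e, (k, st k))`
  let S : Γ → ℕ → Data := fun γ k => .node (e γ) (.node (encodeNat k) (st γ k))
  let z : Polynomial ℕ := 3 + .X + m + q
  have hz : ∀ γ, ∀ k ≤ n γ, (S γ k).size ≤ z.eval (e γ).size := by
    intro γ k hk
    have h1 := hm γ
    have h2 := hq γ k hk
    rw [size_encodeNat] at h1
    simp only [S, Data.size, size_encodeNat, z, Polynomial.eval_add, Polynomial.eval_X,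
      Polynomial.eval_ofNat]
    omega
  let cnt : Prog := .seq .tl .hd
  have hcnt : ∀ γ k, ∃ t, t ≤ 3 * (S γ k).size ∧ Prog.Eval cnt (S γ k) (encodeNat k) t := by
    intro γ k
    refine ⟨_, ?_, .seq (.tl_node _ _) (.hd_node _ _)⟩
    simp only [S, Data.size]; omega
  let cnt' : Prog := .seq cnt .tl
  have hcnt' : ∀ γ k, ∃ t, t ≤ 5 * (S γ (k + 1)).size ∧
      Prog.Eval cnt' (S γ (k + 1)) (encodeNat k) t := by
    intro γ k
    obtain ⟨t, ht, hE⟩ := hcnt γ (k + 1)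
    rw [encodeNat_succ] at hE
    refine ⟨_, ?_, .seq hE (.tl_node _ _)⟩
    rw [← encodeNat_succ]
    have : (encodeNat (k + 1)).size ≤ (S γ (k + 1)).size := by
      simp only [S, Data.size]; omega
    omega
  let body : Prog := .pair .hd (.pair cnt' (.seq (.pair (.pair .hd cnt') (.seq .tl .tl)) Q))
  let b : Polynomial ℕ := 40 * z + r.comp (40 * z)
  have hbody : ∀ γ, ∀ k < n γ, ∃ t, t ≤ b.eval (e γ).size ∧
      Prog.Eval body (S γ (k + 1)) (S γ k) t := by
    intro γ k hk
    obtain ⟨t, ht, hE⟩ := hcnt' γ k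
    obtain ⟨u, hu, hF⟩ := hQ ⟨γ, ⟨k, hk⟩⟩
    have h1 := hz γ (k + 1) hk
    refine ⟨_, ?_, .pair (.hd_node _ _) (.pair hE (.seq (.pair (.pair (.hd_node _ _) hE)
      (.seq (.tl_node _ _) (.tl_node _ _))) hF))⟩
    have h2 : r.eval (Data.node (Data.node (e γ) (encodeNat k)) (st γ (k + 1))).size ≤
        r.eval (40 * z.eval (e γ).size) := by
      apply eval_mono_nat
      refine le_trans ?_ (Nat.mul_le_mul_left 40 h1)
      simp only [S, Data.size, size_encodeNat]; omega
    have h3 : (Data.node (encodeNat (k + 1)) (st γ (k + 1))).size ≤ (S γ (k + 1)).size := by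
      simp only [S, Data.size]; omega
    have h5 := Nat.mul_le_mul_left 40 h1
    simp only [b, Polynomial.eval_add, Polynomial.eval_mul, Polynomial.eval_comp,
      Polynomial.eval_ofNat]
    change _ ≤ 40 * z.eval (e γ).size + r.eval (40 * z.eval (e γ).size)
    change u ≤ r.eval (Data.node (Data.node (e γ) (encodeNat k)) (st γ (k + 1))).size at hu
    have h6 : (Data.node (e γ) (.node (encodeNat (k + 1)) (st γ (k + 1)))).size =
        (S γ (k + 1)).size := rfl
    omega
  let c : Polynomial ℕ := b + 4 * z
  have hloop : ∀ γ, ∀ k ≤ n γ, ∃ t, t ≤ (k + 1) * c.eval (e γ).size ∧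
      Prog.Eval (.loop cnt body) (S γ k) (S γ 0) t := by
    intro γ k
    have hc : ∀ k ≤ n γ, 4 * (S γ k).size ≤ 4 * z.eval (e γ).size := fun k hk =>
      Nat.mul_le_mul_left 4 (hz γ k hk)
    have hce : c.eval (e γ).size = b.eval (e γ).size + 4 * z.eval (e γ).size := by
      simp [c, Polynomial.eval_add, Polynomial.eval_mul]
    induction k with
    | zero =>
      intro hk
      obtain ⟨t, ht, hE⟩ := hcnt γ 0
      refine ⟨_, ?_, .loop_done hE⟩
      have := hc 0 hk
      rw [hce]; omega
    | succ k ih =>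
      intro hk
      obtain ⟨t, ht, hE⟩ := hcnt γ (k + 1)
      rw [encodeNat_succ] at hE
      obtain ⟨u, hu, hF⟩ := hbody γ k hk
      obtain ⟨w, hw, hG⟩ := ih (by omega)
      refine ⟨_, ?_, .loop_step hE hF hG⟩
      have := hc (k + 1) hk
      rw [hce] at hw ⊢
      linarith
  have hfin : Poly e fun γ => S γ 0 := by
    refine comp (d₁ := fun γ => S γ (n γ)) ((id e).node (hn.node hinit)) ?_
    -- the first argument of the loop is at least as large as `e γ` and its counter
    refine ⟨.loop cnt body, (.X + 1) * c.comp .X, fun γ => ?_⟩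
    obtain ⟨t, ht, hE⟩ := hloop γ (n γ) le_rfl
    refine ⟨t, ht.trans ?_, hE⟩
    simp only [Polynomial.eval_mul, Polynomial.eval_add, Polynomial.eval_X, Polynomial.eval_one,
      Polynomial.comp_X]
    have h1 : n γ ≤ (S γ (n γ)).size := by simp only [S, Data.size, size_encodeNat]; omega
    have h2 : (e γ).size ≤ (S γ (n γ)).size := by simp only [S, Data.size]; omega
    exact Nat.mul_le_mul (by omega) (eval_mono_nat c h2)
  exact hfin.snd.snd

end Poly

namespace Poly

variable {Γ : Type} {e d d₁ d₂ d₃ : Γ → Data}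

/-- Results computed from `e` alone are available when more data has been stored. -/
theorem weaken {Δ : Type} {f : Δ → Γ} {x : Δ → Data} (h : Poly e d) :
    Poly (fun δ => .node (e (f δ)) (x δ)) fun δ => d (f δ) :=
  (Poly.id _).fst.comp (h.reindex f)

/-- The case `f = id` of `Poly.weaken`. -/
theorem keep {x : Γ → Data} (h : Poly e d) : Poly (fun γ => .node (e γ) (x γ)) d :=
  (Poly.id _).fst.comp h

/-- The case of `Poly.weaken` in which an index is added to the instance. -/
theorem lift {n : Γ → ℕ} (h : Poly e d) :
    Poly (fun p : (γ : Γ) × Fin (n γ) => .node (e p.1) (encodeNat p.2)) fun p => d p.1 :=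
  h.weaken

theorem tail {l : Γ → List Data} (h : Poly e fun γ => encodeList (l γ)) :
    Poly e fun γ => encodeList (l γ).tail := by
  refine h.comp ⟨.tl, .X, fun γ => ⟨(encodeList (l γ)).size, by simp, ?_⟩⟩
  rcases hl : l γ with _ | ⟨a, l'⟩ <;> simp only [hl]
  · exact .tl_leaf
  · exact .tl_node _ _

theorem size_encodeList_tail (l : List Data) : (encodeList l.tail).size ≤ (encodeList l).size := by
  cases l with
  | nil => exact le_rfl
  | cons a l => simp only [List.tail_cons, encodeList, Data.size]; omega

theorem size_encodeList_drop (l : List Data) (k : ℕ) :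
    (encodeList (l.drop k)).size ≤ (encodeList l).size := by
  induction k with
  | zero => simp
  | succ k ih => rw [← List.tail_drop]; exact (size_encodeList_tail _).trans ih

theorem drop {l : Γ → List Data} {k : Γ → ℕ} (h : Poly e fun γ => encodeList (l γ))
    (hk : Poly e fun γ => encodeNat (k γ)) : Poly e fun γ => encodeList ((l γ).drop (k γ)) := by
  have := loopDown (e := e) (st := fun γ j => encodeList ((l γ).drop (k γ - j))) hk
    (by simpa using h) ?_ ?_
  · simpa using this
  · have h1 : Poly (Γ := (γ : Γ) × Fin (k γ)) (fun p => Data.node (.node (e p.1) (encodeNat p.2))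
        (encodeList ((l p.1).drop (k p.1 - (p.2 + 1))))) _ := (Poly.id _).snd.tail
    convert h1 using 2 with p
    rw [List.tail_drop]
    congr 2
    omega
  · obtain ⟨q, hq⟩ := h.size_le
    exact ⟨q, fun γ j _ => (size_encodeList_drop _ _).trans (hq γ)⟩

theorem lookup {m : Γ → ℕ} {T : ∀ γ, Fin (m γ) → Data} {x : ∀ γ, Fin (m γ)}
    (hT : Poly e fun γ => encodeList (List.ofFn (T γ))) (hx : Poly e fun γ => encodeNat (x γ)) :
    Poly e fun γ => T γ (x γ) := by
  have h := hT.drop hx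
  refine fst (d₂ := fun γ => encodeList ((List.ofFn (T γ)).drop (x γ + 1))) ?_
  convert h using 2 with γ
  rw [List.drop_eq_getElem_cons (i := x γ) (by simp)]
  simp [encodeList]

theorem lookupFun {α : Type} {m : Γ → ℕ} {enc : α → Data} {T : ∀ γ, Fin (m γ) → α}
    {x : ∀ γ, Fin (m γ)}
    (hT : Poly e fun γ => encodeFun fun i => enc (T γ i)) (hx : Poly e fun γ => encodeNat (x γ)) :
    Poly e fun γ => enc (T γ (x γ)) :=
  lookup (T := fun γ i => enc (T γ i)) hT hx

theorem lookupConst {m : ℕ} {T : Γ → Fin m → Data}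
    (hT : Poly e fun γ => encodeFun (T γ)) (i : Fin m) : Poly e fun γ => T γ i :=
  lookup (m := fun _ => m) (x := fun _ => i) hT (const _ _)

theorem encodeFunConst {m : ℕ} {T : Γ → Fin m → Data} (h : ∀ i, Poly e fun γ => T γ i) :
    Poly e fun γ => encodeFun (T γ) := by
  induction m with
  | zero => simpa [encodeFun, encodeList] using leaf e
  | succ m ih =>
    simpa [encodeFun, encodeList, List.ofFn_succ] using
      (h 0).node (ih (T := fun γ i => T γ i.succ) fun i => h i.succ)

end Poly

/-- The encoding of an instance together with one of finitely many indices. -/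
abbrev ext {Γ : Type} (e : Γ → Data) (n : Γ → ℕ) : ((γ : Γ) × Fin (n γ)) → Data :=
  fun p => .node (e p.1) (encodeNat p.2)

open Classical in
/-- The predicate `p` is decided in polynomial time. -/
def Dec {Γ : Type} (e : Γ → Data) (p : Γ → Prop) : Prop :=
  Poly e fun γ => encodeBool (decide (p γ))

namespace Dec

variable {Γ : Type} {e : Γ → Data} {p q : Γ → Prop} {n : Γ → ℕ}

theorem congr (h : Dec e p) (hpq : ∀ γ, p γ ↔ q γ) : Dec e q := by
  rwa [show q = p from funext fun γ => propext (hpq γ).symm]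

theorem keep {x : Γ → Data} (h : Dec e p) : Dec (fun γ => .node (e γ) (x γ)) p :=
  Poly.keep h

theorem lift (h : Dec e p) : Dec (ext e n) fun x => p x.1 :=
  Poly.lift h

theorem store {d : Γ → Data} (h₁ : Poly e d) (h₂ : Dec (fun γ => .node (e γ) (d γ)) p) : Dec e p :=
  Poly.store h₁ h₂

theorem true (e : Γ → Data) : Dec e fun _ => True := Poly.const _ _

theorem false (e : Γ → Data) : Dec e fun _ => False := Poly.const _ _

theorem const (e : Γ → Data) (a : Prop) : Dec e fun _ => a := Poly.const _ _

theorem ite (hp : Dec e p) {r : Γ → Prop} (hq : Dec e q) (hr : Dec e r) :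
    Dec e fun γ => (p γ ∧ q γ) ∨ (¬ p γ ∧ r γ) := by
  have := Poly.ite hp hq hr
  unfold Dec
  convert this using 2 with γ
  by_cases h : p γ <;> simp only [h, if_true, if_false] <;> congr 1 <;> simp <;> tauto

theorem not (hp : Dec e p) : Dec e fun γ => ¬ p γ :=
  (hp.ite (Dec.false e) (Dec.true e)).congr fun _ => by tauto

theorem and (hp : Dec e p) (hq : Dec e q) : Dec e fun γ => p γ ∧ q γ :=
  (hp.ite hq (Dec.false e)).congr fun _ => by tauto

theorem or (hp : Dec e p) (hq : Dec e q) : Dec e fun γ => p γ ∨ q γ :=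
  (hp.ite (Dec.true e) hq).congr fun _ => by tauto

theorem imp (hp : Dec e p) (hq : Dec e q) : Dec e fun γ => p γ → q γ :=
  (hp.ite hq (Dec.true e)).congr fun _ => by tauto

theorem iff (hp : Dec e p) (hq : Dec e q) : Dec e fun γ => p γ ↔ q γ :=
  (hp.ite hq hq.not).congr fun _ => by tauto

/-- Quantification over a fixed finite type is resolved by the program text. -/
theorem exFixed {ι : Type} [Finite ι] {p : ι → Γ → Prop} (h : ∀ i, Dec e (p i)) :
    Dec e fun γ => ∃ i, p i γ := by
  have := Fintype.ofFinite ι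
  have key : ∀ s : Finset ι, Dec e fun γ => ∃ i ∈ s, p i γ := by
    classical
    intro s
    induction s using Finset.induction_on with
    | empty => exact (Dec.false e).congr (by simp)
    | insert a s _ ih => exact ((h a).or ih).congr (by simp)
  exact (key Finset.univ).congr (by simp)

theorem allFixed {ι : Type} [Finite ι] {p : ι → Γ → Prop} (h : ∀ i, Dec e (p i)) :
    Dec e fun γ => ∀ i, p i γ :=
  (exFixed fun i => (h i).not).not.congr (by simp)

/-- Quantification over `Fin n`, where `n` depends on the instance, is a loop. -/
theorem ex (hn : Poly e fun γ => encodeNat (n γ)) {p : ∀ γ, Fin (n γ) → Prop}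
    (h : Dec (ext e n) fun x => p x.1 x.2) : Dec e fun γ => ∃ i, p γ i := by
  classical
  have := Poly.loopDown (e := e) (n := n)
    (st := fun γ k => encodeBool (decide (∃ i : Fin (n γ), k ≤ i ∧ p γ i))) hn ?_ ?_ ?_
  · unfold Dec
    convert this using 3
    simp
  · convert Poly.const e (encodeBool .false) with γ
    rw [decide_eq_false_iff_not]
    rintro ⟨i, hi, -⟩
    omega
  · have h1 := h.keep (x := fun x : (γ : Γ) × Fin (n γ) =>
      encodeBool (decide (∃ i : Fin (n x.1), x.2 + 1 ≤ (i : ℕ) ∧ p x.1 i)))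
    have h2 : Dec (fun x : (γ : Γ) × Fin (n γ) => .node (ext e n x)
      (encodeBool (decide (∃ i : Fin (n x.1), x.2 + 1 ≤ (i : ℕ) ∧ p x.1 i))))
      fun x => ∃ i : Fin (n x.1), x.2 + 1 ≤ (i : ℕ) ∧ p x.1 i := by
      unfold Dec
      convert (Poly.id _).snd
    have h3 := (h1.or h2).congr (q := fun x => ∃ i : Fin (n x.1), (x.2 : ℕ) ≤ i ∧ p x.1 i) ?_
    · unfold Dec at h3
      convert h3
    · intro x
      constructor
      · rintro (h | ⟨i, hi, h⟩)
        · exact ⟨x.2, le_rfl, h⟩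
        · exact ⟨i, by omega, h⟩
      · rintro ⟨i, hi, h⟩
        rcases hi.eq_or_lt with hi | hi
        · left
          rwa [show x.2 = i from Fin.ext hi]
        · exact Or.inr ⟨i, hi, h⟩
  · refine ⟨3, fun γ k _ => ?_⟩
    cases decide (∃ i : Fin (n γ), k ≤ i ∧ p γ i) <;> simp [encodeBool, Data.size]

theorem all (hn : Poly e fun γ => encodeNat (n γ)) {p : ∀ γ, Fin (n γ) → Prop}
    (h : Dec (ext e n) fun x => p x.1 x.2) : Dec e fun γ => ∀ i, p γ i :=
  (ex (p := fun γ i => ¬ p γ i) hn h.not).not.congr (by simp)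

theorem eq_nil {l : Γ → List Data} (h : Poly e fun γ => encodeList (l γ)) :
    Dec e fun γ => l γ = [] := by
  refine Poly.comp h ⟨.ite .skip .nil (.pair .nil .nil), 10 * .X, fun γ => ?_⟩
  simp only [Polynomial.eval_mul, Polynomial.eval_X, Polynomial.eval_ofNat]
  by_cases hl : l γ = []
  · simp only [hl, decide_true, encodeBool, encodeList]
    refine ⟨_, ?_, .ite_false (.skip _) (.pair (.nil _) (.nil _))⟩
    simp only [Data.size]; omega
  · obtain ⟨a, l', hl'⟩ := List.exists_cons_of_ne_nil hl
    simp only [hl, decide_false, encodeBool]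
    simp only [hl', encodeList]
    refine ⟨_, ?_, .ite_true (.skip _) (.nil _)⟩
    simp only [Data.size]; omega

theorem le {x y : Γ → ℕ} (hx : Poly e fun γ => encodeNat (x γ))
    (hy : Poly e fun γ => encodeNat (y γ)) : Dec e fun γ => x γ ≤ y γ :=
  (eq_nil (Poly.drop hx hy)).congr fun γ => by simp [Nat.sub_eq_zero_iff_le]

theorem eq {m : Γ → ℕ} {x y : ∀ γ, Fin (m γ)} (hx : Poly e fun γ => encodeNat (x γ))
    (hy : Poly e fun γ => encodeNat (y γ)) : Dec e fun γ => x γ = y γ :=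
  ((le hx hy).and (le hy hx)).congr fun γ => by rw [Fin.ext_iff]; omega

end Dec

namespace Poly

variable {Γ : Type} {e : Γ → Data} {n : Γ → ℕ}

theorem ofDec {p : Γ → Prop} [∀ γ, Decidable (p γ)] (h : Dec e p) :
    Poly e fun γ => encodeBool (decide (p γ)) := by
  unfold Dec at h
  convert h

theorem var (e : Γ → Data) (n : Γ → ℕ) : Poly (ext e n) fun x => encodeNat x.2 :=
  (Poly.id (ext e n)).snd

theorem base (e : Γ → Data) (n : Γ → ℕ) : Poly (ext e n) fun x => e x.1 :=
  (Poly.id (ext e n)).fst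

theorem size_encodeList_le (l : List Data) (s : ℕ) (h : ∀ a ∈ l, a.size ≤ s) :
    (encodeList l).size ≤ l.length * (s + 1) + 1 := by
  induction l with
  | nil => simp [encodeList, Data.size]
  | cons a l ih =>
    have h1 := ih fun b hb => h b (List.mem_cons_of_mem _ hb)
    have h2 := h a List.mem_cons_self
    simp only [encodeList, Data.size, List.length_cons]
    linarith

theorem size_encodeFun_le {m : ℕ} (f : Fin m → Data) (s : ℕ) (h : ∀ i, (f i).size ≤ s) :
    (encodeFun f).size ≤ m * (s + 1) + 1 := by
  have := size_encodeList_le (List.ofFn f) s (by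
    intro a ha
    obtain ⟨i, rfl⟩ := (List.mem_ofFn' f a).1 ha
    exact h i)
  simpa [encodeFun] using this

theorem tabulate (hn : Poly e fun γ => encodeNat (n γ)) {d : ∀ γ, Fin (n γ) → Data}
    (h : Poly (ext e n) fun x => d x.1 x.2) : Poly e fun γ => encodeFun (d γ) := by
  have := loopDown (e := e) (n := n) (st := fun γ k => encodeList ((List.ofFn (d γ)).drop k)) hn
    ?_ ?_ ?_
  · simpa [encodeFun] using this
  · convert leaf e with γ
    rw [List.drop_of_length_le (by simp)]
    rfl
  · have h1 := (h.keep (x := fun x : (γ : Γ) × Fin (n γ) =>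
      encodeList ((List.ofFn (d x.1)).drop (x.2 + 1)))).node (Poly.id _).snd
    convert h1 using 2 with x
    rw [List.drop_eq_getElem_cons (i := x.2) (by simp)]
    simp [encodeList]
  · obtain ⟨p, hp⟩ := hn.size_le
    obtain ⟨q, hq⟩ := h.size_le
    refine ⟨p * (q.comp (1 + .X + p) + 1) + 1, fun γ k _ => (size_encodeList_drop _ _).trans ?_⟩
    have h1 := hp γ
    rw [size_encodeNat] at h1
    refine (size_encodeFun_le (d γ) (q.eval (1 + (e γ).size + p.eval (e γ).size)) ?_).trans ?_
    · intro i
      refine (hq ⟨γ, i⟩).trans (eval_mono_nat q ?_)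
      simp only [Data.size, size_encodeNat]
      omega
    · simp only [Polynomial.eval_add, Polynomial.eval_mul, Polynomial.eval_comp,
        Polynomial.eval_one, Polynomial.eval_X]
      gcongr
      omega

theorem iterate {S : Γ → Type} {enc : ∀ γ, S γ → Data} {f : ∀ γ, S γ → S γ} {s : ∀ γ, S γ}
    (hn : Poly e fun γ => encodeNat (n γ)) (hs : Poly e fun γ => enc γ (s γ))
    (hf : Poly (Γ := (γ : Γ) × S γ) (fun x => .node (e x.1) (enc x.1 x.2))
      fun x => enc x.1 (f x.1 x.2))
    (hsize : ∃ q : Polynomial ℕ, ∀ γ t, (enc γ t).size ≤ q.eval (e γ).size) :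
    Poly e fun γ => enc γ ((f γ)^[n γ] (s γ)) := by
  have := loopDown (e := e) (n := n) (st := fun γ k => enc γ ((f γ)^[n γ - k] (s γ))) hn
    (by simpa using hs) ?_ ?_
  · simpa using this
  · let F : ((γ : Γ) × Fin (n γ)) → ((γ : Γ) × S γ) := fun x =>
      ⟨x.1, (f x.1)^[n x.1 - (x.2 + 1)] (s x.1)⟩
    have h1 := hf.reindex F
    have h2 : Poly (fun x : (γ : Γ) × Fin (n γ) => Data.node (ext e n x)
        (enc x.1 ((f x.1)^[n x.1 - (x.2 + 1)] (s x.1))))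
        (fun x => Data.node (e x.1) (enc x.1 ((f x.1)^[n x.1 - (x.2 + 1)] (s x.1)))) :=
      (Poly.id _).fst.fst.node (Poly.id _).snd
    convert h2.comp h1 using 2 with x
    simp only [Function.comp, F]
    rw [← Function.iterate_succ_apply' (f x.1)]
    congr 2
    omega
  · obtain ⟨q, hq⟩ := hsize
    exact ⟨q, fun γ k _ => hq γ _⟩

end Poly

/-! ### Binary constraints on lists of two colours -/

/-- A map that decreases a measure unless it fixes its argument reaches a fixed point. -/
theorem iterate_fixed_of_measure {α : Type} {f : α → α} (μ : α → ℕ)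
    (h : ∀ x, f x = x ∨ μ (f x) < μ x) : ∀ (k : ℕ) (x : α), μ x ≤ k → f (f^[k] x) = f^[k] x := by
  intro k
  induction k with
  | zero =>
    intro x hx
    rcases h x with h | h
    · exact h
    · omega
  | succ k ih =>
    intro x hx
    rw [Function.iterate_succ_apply]
    rcases h x with h' | h'
    · rw [h', Function.iterate_fixed h', h']
    · exact ih (f x) (by omega)

section CSP

variable {V : Type} (M : V → Fin 4 → Prop) (conf : V → Fin 4 → V → Fin 4 → Prop)

/-- Giving `a.1` the value `a.2` forces the value `b.2` on `b.1`: every other value in the list of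
`b.1` is in conflict with it. (A list whose values are all in conflict with it has all its values
forced, hence a conflict.) -/
def Forces (a b : V × Fin 4) : Prop :=
  M b.1 b.2 ∧ ∀ d, M b.1 d → d ≠ b.2 → conf a.1 a.2 b.1 d

/-- With lists of size at most two, binary constraints are satisfiable as soon as every variable has
a value whose forced consequences are free of conflicts: such a set of consequences does not
restrict the variables outside it, so maximal sets of this kind assign all variables. -/
theorem binary_constraints_iff [Finite V] (two : ∀ x, ∃ i j, ∀ c, M x c → c = i ∨ c = j)
    (symm : ∀ x c y d, conf x c y d → conf y d x c) :
    (∃ f : V → Fin 4, (∀ x, M x (f x)) ∧ ∀ x y, ¬ conf x (f x) y (f y)) ↔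
      ∀ x, ∃ c, M x c ∧ ∀ a b, Relation.ReflTransGen (Forces M conf) (x, c) a →
        Relation.ReflTransGen (Forces M conf) (x, c) b → ¬ conf a.1 a.2 b.1 b.2 := by
  constructor
  · rintro ⟨f, hf, hc⟩ x
    have key : ∀ a, Relation.ReflTransGen (Forces M conf) (x, f x) a → f a.1 = a.2 := by
      intro a ha
      induction ha with
      | refl => rfl
      | tail _ h ih =>
        rename_i b c _
        by_contra hne
        have := h.2 _ (hf c.1) hne
        rw [← ih] at this
        exact hc _ _ this
    refine ⟨f x, hf x, fun a b ha hb => ?_⟩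
    rw [← key a ha, ← key b hb]
    exact hc _ _
  · intro h
    let good : Set (V × Fin 4) → Prop := fun T =>
      (∀ a ∈ T, M a.1 a.2) ∧ (∀ a ∈ T, ∀ b, Forces M conf a b → b ∈ T) ∧
        ∀ a ∈ T, ∀ b ∈ T, ¬ conf a.1 a.2 b.1 b.2
    obtain ⟨T, ⟨hTM, hTF, hTC⟩, hmax⟩ : ∃ T, Maximal good T :=
      (Set.toFinite {T | good T}).exists_maximal ⟨∅, by simp [good]⟩
    have total : ∀ x, ∃ c, (x, c) ∈ T := by
      intro x
      by_contra! hx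
      obtain ⟨c, hMc, hcf⟩ := h x
      let R : Set (V × Fin 4) := {a | Relation.ReflTransGen (Forces M conf) (x, c) a}
      have hRM : ∀ a ∈ R, M a.1 a.2 := by
        intro a ha
        rcases Relation.ReflTransGen.cases_tail ha with h | ⟨b, _, h⟩
        · rw [h]; exact hMc
        · exact h.1
      -- a member of `T` in conflict with `b` forces the other value of `b.1`
      have force : ∀ a ∈ T, ∀ b : V × Fin 4, M b.1 b.2 → conf a.1 a.2 b.1 b.2 →
          ∃ d, (b.1, d) ∈ T ∧ (d = b.2 ∨ M b.1 d ∧ d ≠ b.2) := by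
        intro a ha b hb hab
        by_cases hd : ∃ d, M b.1 d ∧ d ≠ b.2
        · obtain ⟨d, hd, hne⟩ := hd
          refine ⟨d, hTF a ha _ ⟨hd, fun d' hd' hne' => ?_⟩, Or.inr ⟨hd, hne⟩⟩
          obtain ⟨i, j, hij⟩ := two b.1
          have h1 := hij _ hd
          have h2 := hij _ hd'
          have h3 := hij _ hb
          have : d' = b.2 := by
            dsimp only at hne'
            rcases h1 with h1 | h1 <;> rcases h2 with h2 | h2 <;> rcases h3 with h3 | h3 <;>
              simp_all
          rw [this]
          exact hab
        · push Not at hd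
          exact ⟨b.2, hTF a ha _ ⟨hb, fun d hd' hne => absurd (hd d hd') hne⟩, Or.inl rfl⟩
      have hRT : ∀ b ∈ R, ∀ a ∈ T, ¬ conf a.1 a.2 b.1 b.2 := by
        intro b hb
        induction hb with
        | refl =>
          intro a ha hab
          obtain ⟨d, hd, -⟩ := force a ha (x, c) hMc hab
          exact hx d hd
        | tail _ hf ih =>
          rename_i b' b hb'
          intro a ha hab
          obtain ⟨d, hd, rfl | ⟨hM, hne⟩⟩ := force a ha b hf.1 hab
          · exact hTC a ha _ hd hab
          · exact ih _ hd (symm _ _ _ _ (hf.2 d hM hne))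
      have hgood : good (T ∪ R) := by
        refine ⟨?_, ?_, ?_⟩
        · rintro a (ha | ha)
          exacts [hTM a ha, hRM a ha]
        · rintro a (ha | ha) b hab
          exacts [Or.inl (hTF a ha b hab), Or.inr (Relation.ReflTransGen.tail ha hab)]
        · rintro a (ha | ha) b (hb | hb) hab
          exacts [hTC a ha b hb hab, hRT b hb a ha hab, hRT a ha b hb (symm _ _ _ _ hab),
            hcf a b ha hb hab]
      exact hx c (hmax hgood Set.subset_union_left (Or.inr Relation.ReflTransGen.refl))
    choose f hf using total
    exact ⟨f, fun x => hTM _ (hf x), fun x y => hTC _ (hf x) _ (hf y)⟩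

open Classical in
/-- One round of forcing, on sets of variables with values. -/
noncomputable def forceStep (S : V → Finset (Fin 4)) (x : V) : Finset (Fin 4) :=
  {d | d ∈ S x ∨ ∃ y, ∃ c ∈ S y, Forces M conf (y, c) (x, d)}

theorem mem_forceStep {S : V → Finset (Fin 4)} {x : V} {d : Fin 4} :
    d ∈ forceStep M conf S x ↔ d ∈ S x ∨ ∃ y, ∃ c, c ∈ S y ∧ (M x d ∧
      ∀ d', d' ≠ d → M x d' → conf y c x d') := by
  classical
  rw [forceStep, Finset.mem_filter]
  simp only [Forces, Finset.mem_univ, true_and]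
  refine or_congr Iff.rfl (exists_congr fun y => exists_congr fun c => and_congr_right fun _ =>
    and_congr_right fun _ => forall_congr' fun d' => ?_)
  tauto

open Classical in
/-- The set with the single member `(x, c)`. -/
noncomputable def forceInit (x : V) (c : Fin 4) (y : V) : Finset (Fin 4) :=
  if y = x then {c} else ∅

/-- Every round of forcing adds a member until all consequences are reached, so `4 * |V|` rounds
suffice. -/
theorem mem_forceStep_iterate [Fintype V] (x : V) (c : Fin 4) (y : V) (d : Fin 4) :
    d ∈ (forceStep M conf)^[4 * Fintype.card V] (forceInit x c) y ↔
      Relation.ReflTransGen (Forces M conf) (x, c) (y, d) := by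
  have hmono : ∀ S y, S y ⊆ forceStep M conf S y := fun S y d hd => by
    simp [forceStep, hd]
  constructor
  · generalize 4 * Fintype.card V = k
    induction k generalizing y d with
    | zero =>
      simp only [Function.iterate_zero, id, forceInit]
      split_ifs with h
      · rw [Finset.mem_singleton]; rintro rfl; rw [h]
      · simp
    | succ k ih =>
      rw [Function.iterate_succ_apply']
      intro h
      simp only [forceStep, Finset.mem_filter, Finset.mem_univ, true_and] at h
      rcases h with h | ⟨z, b, h, hF⟩
      · exact ih y d h
      · exact (ih z b h).tail hF
  · have hfix := iterate_fixed_of_measure (f := forceStep M conf)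
      (fun S => ∑ x, (4 - (S x).card)) (by
        intro S
        by_cases h : forceStep M conf S = S
        · exact Or.inl h
        · right
          obtain ⟨y, hy⟩ := Function.ne_iff.1 h
          refine Finset.sum_lt_sum (fun x _ => Nat.sub_le_sub_left
            (Finset.card_le_card (hmono S x)) _) ⟨y, Finset.mem_univ _, ?_⟩
          have h1 := Finset.card_lt_card ((hmono S y).ssubset_of_ne (Ne.symm hy))
          have h2 := card_finset_fin_le (forceStep M conf S y)
          omega) (4 * Fintype.card V) (forceInit x c) (by
        refine (Finset.sum_le_card_nsmul _ _ 4 fun x _ => Nat.sub_le _ _).trans ?_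
        simp [mul_comm])
    have hmono' : ∀ k y, forceInit x c y ⊆ (forceStep M conf)^[k] (forceInit x c) y := by
      intro k
      induction k with
      | zero => exact fun y => subset_rfl
      | succ k ih =>
        intro y
        rw [Function.iterate_succ_apply']
        exact (ih y).trans (hmono _ y)
    suffices ∀ b : V × Fin 4, Relation.ReflTransGen (Forces M conf) (x, c) b →
        b.2 ∈ (forceStep M conf)^[4 * Fintype.card V] (forceInit x c) b.1 from this (y, d)
    intro b hb
    induction hb with
    | refl => exact hmono' _ _ (by simp [forceInit])
    | tail _ h ih =>
      rename_i b b' _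
      rw [← hfix]
      simp only [forceStep, Finset.mem_filter, Finset.mem_univ, true_and]
      exact Or.inr ⟨b.1, b.2, ih, h⟩

end CSP

section

variable {Γ : Type} {e : Γ → Data} {n : Γ → ℕ}

theorem Poly.subst {Δ : Type} {e' : Δ → Data} {d : ((γ : Γ) × Fin (n γ)) → Data}
    (h : Poly (ext e n) d) {g : Δ → Γ} {x : ∀ δ, Fin (n (g δ))} (hg : Poly e' fun δ => e (g δ))
    (hx : Poly e' fun δ => encodeNat (x δ)) : Poly e' fun δ => d ⟨g δ, x δ⟩ :=
  (hg.node hx).comp (h.reindex fun δ => ⟨g δ, x δ⟩)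

theorem Dec.subst {Δ : Type} {e' : Δ → Data} {p : ∀ γ, Fin (n γ) → Prop}
    (h : Dec (ext e n) fun x => p x.1 x.2) {g : Δ → Γ} {x : ∀ δ, Fin (n (g δ))}
    (hg : Poly e' fun δ => e (g δ)) (hx : Poly e' fun δ => encodeNat (x δ)) :
    Dec e' fun δ => p (g δ) (x δ) :=
  Poly.subst h hg hx

theorem Dec.subst₂ {Δ : Type} {e' : Δ → Data} {p : ∀ γ, Fin (n γ) → Fin (n γ) → Prop}
    (h : Dec (ext (ext e n) fun x => n x.1) fun x => p x.1.1 x.1.2 x.2) {g : Δ → Γ}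
    {x y : ∀ δ, Fin (n (g δ))} (hg : Poly e' fun δ => e (g δ))
    (hx : Poly e' fun δ => encodeNat (x δ)) (hy : Poly e' fun δ => encodeNat (y δ)) :
    Dec e' fun δ => p (g δ) (x δ) (y δ) :=
  ((hg.node hx).node hy).comp
    (Poly.reindex (fun δ => (⟨⟨g δ, x δ⟩, y δ⟩ : (p : (γ : Γ) × Fin (n γ)) × Fin (n p.1))) h)

theorem Dec.mem_colors {T : Γ → Finset (Fin 4)} (h : Poly e fun γ => encodeColors (T γ))
    (c : Fin 4) : Dec e fun γ => c ∈ T γ := by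
  have := Poly.lookupConst h c
  unfold Dec
  convert this

theorem Dec.mem_table {m : Γ → ℕ} {T : ∀ γ, Fin (m γ) → Finset (Fin 4)} {x : ∀ γ, Fin (m γ)}
    (hT : Poly e fun γ => encodeFun fun i => encodeColors (T γ i))
    (hx : Poly e fun γ => encodeNat (x γ)) (c : Fin 4) : Dec e fun γ => c ∈ T γ (x γ) :=
  Dec.mem_colors (Poly.lookupFun (T := T) hT hx) c

theorem Poly.colors {T : Γ → Finset (Fin 4)} (h : ∀ c, Dec e fun γ => c ∈ T γ) :
    Poly e fun γ => encodeColors (T γ) :=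
  Poly.encodeFunConst fun c => Poly.ofDec (h c)

theorem Poly.colorTable (hn : Poly e fun γ => encodeNat (n γ))
    {T : ∀ γ, Fin (n γ) → Finset (Fin 4)} (h : ∀ c, Dec (ext e n) fun x => c ∈ T x.1 x.2) :
    Poly e fun γ => encodeFun fun x => encodeColors (T γ x) :=
  Poly.tabulate hn (d := fun γ x => encodeColors (T γ x)) (Poly.colors h)

theorem Poly.size_colorTable_le (hn : Poly e fun γ => encodeNat (n γ)) :
    ∃ q : Polynomial ℕ, ∀ γ (T : Fin (n γ) → Finset (Fin 4)),
      (encodeFun fun x => encodeColors (T x)).size ≤ q.eval (e γ).size := by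
  obtain ⟨p, hp⟩ := hn.size_le
  refine ⟨18 * p + 1, fun γ T => (Poly.size_encodeFun_le _ 17 fun x => ?_).trans ?_⟩
  · refine (Poly.size_encodeFun_le _ 3 fun c => ?_).trans (by norm_num)
    cases decide (c ∈ T x) <;> simp [encodeBool, Data.size]
  · have h1 := hp γ
    rw [Poly.size_encodeNat] at h1
    simp only [Polynomial.eval_add, Polynomial.eval_mul, Polynomial.eval_ofNat,
      Polynomial.eval_one]
    omega

theorem Poly.add {a b : Γ → ℕ} (ha : Poly e fun γ => encodeNat (a γ))
    (hb : Poly e fun γ => encodeNat (b γ)) : Poly e fun γ => encodeNat (a γ + b γ) := by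
  have := Poly.loopDown (e := e) (st := fun γ k => encodeNat (a γ - k + b γ)) ha
    (by simpa using hb) ?_ ?_
  · simpa using this
  · have h1 : Poly (Γ := (γ : Γ) × Fin (a γ)) (fun p => Data.node (.node (e p.1) (encodeNat p.2))
        (encodeNat (a p.1 - (p.2 + 1) + b p.1))) _ := (Poly.leaf _).node (Poly.id _).snd
    convert h1 using 2 with p
    rw [← Poly.encodeNat_succ]
    congr 1
    omega
  · obtain ⟨p, hp⟩ := ha.size_le
    obtain ⟨q, hq⟩ := hb.size_le
    refine ⟨p + q, fun γ k _ => ?_⟩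
    have h1 := hp γ
    have h2 := hq γ
    simp only [Poly.size_encodeNat, Polynomial.eval_add] at *
    omega

theorem Poly.four_mul (hn : Poly e fun γ => encodeNat (n γ)) :
    Poly e fun γ => encodeNat (4 * n γ) := by
  convert (hn.add hn).add (hn.add hn) using 3
  omega

/-- An instance together with a list of colours for every vertex. -/
abbrev withTable (e : Γ → Data) (n : Γ → ℕ) :
    ((γ : Γ) × (Fin (n γ) → Finset (Fin 4))) → Data :=
  fun x => .node (e x.1) (encodeFun fun i => encodeColors (x.2 i))

theorem Poly.iterate_table (hn : Poly e fun γ => encodeNat (n γ)) {m : Γ → ℕ}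
    (hm : Poly e fun γ => encodeNat (m γ)) {s : ∀ γ, Fin (n γ) → Finset (Fin 4)}
    {f : ∀ γ, (Fin (n γ) → Finset (Fin 4)) → Fin (n γ) → Finset (Fin 4)}
    (hs : Poly e fun γ => encodeFun fun i => encodeColors (s γ i))
    (hf : ∀ d, Dec (ext (withTable e n) fun x => n x.1) fun p => d ∈ f p.1.1 p.1.2 p.2) :
    Poly e fun γ => encodeFun fun i => encodeColors ((f γ)^[m γ] (s γ) i) :=
  Poly.iterate (S := fun γ => Fin (n γ) → Finset (Fin 4))
    (enc := fun _ T => encodeFun fun i => encodeColors (T i)) hm hs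
    (Poly.colorTable hn.weaken hf) (Poly.size_colorTable_le hn)

theorem Dec.mem_forceStep (hn : Poly e fun γ => encodeNat (n γ))
    {M : ∀ γ, Fin (n γ) → Fin 4 → Prop}
    {conf : ∀ γ, Fin (n γ) → Fin 4 → Fin (n γ) → Fin 4 → Prop}
    (hM : ∀ c, Dec (ext e n) fun p => M p.1 p.2 c)
    (hconf : ∀ c d, Dec (ext (ext e n) fun p => n p.1) fun p => conf p.1.1 p.1.2 c p.2 d)
    (d : Fin 4) :
    Dec (ext (withTable e n) fun x => n x.1)
      fun p => d ∈ forceStep (M p.1.1) (conf p.1.1) p.1.2 p.2 := by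
  let E := ext (withTable e n) fun x => n x.1
  have hT : Poly E fun p => encodeFun fun i => encodeColors (p.1.2 i) :=
    (Poly.id (withTable e n)).snd.lift
  have hE : Poly E fun p => e p.1.1 := (Poly.id (withTable e n)).fst.lift
  have hx : Poly E fun p => encodeNat p.2 := Poly.var _ _
  have hy : Poly (ext E fun p => n p.1.1) fun p => encodeNat p.2 := Poly.var _ _
  have h1 : ∀ c, Dec (ext E fun x => n x.1.1) fun x => c ∈ x.1.1.2 x.2 := fun c =>
    Dec.mem_table (e := ext E fun x => n x.1.1) (m := fun x => n x.1.1.1)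
      (T := fun x => x.1.1.2) (x := fun x => x.2) hT.lift hy c
  have h2 : ∀ c, Dec (ext E fun x => n x.1.1) fun x => M x.1.1.1 x.1.2 c := fun c =>
    Dec.subst (e' := ext E fun x => n x.1.1) (p := fun γ x => M γ x c) (hM c)
      (g := fun x => x.1.1.1) (x := fun x => x.1.2) hE.lift hx.lift
  have h3 : ∀ c d, Dec (ext E fun x => n x.1.1) fun x => conf x.1.1.1 x.2 c x.1.2 d := fun c d =>
    Dec.subst₂ (e' := ext E fun x => n x.1.1) (p := fun γ x y => conf γ x c y d) (hconf c d)
      (g := fun x => x.1.1.1) (x := fun x => x.2) (y := fun x => x.1.2) hE.lift hy hx.lift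
  have h4 : Dec E fun x => d ∈ x.1.2 x.2 :=
    Dec.mem_table (e := E) (m := fun x => n x.1.1) (T := fun x => x.1.2) (x := fun x => x.2) hT hx d
  have hn' : Poly (withTable e n) fun x => encodeNat (n x.1) := hn.weaken
  have h5 := Dec.ex (e := E) (n := fun x => n x.1.1) hn'.lift
    (p := fun x y => ∃ c, c ∈ x.1.2 y ∧ (M x.1.1 x.2 d ∧
      ∀ d', d' ≠ d → M x.1.1 x.2 d' → conf x.1.1 y c x.2 d'))
    (Dec.exFixed fun c => (h1 c).and ((h2 d).and (Dec.allFixed fun d' =>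
      (Dec.const _ _).imp ((h2 d').imp (h3 c d')))))
  exact (h4.or h5).congr fun x => (PhaseTwo.mem_forceStep _ _).symm

/-- Binary constraints on lists of at most two colours are decided in polynomial time. -/
theorem Dec.binary_constraints (hn : Poly e fun γ => encodeNat (n γ))
    {M : ∀ γ, Fin (n γ) → Fin 4 → Prop}
    {conf : ∀ γ, Fin (n γ) → Fin 4 → Fin (n γ) → Fin 4 → Prop}
    (hM : ∀ c, Dec (ext e n) fun p => M p.1 p.2 c)
    (hconf : ∀ c d, Dec (ext (ext e n) fun p => n p.1) fun p => conf p.1.1 p.1.2 c p.2 d)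
    (two : ∀ γ x, ∃ i j, ∀ c, M γ x c → c = i ∨ c = j)
    (symm : ∀ γ x c y d, conf γ x c y d → conf γ y d x c) :
    Dec e fun γ => ∃ f : Fin (n γ) → Fin 4,
      (∀ x, M γ x (f x)) ∧ ∀ x y, ¬ conf γ x (f x) y (f y) := by
  have hn1 : Poly (ext e n) fun p => encodeNat (n p.1) := hn.weaken
  -- the forced consequences of giving the colour `c` to a vertex
  let R : Fin 4 → ∀ p : (γ : Γ) × Fin (n γ), Fin (n p.1) → Finset (Fin 4) := fun c p =>
    (forceStep (M p.1) (conf p.1))^[4 * n p.1] (forceInit p.2 c)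
  have hreach : ∀ c, Poly (ext e n) fun p => encodeFun fun i => encodeColors (R c p i) := by
    intro c
    refine Poly.iterate_table hn1 (Poly.four_mul hn1) ?_ (Dec.mem_forceStep hn1
      (M := fun p => M p.1) (conf := fun p => conf p.1) ?_ ?_)
    · refine Poly.colorTable hn1 fun d => ?_
      have h1 : Dec (ext (ext e n) fun p => n p.1) fun x => x.2 = x.1.2 :=
        Dec.eq (e := ext (ext e n) fun p => n p.1) (m := fun x => n x.1.1) (x := fun x => x.2)
          (y := fun x => x.1.2) (Poly.var _ _) (Poly.var e n).lift
      refine (h1.and (Dec.const _ (d = c))).congr fun p => ?_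
      simp only [forceInit]
      split_ifs with h <;> simp [h]
    · exact fun c => Dec.subst (e' := ext (ext e n) fun p => n p.1) (p := fun γ x => M γ x c)
        (hM c) (g := fun x => x.1.1) (x := fun x => x.2) (Poly.base e n).lift (Poly.var _ _)
    · exact fun c d => Dec.subst₂ (e' := ext (ext (ext e n) fun p => n p.1) fun p => n p.1.1)
        (p := fun γ x y => conf γ x c y d) (hconf c d) (g := fun x => x.1.1.1)
        (x := fun x => x.1.2) (y := fun x => x.2) (Poly.base e n).lift.lift (Poly.var _ _).lift
        (Poly.var _ _)
  have hfree : ∀ c, Dec (ext e n) fun p => ∀ y z : Fin (n p.1), ∀ d d',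
      d ∈ R c p y → d' ∈ R c p z → ¬ conf p.1 y d z d' := by
    intro c
    let e' : ((γ : Γ) × Fin (n γ)) → Data := fun p =>
      .node (ext e n p) (encodeFun fun i => encodeColors (R c p i))
    refine Dec.store (hreach c) ?_
    change Dec e' _
    refine Dec.all (n := fun p => n p.1) (hn1.keep) (p := fun p y => ∀ z : Fin (n p.1), ∀ d d',
      d ∈ R c p y → d' ∈ R c p z → ¬ conf p.1 y d z d') ?_
    refine Dec.all (n := fun p => n p.1.1) (e := ext e' fun p => n p.1) (hn1.keep : Poly e' _).lift
      (p := fun p z => ∀ d d', d ∈ R c p.1 p.2 → d' ∈ R c p.1 z → ¬ conf p.1.1 p.2 d z d') ?_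
    let E := ext (ext e' fun p => n p.1) fun p => n p.1.1
    have hT : Poly E fun x => encodeFun fun i => encodeColors (R c x.1.1 i) :=
      (Poly.id e').snd.lift.lift
    have he : Poly e' fun x => e x.1 := (Poly.base e n).keep
    have hE : Poly E fun x => e x.1.1.1 := he.lift.lift
    have hy : Poly E fun x => encodeNat x.1.2 := (Poly.var _ _).lift
    have hz : Poly E fun x => encodeNat x.2 := Poly.var _ _
    refine Dec.allFixed fun d => Dec.allFixed fun d' => Dec.imp ?_ (Dec.imp ?_ (Dec.not ?_))
    · exact Dec.mem_table (e := E) (m := fun x => n x.1.1.1) (T := fun x => R c x.1.1) hT hy d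
    · exact Dec.mem_table (e := E) (m := fun x => n x.1.1.1) (T := fun x => R c x.1.1) hT hz d'
    · exact Dec.subst₂ (e' := E) (p := fun γ x y => conf γ x d y d') (hconf d d')
        (g := fun x => x.1.1.1) (x := fun x => x.1.2) (y := fun x => x.2) hE hy hz
  refine (Dec.all hn (p := fun γ x => ∃ c, M γ x c ∧ ∀ y z : Fin (n γ), ∀ d d',
      d ∈ R c ⟨γ, x⟩ y → d' ∈ R c ⟨γ, x⟩ z → ¬ conf γ y d z d')
      (Dec.exFixed fun c => (hM c).and (hfree c))).congr fun γ => ?_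
  rw [binary_constraints_iff (M γ) (conf γ) (two γ) (symm γ)]
  have hk := fun x c y d => mem_forceStep_iterate (M γ) (conf γ) x c y d
  simp only [Fintype.card_fin] at hk
  simp only [R, hk, Prod.forall]
  refine forall_congr' fun x => exists_congr fun c => and_congr_right fun _ => ?_
  exact ⟨fun h y d z d' h1 h2 => h y z d d' h1 h2, fun h y z d d' h1 h2 => h y d z d' h1 h2⟩

end

/-! ### Bichromatic components in graphs without induced `P₆` and `C₅` -/

section Colouring

variable {V : Type} {G : SimpleGraph V}

/-- `G` has no induced path on six vertices, in terms of the vertices of the path. -/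
def NoP6 (G : SimpleGraph V) : Prop :=
  ∀ a b c d e f, G.Adj a b → G.Adj b c → G.Adj c d → G.Adj d e → G.Adj e f →
    ¬ G.Adj a c → ¬ G.Adj a d → ¬ G.Adj a e → ¬ G.Adj a f → ¬ G.Adj b d → ¬ G.Adj b e →
    ¬ G.Adj b f → ¬ G.Adj c e → ¬ G.Adj c f → ¬ G.Adj d f → False

/-- `G` has no induced cycle on five vertices, in terms of the vertices of the cycle. -/
def NoC5 (G : SimpleGraph V) : Prop :=
  ∀ a b c d e, G.Adj a b → G.Adj b c → G.Adj c d → G.Adj d e → G.Adj e a →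
    ¬ G.Adj a c → ¬ G.Adj a d → ¬ G.Adj b d → ¬ G.Adj b e → ¬ G.Adj c e → False

/-- The restriction of `c` to `S` is a proper colouring of `G[S]`. -/
def ProperOn (G : SimpleGraph V) {κ : Type} (S : Set V) (c : V → κ) : Prop :=
  ∀ x ∈ S, ∀ y ∈ S, G.Adj x y → c x ≠ c y

theorem isIndContained_of_adj_iff {W : Type} {H : SimpleGraph W} (f : W → V)
    (hH : ∀ i j, (∀ l, H.Adj i l ↔ H.Adj j l) → i = j)
    (h : ∀ i j, H.Adj i j ↔ G.Adj (f i) (f j)) : H.IsIndContained G :=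
  ⟨⟨⟨f, fun i j hij => hH i j fun l => by rw [h, h, hij]⟩, fun {i j} => (h i j).symm⟩⟩

theorem adj_iff_of_lt {k : ℕ} {H : SimpleGraph (Fin k)} {f : Fin k → V}
    (h : ∀ i j, i < j → (H.Adj i j ↔ G.Adj (f i) (f j))) (i j : Fin k) :
    H.Adj i j ↔ G.Adj (f i) (f j) := by
  rcases lt_trichotomy i j with hij | rfl | hij
  · exact h i j hij
  · simp
  · rw [H.adj_comm, G.adj_comm]; exact h j i hij

theorem noP6_of_not_isIndContained (h : ¬ (SimpleGraph.pathGraph 6).IsIndContained G) :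
    NoP6 G := by
  intro a b c d e f h1 h2 h3 h4 h5 n1 n2 n3 n4 n5 n6 n7 n8 n9 n10
  refine h (isIndContained_of_adj_iff ![a, b, c, d, e, f] ?_ (adj_iff_of_lt ?_))
  · simp only [SimpleGraph.pathGraph_adj]; decide
  · intro i j hij
    rw [SimpleGraph.pathGraph_adj]
    fin_cases i <;> fin_cases j <;> first
      | exact absurd hij (by decide)
      | exact iff_of_true (by decide) (by assumption)
      | exact iff_of_false (by decide) (by assumption)

theorem noC5_of_not_isIndContained (h : ¬ (SimpleGraph.cycleGraph 5).IsIndContained G) :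
    NoC5 G := by
  intro a b c d e h1 h2 h3 h4 h5 n1 n2 n3 n4 n5
  refine h (isIndContained_of_adj_iff ![a, b, c, d, e] ?_ (adj_iff_of_lt ?_))
  · simp only [SimpleGraph.cycleGraph_adj']; decide
  · intro i j hij
    rw [SimpleGraph.cycleGraph_adj']
    fin_cases i <;> fin_cases j <;> first
      | exact absurd hij (by decide)
      | exact iff_of_true (by decide) (by first | assumption | exact G.adj_symm (by assumption))
      | exact iff_of_false (by decide) (by assumption)

/-- In a properly coloured graph without induced `P₆`, every bichromatic component has depth at
most four over any set `A` of vertices of one colour: its vertices of the other colour have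
distance at most three from `A`. -/
theorem exists_bichromatic_closure (h6 : NoP6 G) {κ : Type} {S : Set V} {c : V → κ}
    (hc : ProperOn G S c) {a b : κ} (hab : a ≠ b) {A : Set V} (hA : ∀ x ∈ A, x ∈ S ∧ c x = a) :
    ∃ R : Set V, A ⊆ R ∧ (∀ x ∈ R, x ∈ S ∧ (c x = a ∨ c x = b)) ∧
      (∀ x ∈ R, ∀ y ∈ S, G.Adj x y → c y = a ∨ c y = b → y ∈ R) ∧
      ∀ y ∈ R, c y = b → ∃ p ∈ A, G.Adj p y ∨
        ∃ r ∈ S, ∃ s ∈ S, c r = b ∧ c s = a ∧ G.Adj p r ∧ G.Adj r s ∧ G.Adj s y := by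
  have same : ∀ x ∈ S, ∀ y ∈ S, c x = c y → ¬ G.Adj x y := fun x hx y hy h hxy => hc x hx y hy hxy h
  let B : Set V := {y | y ∈ S ∧ c y = b ∧ ∃ p ∈ A, G.Adj p y ∨
        ∃ r ∈ S, ∃ s ∈ S, c r = b ∧ c s = a ∧ G.Adj p r ∧ G.Adj r s ∧ G.Adj s y}
  refine ⟨B ∪ {x | x ∈ S ∧ c x = a ∧ (x ∈ A ∨ ∃ y ∈ B, G.Adj x y)}, ?_, ?_, ?_, ?_⟩
  · exact fun x hx => Or.inr ⟨(hA x hx).1, (hA x hx).2, Or.inl hx⟩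
  · rintro x (hx | hx)
    exacts [⟨hx.1, Or.inr hx.2.1⟩, ⟨hx.1, Or.inl hx.2.1⟩]
  · rintro x (hx | ⟨hxS, hxa, hx⟩) y hy hxy hyc
    · have hya : c y = a := by
        rcases hyc with h | h
        · exact h
        · exact absurd (hx.2.1.trans h.symm) (hc x hx.1 y hy hxy)
      exact Or.inr ⟨hy, hya, Or.inr ⟨x, hx, hxy.symm⟩⟩
    · have hyb : c y = b := by
        rcases hyc with h | h
        · exact absurd (hxa.trans h.symm) (hc x hxS y hy hxy)
        · exact h
      refine Or.inl ⟨hy, hyb, ?_⟩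
      rcases hx with hx | ⟨z, ⟨hzS, hzb, p, hp, hz⟩, hxz⟩
      · exact ⟨x, hx, Or.inl hxy⟩
      · obtain ⟨hpS, hpa⟩ := hA p hp
        refine ⟨p, hp, ?_⟩
        rcases hz with hpz | ⟨r, hr, s, hs, hrb, hsa, hpr, hrs, hsz⟩
        · exact Or.inr ⟨z, hzS, x, hxS, hzb, hxa, hpz, hxz.symm, hxy⟩
        · by_contra! hcon
          obtain ⟨hpy, hcon⟩ := hcon
          refine h6 p r s z x y hpr hrs hsz hxz.symm hxy
            (same p hpS s hs (hpa.trans hsa.symm)) ?_ (same p hpS x hxS (hpa.trans hxa.symm)) hpy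
            (same r hr z hzS (hrb.trans hzb.symm)) ?_ (same r hr y hy (hrb.trans hyb.symm))
            (same s hs x hxS (hsa.trans hxa.symm)) ?_ (same z hzS y hy (hzb.trans hyb.symm))
          · exact fun hpz => hcon z hzS x hxS hzb hxa hpz hxz.symm hxy
          · exact fun hrx => hcon r hr x hxS hrb hxa hpr hrx hxy
          · exact fun hsy => hcon r hr s hs hrb hsa hpr hrs hsy
  · rintro y (hy | hy) hyb
    · exact hy.2.2
    · exact absurd (hy.2.1.symm.trans hyb) hab

open Classical in
/-- The exchange of the colours `a` and `b` on `R`. -/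
noncomputable def kempeSwap {κ : Type} (R : Set V) (a b : κ) (c : V → κ) (x : V) : κ :=
  if x ∈ R then (if c x = a then b else a) else c x

theorem properOn_kempeSwap {κ : Type} {S R : Set V} {c : V → κ} (hc : ProperOn G S c) {a b : κ}
    (hab : a ≠ b) (hR : ∀ x ∈ R, x ∈ S ∧ (c x = a ∨ c x = b))
    (hcl : ∀ x ∈ R, ∀ y ∈ S, G.Adj x y → c y = a ∨ c y = b → y ∈ R) :
    ProperOn G S (kempeSwap R a b c) := by
  intro x hx y hy hxy h
  have hne := hc x hx y hy hxy
  unfold kempeSwap at h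
  by_cases hxR : x ∈ R <;> by_cases hyR : y ∈ R
  · have h1 := (hR x hxR).2
    have h2 := (hR y hyR).2
    rcases h1 with h1 | h1 <;> rcases h2 with h2 | h2 <;> simp_all
  · have h1 : ¬ (c y = a ∨ c y = b) := fun h1 => hyR (hcl x hxR y hy hxy h1)
    push Not at h1
    simp only [hxR, hyR, if_true, if_false] at h
    split_ifs at h
    exacts [h1.2 h.symm, h1.1 h.symm]
  · have h1 : ¬ (c x = a ∨ c x = b) := fun h1 => hxR (hcl y hyR x hx hxy.symm h1)
    push Not at h1
    simp only [hxR, hyR, if_true, if_false] at h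
    split_ifs at h
    exacts [h1.2 h, h1.1 h]
  · simp_all

/-- A colouring extends to `v`, up to an exchange of colours, unless every two colours occur at the
ends of an edge between neighbours of `v`. -/
theorem exists_properOn_insert (h6 : NoP6 G) (h5 : NoC5 G) {κ : Type} {S : Set V} {v : V}
    {c : V → κ} (hc : ProperOn G S c) {a b : κ} (hab : a ≠ b)
    (hno : ∀ p ∈ S, ∀ q ∈ S, G.Adj v p → G.Adj v q → c p = a → c q = b → ¬ G.Adj p q) :
    ∃ c' : V → κ, ProperOn G (insert v S) c' := by
  classical
  by_cases hvS : v ∈ S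
  · exact ⟨c, by rwa [Set.insert_eq_of_mem hvS]⟩
  obtain ⟨R, hAR, hRS, hcl, hRb⟩ := exists_bichromatic_closure h6 hc hab
    (A := {p | p ∈ S ∧ G.Adj v p ∧ c p = a}) (fun x hx => ⟨hx.1, hx.2.2⟩)
  have hq : ∀ q ∈ R, G.Adj v q → c q ≠ b := by
    intro q hqR hvq hqb
    have hqS := (hRS q hqR).1
    obtain ⟨p, ⟨hpS, hvp, hpa⟩, hpq | ⟨r, hr, s, hs, hrb, hsa, hpr, hrs, hsq⟩⟩ := hRb q hqR hqb
    · exact hno p hpS q hqS hvp hvq hpa hqb hpq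
    · refine h5 v p r s q hvp hpr hrs hsq hvq.symm ?_ ?_ ?_ ?_ ?_
      · exact fun h => hno p hpS r hr hvp h hpa hrb hpr
      · exact fun h => hno s hs q hqS h hvq hsa hqb hsq
      · exact fun h => hc p hpS s hs h (hpa.trans hsa.symm)
      · exact hno p hpS q hqS hvp hvq hpa hqb
      · exact fun h => hc r hr q hqS h (hrb.trans hqb.symm)
  have hsw := properOn_kempeSwap hc hab hRS hcl
  have hv : ∀ x ∈ S, G.Adj v x → kempeSwap R a b c x ≠ a := by
    intro x hx hvx h
    unfold kempeSwap at h
    by_cases hxR : x ∈ R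
    · simp only [hxR, if_true] at h
      split_ifs at h with h1
      · exact hab h.symm
      · exact hq x hxR hvx ((hRS x hxR).2.resolve_left h1)
    · simp only [hxR, if_false] at h
      exact hxR (hAR ⟨hx, hvx, h⟩)
  refine ⟨fun x => if x = v then a else kempeSwap R a b c x, ?_⟩
  rintro x (rfl | hx) y (rfl | hy) hxy
  · exact absurd hxy (G.loopless.irrefl _)
  · have : y ≠ x := fun h => hvS (h ▸ hy)
    simpa [this] using (hv y hy hxy).symm
  · have : x ≠ y := fun h => hvS (h ▸ hx)
    simpa [this] using hv x hx hxy.symm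
  · have h1 : x ≠ v := fun h => hvS (h ▸ hx)
    have h2 : y ≠ v := fun h => hvS (h ▸ hy)
    simpa [h1, h2] using hsw x hx y hy hxy

/-- Without induced `P₆`, `C₅` and triangles, a finite graph is bipartite. -/
theorem exists_properOn_two (h6 : NoP6 G) (h5 : NoC5 G) (S : Finset V)
    (h3 : ∀ x ∈ S, ∀ y ∈ S, ∀ z ∈ S, G.Adj x y → G.Adj y z → ¬ G.Adj x z) :
    ∃ c : V → Fin 2, ProperOn G (S : Set V) c := by
  classical
  induction S using Finset.induction_on with
  | empty => exact ⟨fun _ => 0, by simp [ProperOn]⟩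
  | insert v S _ ih =>
    obtain ⟨c, hc⟩ := ih fun x hx y hy z hz => h3 x (Finset.mem_insert_of_mem hx) y
      (Finset.mem_insert_of_mem hy) z (Finset.mem_insert_of_mem hz)
    rw [Finset.coe_insert]
    refine exists_properOn_insert h6 h5 hc (a := 0) (b := 1) (by decide) ?_
    intro p hp q hq hvp hvq _ _ hpq
    exact h3 v (Finset.mem_insert_self _ _) p (Finset.mem_insert_of_mem hp) q
      (Finset.mem_insert_of_mem hq) hvp hpq hvq

end Colouring

/-! ### Graphs that are critical for not being 3-colourable -/

section Critical

variable {V : Type} {G : SimpleGraph V}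

/-- `G` contains neither `P₆`, `C₅`, `K₄` nor the complement of `C₇`, and it is not 3-colourable,
but it becomes so when any vertex is deleted. (There are no such graphs.) -/
structure IsCritical (G : SimpleGraph V) : Prop where
  p6 : NoP6 G
  c5 : NoC5 G
  k4 : ∀ a b c d, G.Adj a b → G.Adj a c → G.Adj a d → G.Adj b c → G.Adj b d → ¬ G.Adj c d
  a7 : ¬ (SimpleGraph.cycleGraph 7)ᶜ.IsIndContained G
  not_colorable : ¬ ∃ c : V → Fin 3, ProperOn G Set.univ c
  colorable : ∀ v, ∃ c : V → Fin 3, ProperOn G {v}ᶜ c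

/-- No two members of `S` are adjacent. -/
def Stable (G : SimpleGraph V) (S : Finset V) : Prop := ∀ x ∈ S, ∀ y ∈ S, ¬ G.Adj x y

theorem Stable.card_inter_le_one [DecidableEq V] {S T : Finset V} (hS : Stable G S)
    (hT : G.IsNClique 3 T) :
    (S ∩ T).card ≤ 1 := by
  rw [Finset.card_le_one]
  intro a ha b hb
  rw [Finset.mem_inter] at ha hb
  by_contra hne
  exact hS a ha.1 b hb.1 (hT.1 ha.2 hb.2 hne)

variable [Fintype V] [DecidableEq V]

theorem IsCritical.exists_disjoint_triangle (hG : IsCritical G) {S : Finset V} (hS : Stable G S) :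
    ∃ T, G.IsNClique 3 T ∧ S ∩ T = ∅ := by
  by_contra! hcon
  obtain ⟨c, hc⟩ := exists_properOn_two hG.p6 hG.c5 Sᶜ (by
    intro x hx y hy z hz hxy hyz hxz
    refine (hcon {x, y, z} (SimpleGraph.is3Clique_triple_iff.2 ⟨hxy, hxz, hyz⟩)).ne_empty ?_
    rw [Finset.mem_compl] at hx hy hz
    ext w
    simp only [Finset.mem_inter, Finset.mem_insert, Finset.mem_singleton, Finset.notMem_empty,
      iff_false, not_and]
    rintro hw (rfl | rfl | rfl)
    exacts [hx hw, hy hw, hz hw])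
  refine hG.not_colorable ⟨fun x => if x ∈ S then 2 else (c x).castSucc, ?_⟩
  intro x _ y _ hxy h
  have h2 : ∀ i : Fin 2, (2 : Fin 3) ≠ i.castSucc := by decide
  by_cases hx : x ∈ S <;> by_cases hy : y ∈ S <;> simp only [hx, hy, if_true, if_false] at h
  · exact hS x hx y hy hxy
  · exact h2 _ h
  · exact h2 _ h.symm
  · exact hc x (by simpa using hx) y (by simpa using hy) hxy (Fin.castSucc_injective 2 h)

/-- The vertices other than `v` with colour `k`. -/
def colourClass (c : V → Fin 3) (v : V) (k : Fin 3) : Finset V := {u | u ≠ v ∧ c u = k}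

theorem stable_colourClass {c : V → Fin 3} {v : V} (hc : ProperOn G {v}ᶜ c) (k : Fin 3) :
    Stable G (colourClass c v k) := by
  intro x hx y hy hxy
  simp only [colourClass, Finset.mem_filter, Finset.mem_univ, true_and] at hx hy
  exact hc x hx.1 y hy.1 hxy (hx.2.trans hy.2.symm)

theorem sum_card_colourClass (c : V → Fin 3) (v : V) :
    ∑ k, (colourClass c v k).card = Fintype.card V - 1 := by
  rw [← Finset.card_univ, ← Finset.card_erase_of_mem (Finset.mem_univ v)]
  rw [Finset.card_eq_sum_card_fiberwise (f := c) (t := Finset.univ) (fun _ _ => by simp)]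
  refine Finset.sum_congr rfl fun k _ => ?_
  congr 1
  ext u
  simp [colourClass]

/-- Lovász's system: the stable sets `S j` of maximum size and the triangles `T j`, where `S i` and
`T j` are disjoint for `i = j` and have one vertex in common otherwise. Every vertex is in three of
the triangles. -/
structure LovaszSystem (G : SimpleGraph V) (α : ℕ) (J : Type) where
  S : J → Finset V
  T : J → Finset V
  stable : ∀ j, Stable G (S j)
  card_S : ∀ j, (S j).card = α
  clique : ∀ j, G.IsNClique 3 (T j)
  inter_self : ∀ j, S j ∩ T j = ∅
  inter_ne : ∀ i j, i ≠ j → (S i ∩ T j).card = 1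
  card_colourClass : ∀ (v : V) (c : V → Fin 3), ProperOn G {v}ᶜ c → ∀ k,
    (colourClass c v k).card = α
  exists_S : ∀ K, Stable G K → K.card = α → ∃ j, K = S j
  exists_T : ∀ K, G.IsNClique 3 K → ∃ j, K = T j
  exists_three : ∀ v, ∃ s : Finset J, s.card = 3 ∧ ∀ j, j ∈ s ↔ v ∈ T j

theorem exists_unique_zero {J : Type} [Fintype J] {f : J → ℕ} (h1 : ∀ j, f j ≤ 1)
    (hsum : ∑ j, f j + 1 = Fintype.card J) : ∃ i, f i = 0 ∧ ∀ j, j ≠ i → f j = 1 := by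
  classical
  obtain ⟨i, hi⟩ : ∃ i, f i = 0 := by
    by_contra! h
    have : ∑ j, f j = ∑ _j : J, 1 :=
      Finset.sum_congr rfl fun j _ => le_antisymm (h1 j) (Nat.one_le_iff_ne_zero.2 (h j))
    rw [Finset.sum_const, smul_eq_mul, mul_one, Finset.card_univ] at this
    omega
  refine ⟨i, hi, fun j hj => ?_⟩
  by_contra hne
  have hj0 : f j = 0 := by have := h1 j; omega
  have h2 : ∑ j, f j ≤ ∑ k, if k ∈ ({i, j} : Finset J)ᶜ then 1 else 0 := by
    refine Finset.sum_le_sum fun k _ => ?_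
    split_ifs with hk
    · exact h1 k
    · have : k = i ∨ k = j := by simpa [-not_or, or_iff_not_imp_left] using hk
      rcases this with rfl | rfl
      · exact hi.le
      · exact hj0.le
  rw [Finset.sum_ite_mem, Finset.univ_inter, Finset.sum_const, smul_eq_mul, mul_one,
    Finset.card_compl, Finset.card_pair (Ne.symm hj)] at h2
  have h3 := Finset.card_le_univ ({i, j} : Finset J)
  rw [Finset.card_pair (Ne.symm hj)] at h3
  omega

/-- The matrix `𝟙 - I` is invertible. -/
theorem exists_mul_eq_one_of_zero_one {J : Type} [Fintype J] [DecidableEq J] {M : Matrix J J ℚ}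
    {α : ℕ} (hJ : Fintype.card J = 3 * α + 1) (hα : 0 < α) (h0 : ∀ i, M i i = 0)
    (h1 : ∀ i j, i ≠ j → M i j = 1) : ∃ D : Matrix J J ℚ, M * D = 1 := by
  refine ⟨Matrix.of fun i j => 1 / (3 * α : ℚ) - if i = j then 1 else 0, ?_⟩
  have hα0 : (α : ℚ) ≠ 0 := by positivity
  ext i j
  rw [Matrix.mul_apply, Matrix.one_apply]
  simp only [Matrix.of_apply]
  have h : ∀ k, M i k * (1 / (3 * α : ℚ) - if k = j then 1 else 0) =
      1 / (3 * α : ℚ) - (if k = i then 1 / (3 * α : ℚ) else 0) - (if k = j then 1 else 0) +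
        if k = i then (if k = j then 1 else 0) else 0 := by
    intro k
    rcases eq_or_ne k i with rfl | h
    · simp [h0]
    · simp [h, h1 i k h.symm]
  simp only [h, Finset.sum_add_distrib, Finset.sum_sub_distrib, Finset.sum_ite_eq',
    Finset.mem_univ, if_true, Finset.sum_const, Finset.card_univ, hJ]
  simp only [nsmul_eq_mul]
  push_cast
  field_simp
  ring

theorem IsCritical.exists_lovaszSystem (hG : IsCritical G) :
    ∃ (α : ℕ) (J : Type), Nonempty (LovaszSystem G α J) := by
  classical
  obtain ⟨S₀, hS₀, hmax⟩ := Finset.exists_max_image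
    (Finset.univ.filter fun S : Finset V => Stable G S) Finset.card
    ⟨∅, Finset.mem_filter.2 ⟨Finset.mem_univ _, by simp [Stable]⟩⟩
  simp only [Finset.mem_filter, Finset.mem_univ, true_and] at hS₀ hmax
  set α := S₀.card with hα
  choose c hc using hG.colorable
  obtain ⟨v₀⟩ : Nonempty V := by
    by_contra h
    rw [not_nonempty_iff] at h
    exact hG.not_colorable ⟨fun _ => 0, fun x => (h.false x).elim⟩
  have hαpos : 0 < α := by
    have := hmax {v₀} (by simp [Stable])
    simp at this
    omega
  let J := Option (S₀ × Fin 3)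
  let S : J → Finset V := fun j => j.elim S₀ fun p => colourClass (c p.1) p.1 p.2
  have hS : ∀ j, Stable G (S j) := by
    rintro (_ | ⟨s, k⟩)
    · exact hS₀
    · exact stable_colourClass (hc s) k
  choose T hT hST using fun j => hG.exists_disjoint_triangle (hS j)
  have hJ : Fintype.card J = 3 * α + 1 := by
    simp [J, mul_comm, hα]
  -- every vertex is in `α` of the stable sets
  have hcount : ∀ u, ∑ j, (if u ∈ S j then 1 else 0) = α := by
    intro u
    rw [Fintype.sum_option, Fintype.sum_prod_type]
    have h1 : ∀ s : S₀, ∑ k, (if u ∈ S (some (s, k)) then 1 else 0) = if u = s then 0 else 1 := by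
      intro s
      simp only [S, Option.elim, colourClass, Finset.mem_filter, Finset.mem_univ, true_and]
      by_cases hus : u = s <;> simp [hus]
    simp only [h1]
    rw [Finset.sum_coe_sort S₀ (fun s => if u = s then 0 else 1)]
    simp only [S, Option.elim]
    have h2 : ∑ s ∈ S₀, (if u = s then 0 else 1) + ∑ s ∈ S₀, (if u = s then 1 else 0) = α := by
      rw [← Finset.sum_add_distrib, hα, Finset.card_eq_sum_ones]
      exact Finset.sum_congr rfl fun s _ => by split_ifs <;> rfl
    rw [Finset.sum_ite_eq S₀ u] at h2
    by_cases hu : u ∈ S₀ <;> simp only [hu, if_true, if_false] at h2 ⊢ <;> omega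
  have hsum : ∀ (K : Finset V) (F : J → Finset V) (m : ℕ),
      (∀ u, ∑ j, (if u ∈ F j then 1 else 0) = m) → ∑ j, (F j ∩ K).card = K.card * m := by
    intro K F m h
    have h1 : ∀ j, (F j ∩ K).card = ∑ u ∈ K, if u ∈ F j then 1 else 0 := by
      intro j
      rw [Finset.inter_comm, ← Finset.filter_mem_eq_inter, Finset.card_filter]
    simp only [h1]
    rw [Finset.sum_comm, Finset.sum_congr rfl fun u _ => h u, Finset.sum_const, smul_eq_mul]
  -- every triangle is disjoint from exactly one of the stable sets
  have hone : ∀ K, G.IsNClique 3 K → ∃ i, (S i ∩ K).card = 0 ∧ ∀ j, j ≠ i → (S j ∩ K).card = 1 := by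
    intro K hK
    refine exists_unique_zero (fun j => (hS j).card_inter_le_one hK) ?_
    rw [hsum K S α hcount, hK.2, hJ]
  have hinter : ∀ i j, (S i ∩ T j).card = if i = j then 0 else 1 := by
    intro i j
    obtain ⟨k, hk, hk'⟩ := hone (T j) (hT j)
    have hjk : j = k := by
      by_contra h
      have := hk' j h
      rw [hST j] at this
      simp at this
    subst hjk
    split_ifs with h
    · rw [h]; exact hk
    · exact hk' i h
  let A : Matrix J V ℚ := Matrix.of fun j u => if u ∈ S j then 1 else 0
  let B : Matrix V J ℚ := Matrix.of fun u j => if u ∈ T j then 1 else 0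
  have hcard : ∀ K L : Finset V, ∑ u, (if u ∈ K then (1 : ℚ) else 0) * (if u ∈ L then 1 else 0) =
      (K ∩ L).card := by
    intro K L
    have h : ∀ u, (if u ∈ K then (1 : ℚ) else 0) * (if u ∈ L then 1 else 0) =
        if u ∈ K ∩ L then 1 else 0 := by
      intro u
      by_cases h1 : u ∈ K <;> by_cases h2 : u ∈ L <;> simp [h1, h2]
    simp only [h]
    rw [Finset.sum_boole]
    congr 2
    ext u
    simp
  have hAB : A * B = Matrix.of fun i j => if i = j then 0 else 1 := by
    ext i j
    rw [Matrix.mul_apply]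
    simp only [A, B, Matrix.of_apply]
    rw [hcard, hinter]
    split_ifs <;> simp
  obtain ⟨D, hD⟩ := exists_mul_eq_one_of_zero_one (M := A * B) hJ hαpos
    (fun i => by rw [hAB]; simp) (fun i j h => by rw [hAB]; simp [h])
  have hABD : A * (B * D) = 1 := by rw [← Matrix.mul_assoc, hD]
  have hle : Fintype.card J ≤ Fintype.card V := by
    have hinj : Function.Injective (Matrix.mulVecLin (B * D)) := by
      refine Function.LeftInverse.injective (g := fun x => A.mulVec x) fun x => ?_
      show A.mulVec ((B * D).mulVec x) = x
      rw [Matrix.mulVec_mulVec, hABD, Matrix.one_mulVec]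
    simpa using LinearMap.finrank_le_finrank_of_injective hinj
  have hmaxc : ∀ (v : V) (c : V → Fin 3), ProperOn G {v}ᶜ c → ∀ k,
      (colourClass c v k).card ≤ α := fun v c hc k => hmax _ (stable_colourClass hc k)
  have hcolour : ∀ (v : V) (c : V → Fin 3), ProperOn G {v}ᶜ c → ∀ k,
      (colourClass c v k).card = α := by
    intro v c hc k
    have h1 := sum_card_colourClass c v
    have h2 := hmaxc v c hc
    rw [Fin.sum_univ_three] at h1
    have h3 := h2 0
    have h4 := h2 1
    have h5 := h2 2
    fin_cases k <;> simp only [Fin.zero_eta, Fin.mk_one, Fin.reduceFinMk] <;> omega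
  have hVJ : Fintype.card J = Fintype.card V := by
    have h1 := sum_card_colourClass (c v₀) v₀
    simp only [hcolour v₀ (c v₀) (hc v₀)] at h1
    simp at h1
    omega
  have hBDA : B * D * A = 1 := (Matrix.mul_eq_one_comm_of_equiv (Fintype.equivOfCardEq hVJ)).1 hABD
  have hAinj : ∀ x y, A.mulVec x = A.mulVec y → x = y := by
    intro x y h
    have := congrArg (B * D).mulVec h
    rwa [Matrix.mulVec_mulVec, Matrix.mulVec_mulVec, hBDA, Matrix.one_mulVec,
      Matrix.one_mulVec] at this
  have hBinj : ∀ x y, Matrix.vecMul x B = Matrix.vecMul y B → x = y := by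
    intro x y h
    have := congrArg (fun z => Matrix.vecMul z (D * A)) h
    simpa only [Matrix.vecMul_vecMul, ← Matrix.mul_assoc, hBDA, Matrix.vecMul_one] using this
  have hind : ∀ K L : Finset V, (fun u => if u ∈ K then (1 : ℚ) else 0) =
      (fun u => if u ∈ L then (1 : ℚ) else 0) → K = L := by
    intro K L h
    ext u
    have := congrFun h u
    by_cases h1 : u ∈ K <;> by_cases h2 : u ∈ L <;> simp_all
  have hScard : ∀ j, (S j).card = α := by
    rintro (_ | ⟨s, k⟩)
    · rfl
    · exact hcolour s (c s) (hc s) k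
  -- every vertex is in three of the triangles
  have hthree : ∀ u, ∑ j, (if u ∈ T j then 1 else 0) = 3 := by
    have : B.mulVec 1 = fun _ => 3 := by
      apply hAinj
      rw [Matrix.mulVec_mulVec, hAB]
      ext i
      simp only [Matrix.mulVec, dotProduct, Matrix.of_apply, A, Pi.one_apply, mul_one]
      rw [← Finset.sum_mul]
      have h1 : ∑ x, (if x ∈ S i then (1 : ℚ) else 0) = α := by
        rw [← hScard i]; simp
      have h2 : ∑ j, ((if i = j then (0 : ℚ) else 1) + if i = j then 1 else 0) = 3 * α + 1 := by
        rw [Finset.sum_congr rfl (g := fun _ => (1 : ℚ)) (fun j _ => by split_ifs <;> simp)]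
        rw [Finset.sum_const, Finset.card_univ, hJ]
        simp
      rw [Finset.sum_add_distrib, Finset.sum_ite_eq Finset.univ i] at h2
      simp only [Finset.mem_univ, if_true] at h2
      rw [h1]
      linarith
    intro u
    have := congrFun this u
    simp only [Matrix.mulVec, dotProduct, Matrix.of_apply, B, Pi.one_apply, mul_one] at this
    exact_mod_cast this
  refine ⟨α, J, ⟨⟨S, T, hS, hScard, hT, hST, fun i j hij => by rw [hinter, if_neg hij], hcolour,
    ?_, ?_, ?_⟩⟩⟩
  · intro K hK hKα
    obtain ⟨i, hi, hi'⟩ := exists_unique_zero (f := fun j => (T j ∩ K).card)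
      (fun j => by rw [Finset.inter_comm]; exact hK.card_inter_le_one (hT j))
      (by rw [hsum K T 3 hthree, hJ, hKα, mul_comm])
    refine ⟨i, hind _ _ (hBinj _ _ ?_)⟩
    ext j
    simp only [Matrix.vecMul, dotProduct, B, Matrix.of_apply, hcard, hinter]
    rw [Finset.inter_comm K]
    split_ifs with h
    · rw [← h, hi]
    · rw [hi' j (Ne.symm h)]
  · intro K hK
    obtain ⟨i, hi, hi'⟩ := hone K hK
    refine ⟨i, hind _ _ (hAinj _ _ ?_)⟩
    ext j
    simp only [Matrix.mulVec, dotProduct, A, Matrix.of_apply, hcard, hinter]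
    split_ifs with h
    · rw [h, hi]
    · rw [hi' j h]
  · intro v
    refine ⟨Finset.univ.filter fun j => v ∈ T j, ?_, by simp⟩
    rw [Finset.card_filter]
    exact hthree v

end Critical

section Critical

variable {V : Type} {G : SimpleGraph V}

theorem exists_third (a b : Fin 3) : ∃ k, k ≠ a ∧ k ≠ b := by revert a b; decide

theorem eq_of_ne_of_ne {a b k l : Fin 3} (hab : a ≠ b) (h1 : k ≠ a) (h2 : k ≠ b) (h3 : l ≠ a)
    (h4 : l ≠ b) : k = l := by revert a b k l; decide

/-- The edges of `G[N(v)]` form the path `r p q s`, and the neighbours of `v` other than `p` and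
`q` have the same colour in every 3-colouring of `G - v`. -/
structure Link (G : SimpleGraph V) (v p q r s : V) : Prop where
  vp : G.Adj v p
  vq : G.Adj v q
  vr : G.Adj v r
  vs : G.Adj v s
  pq : G.Adj p q
  rp : G.Adj r p
  qs : G.Adj q s
  r_ne_s : r ≠ s
  r_ne_q : r ≠ q
  p_ne_s : p ≠ s
  edges : ∀ x y z, G.Adj v x → G.Adj v y → G.Adj v z → G.Adj y x → G.Adj y z → x ≠ z →
    (y = p ∧ (x = q ∧ z = r ∨ x = r ∧ z = q)) ∨ (y = q ∧ (x = p ∧ z = s ∨ x = s ∧ z = p))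
  colour : ∀ c : V → Fin 3, ProperOn G {v}ᶜ c → ∀ x, G.Adj v x → x ≠ p → x ≠ q → c x = c s

theorem Link.symm {v p q r s : V} (h : Link G v p q r s) : Link G v q p s r where
  vp := h.vq
  vq := h.vp
  vr := h.vs
  vs := h.vr
  pq := h.pq.symm
  rp := h.qs.symm
  qs := h.rp.symm
  r_ne_s := h.r_ne_s.symm
  r_ne_q := h.p_ne_s.symm
  p_ne_s := h.r_ne_q.symm
  edges x y z h1 h2 h3 h4 h5 h6 := (h.edges x y z h1 h2 h3 h4 h5 h6).symm
  colour c hc x hx h1 h2 := by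
    rw [h.colour c hc x hx h2 h1, h.colour c hc r h.vr h.rp.ne h.r_ne_q]

/-- Otherwise the colouring of `G - v` extends to `v` after an exchange of colours. -/
theorem IsCritical.exists_link_edge (hG : IsCritical G) {v : V} {c : V → Fin 3}
    (hc : ProperOn G {v}ᶜ c) {a b : Fin 3} (hab : a ≠ b) :
    ∃ p q, G.Adj v p ∧ G.Adj v q ∧ G.Adj p q ∧ c p = a ∧ c q = b := by
  by_contra! hcon
  refine hG.not_colorable ?_
  obtain ⟨c', hc'⟩ := exists_properOn_insert hG.p6 hG.c5 hc hab
    (fun p _ q _ hvp hvq hpa hqb hpq => hcon p q hvp hvq hpq hpa hqb)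
  refine ⟨c', fun x _ y _ => hc' x ?_ y ?_⟩ <;> simp [em]

variable [Fintype V] [DecidableEq V]

/-- The triangle of `v` and an edge of its neighbourhood misses the class of the third colour. -/
theorem LovaszSystem.eq_T {α : ℕ} {J : Type} (L : LovaszSystem G α J) {v : V} {c : V → Fin 3}
    (hc : ProperOn G {v}ᶜ c) {p q : V} (hvp : G.Adj v p) (hvq : G.Adj v q) (hpq : G.Adj p q)
    {k : Fin 3} (hkp : k ≠ c p) (hkq : k ≠ c q) {i : J} (hi : colourClass c v k = L.S i) :
    L.T i = {v, p, q} := by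
  obtain ⟨j, hj⟩ := L.exists_T {v, p, q} (SimpleGraph.is3Clique_triple_iff.2 ⟨hvp, hvq, hpq⟩)
  have : i = j := by
    by_contra hij
    have h := L.inter_ne i j hij
    rw [← hj, ← hi] at h
    obtain ⟨x, hx⟩ := Finset.card_pos.1 (h ▸ Nat.one_pos)
    simp only [colourClass, Finset.mem_inter, Finset.mem_filter, Finset.mem_univ, true_and,
      Finset.mem_insert, Finset.mem_singleton] at hx
    obtain ⟨⟨hxv, hxk⟩, rfl | rfl | rfl⟩ := hx
    exacts [hxv rfl, hkp hxk.symm, hkq hxk.symm]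
  rw [this, hj]

/-- The neighbourhood of `v` has only one edge between two given colours. -/
theorem LovaszSystem.link_edge_unique {α : ℕ} {J : Type} (L : LovaszSystem G α J) {v : V}
    {c : V → Fin 3} (hc : ProperOn G {v}ᶜ c) {p q p' q' : V} (hvp : G.Adj v p) (hvq : G.Adj v q)
    (hpq : G.Adj p q) (hvp' : G.Adj v p') (hvq' : G.Adj v q') (hpq' : G.Adj p' q')
    (hp : c p = c p') (hq : c q = c q') : p = p' ∧ q = q' := by
  obtain ⟨k, hk1, hk2⟩ := exists_third (c p) (c q)
  obtain ⟨i, hi⟩ := L.exists_S _ (stable_colourClass hc k) (L.card_colourClass v c hc k)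
  have h1 := L.eq_T hc hvp hvq hpq hk1 hk2 hi
  have h2 := L.eq_T hc hvp' hvq' hpq' (hp ▸ hk1) (hq ▸ hk2) hi
  have hne : c p ≠ c q := hc p hvp.ne' q hvq.ne' hpq
  rw [h1] at h2
  constructor
  · have : p ∈ ({v, p', q'} : Finset V) := by rw [← h2]; simp
    simp only [Finset.mem_insert, Finset.mem_singleton] at this
    rcases this with h | h | h
    · exact absurd h hvp.ne'
    · exact h
    · exact absurd (by rw [h, hq]) hne
  · have : q ∈ ({v, p', q'} : Finset V) := by rw [← h2]; simp
    simp only [Finset.mem_insert, Finset.mem_singleton] at this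
    rcases this with h | h | h
    · exact absurd h hvq.ne'
    · exact absurd (by rw [h, hp]) hne
    · exact h

theorem IsCritical.exists_mem_T (hG : IsCritical G) {α : ℕ} {J : Type} (L : LovaszSystem G α J)
    {v : V} {c : V → Fin 3} (hc : ProperOn G {v}ᶜ c) (k : Fin 3) :
    ∃ j, v ∈ L.T j ∧ colourClass c v k = L.S j := by
  obtain ⟨a, b, hab, hka, hkb⟩ : ∃ a b, a ≠ b ∧ k ≠ a ∧ k ≠ b := by revert k; decide
  obtain ⟨p, q, hvp, hvq, hpq, hp, hq⟩ := hG.exists_link_edge hc hab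
  obtain ⟨i, hi⟩ := L.exists_S _ (stable_colourClass hc k) (L.card_colourClass v c hc k)
  refine ⟨i, ?_, hi⟩
  rw [L.eq_T hc hvp hvq hpq (hp ▸ hka) (hq ▸ hkb) hi]
  simp

/-- All 3-colourings of `G - v` have the same colour classes. -/
theorem IsCritical.colour_eq (hG : IsCritical G) {α : ℕ} {J : Type} (L : LovaszSystem G α J)
    {v : V} {c c' : V → Fin 3} (hc : ProperOn G {v}ᶜ c) (hc' : ProperOn G {v}ᶜ c') {x y : V}
    (hx : x ≠ v) (hy : y ≠ v) (h : c x = c y) : c' x = c' y := by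
  classical
  choose f hfT hf using hG.exists_mem_T L hc
  choose f' hfT' hf' using hG.exists_mem_T L hc'
  have hinj : Function.Injective f' := by
    intro a b hab
    obtain ⟨b', hb'⟩ : ∃ b', b ≠ b' := ⟨b + 1, by clear hab; revert b; decide⟩
    obtain ⟨p, q, hvp, -, -, hp, -⟩ := hG.exists_link_edge hc' hb'
    have : p ∈ colourClass c' v a := by
      rw [hf' a, hab, ← hf' b]
      simpa [colourClass, hp] using hvp.ne'
    simp only [colourClass, Finset.mem_filter, Finset.mem_univ, true_and] at this
    rw [← this.2, hp]
  obtain ⟨s, hs, hmem⟩ := L.exists_three v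
  have himg : Finset.univ.image f' = s := by
    refine Finset.eq_of_subset_of_card_le ?_ ?_
    · intro j hj
      obtain ⟨k, -, rfl⟩ := Finset.mem_image.1 hj
      exact (hmem _).2 (hfT' k)
    · rw [Finset.card_image_of_injective _ hinj, hs]
      simp
  have : f (c x) ∈ Finset.univ.image f' := by rw [himg, hmem]; exact hfT _
  obtain ⟨k, -, hk⟩ := Finset.mem_image.1 this
  have hcls : colourClass c v (c x) = colourClass c' v k := by rw [hf, hf', hk]
  have h1 : x ∈ colourClass c' v k := by rw [← hcls]; simpa [colourClass] using hx
  have h2 : y ∈ colourClass c' v k := by rw [← hcls]; simpa [colourClass, h] using hy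
  simp only [colourClass, Finset.mem_filter, Finset.mem_univ, true_and] at h1 h2
  rw [h1.2, h2.2]

/-- Among the neighbours of `v` with two given colours, one colour occurs only at the end of the
edge joining these colours: otherwise an exchange of colours on a bichromatic component would give
a new partition of `G - v`, or the component contains a path closing to a `C₅` with `v`. -/
theorem IsCritical.eq_or_eq (hG : IsCritical G) {α : ℕ} {J : Type} (L : LovaszSystem G α J)
    {v : V} {c : V → Fin 3} (hc : ProperOn G {v}ᶜ c) {p q x y : V} (hvp : G.Adj v p)
    (hvq : G.Adj v q) (hpq : G.Adj p q) (hvx : G.Adj v x) (hvy : G.Adj v y) (hx : c x = c p)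
    (hy : c y = c q) : x = p ∨ y = q := by
  by_contra! hcon
  have hne : c p ≠ c q := hc p hvp.ne' q hvq.ne' hpq
  have huniq : ∀ x' y', G.Adj v x' → G.Adj v y' → G.Adj x' y' → c x' = c p → c y' = c q →
      x' = p ∧ y' = q := fun x' y' h1 h2 h3 h4 h5 =>
    L.link_edge_unique hc h1 h2 h3 hvp hvq hpq h4 h5
  obtain ⟨R, hAR, hRS, hcl, hRb⟩ := exists_bichromatic_closure hG.p6 hc hne (A := {x})
    (fun z hz => by rw [Set.mem_singleton_iff.1 hz]; exact ⟨hvx.ne', hx⟩)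
  have hxR : x ∈ R := hAR rfl
  have hyR : y ∈ R := by
    by_contra hyR
    have h1 := hG.colour_eq L (properOn_kempeSwap hc hne hRS hcl) hc hvx.ne' hvy.ne' (by
      simp [kempeSwap, hxR, hyR, hx, hy])
    exact hne (by rw [← hx, h1, hy])
  obtain ⟨x', hx', hxy | ⟨r, hr, s, hs, hrb, hsa, hxr, hrs, hsy⟩⟩ := hRb y hyR hy <;>
    rw [Set.mem_singleton_iff] at hx' <;> subst hx'
  · exact hcon.1 (huniq _ y hvx hvy hxy hx hy).1
  · refine hG.c5 v _ r s y hvx hxr hrs hsy hvy.symm ?_ ?_ ?_ ?_ ?_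
    · exact fun h => hcon.1 (huniq _ r hvx h hxr hx hrb).1
    · exact fun h => hcon.2 (huniq s y h hvy hsy hsa hy).2
    · exact fun h => hc _ hvx.ne' s hs h (hx.trans hsa.symm)
    · exact fun h => hcon.1 (huniq _ y hvx hvy h hx hy).1
    · exact fun h => hc r hr y hvy.ne' h (hrb.trans hy.symm)

theorem IsCritical.exists_link (hG : IsCritical G) {α : ℕ} {J : Type} (L : LovaszSystem G α J)
    (v : V) : ∃ p q r s, Link G v p q r s := by
  obtain ⟨c, hc⟩ := hG.colorable v
  -- two colours occur only once among the neighbours of `v`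
  obtain ⟨a, b, k, hab, hak, hbk, p, q, hvp, hvq, hpq, hp, hq, hpu, hqu⟩ :
      ∃ a b k : Fin 3, a ≠ b ∧ a ≠ k ∧ b ≠ k ∧ ∃ p q, G.Adj v p ∧ G.Adj v q ∧ G.Adj p q ∧
        c p = a ∧ c q = b ∧ (∀ x, G.Adj v x → c x = a → x = p) ∧
        (∀ x, G.Adj v x → c x = b → x = q) := by
    have hall : ∀ a b : Fin 3, a ≠ b → ∃ p q, G.Adj v p ∧ G.Adj v q ∧ G.Adj p q ∧ c p = a ∧
        c q = b ∧ ((∀ x, G.Adj v x → c x = a → x = p) ∨ (∀ x, G.Adj v x → c x = b → x = q)) := by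
      intro a b hab
      obtain ⟨p, q, hvp, hvq, hpq, hp, hq⟩ := hG.exists_link_edge hc hab
      refine ⟨p, q, hvp, hvq, hpq, hp, hq, ?_⟩
      by_contra! hcon
      obtain ⟨⟨x, hvx, hxa, hx⟩, y, hvy, hyb, hy⟩ := hcon
      rcases hG.eq_or_eq L hc hvp hvq hpq hvx hvy (hxa.trans hp.symm) (hyb.trans hq.symm) with h | h
      exacts [hx h, hy h]
    have hsub : ∀ a b : Fin 3, a ≠ b →
        (∀ x y, G.Adj v x → G.Adj v y → c x = a → c y = a → x = y) →
        (∀ x y, G.Adj v x → G.Adj v y → c x = b → c y = b → x = y) →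
        ∃ a b k : Fin 3, a ≠ b ∧ a ≠ k ∧ b ≠ k ∧ ∃ p q, G.Adj v p ∧ G.Adj v q ∧ G.Adj p q ∧
        c p = a ∧ c q = b ∧ (∀ x, G.Adj v x → c x = a → x = p) ∧
        (∀ x, G.Adj v x → c x = b → x = q) := by
      intro a b hab ha hb
      obtain ⟨k, hk1, hk2⟩ := exists_third a b
      obtain ⟨p, q, hvp, hvq, hpq, hp, hq⟩ := hG.exists_link_edge hc hab
      exact ⟨a, b, k, hab, hk1.symm, hk2.symm, p, q, hvp, hvq, hpq, hp, hq,
        fun x hx hxa => ha x p hx hvp hxa hp, fun x hx hxb => hb x q hx hvq hxb hq⟩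
    have hor : ∀ a b : Fin 3, a ≠ b →
        (∀ x y, G.Adj v x → G.Adj v y → c x = a → c y = a → x = y) ∨
        (∀ x y, G.Adj v x → G.Adj v y → c x = b → c y = b → x = y) := by
      intro a b hab
      obtain ⟨p, q, -, -, -, -, -, h | h⟩ := hall a b hab
      · exact Or.inl fun x y hx hy h1 h2 => (h x hx h1).trans (h y hy h2).symm
      · exact Or.inr fun x y hx hy h1 h2 => (h x hx h1).trans (h y hy h2).symm
    rcases hor 0 1 (by decide) with h0 | h1
    · rcases hor 1 2 (by decide) with h1 | h2
      · exact hsub 0 1 (by decide) h0 h1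
      · exact hsub 0 2 (by decide) h0 h2
    · rcases hor 0 2 (by decide) with h0 | h2
      · exact hsub 0 1 (by decide) h0 h1
      · exact hsub 1 2 (by decide) h1 h2
  obtain ⟨p₁, r, hvp₁, hvr, hpr, hp₁, hr⟩ := hG.exists_link_edge hc hak
  obtain rfl := hpu p₁ hvp₁ hp₁
  obtain ⟨q₁, s, hvq₁, hvs, hqs, hq₁, hs⟩ := hG.exists_link_edge hc hbk
  obtain rfl := hqu q₁ hvq₁ hq₁
  have hcol : ∀ x, G.Adj v x → x ≠ p₁ → x ≠ q₁ → c x = k := fun x hx h1 h2 =>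
    eq_of_ne_of_ne hab (fun h => h1 (hpu x hx h)) (fun h => h2 (hqu x hx h)) hak.symm hbk.symm
  have hpnb : ∀ x, G.Adj v x → G.Adj p₁ x → x = q₁ ∨ x = r := by
    intro x hvx hpx
    by_contra! h
    refine h.2 (L.link_edge_unique hc hvp₁ hvx hpx hvp₁ hvr hpr rfl ?_).2
    rw [hcol x hvx hpx.ne' h.1, hr]
  have hqnb : ∀ x, G.Adj v x → G.Adj q₁ x → x = p₁ ∨ x = s := by
    intro x hvx hqx
    by_contra! h
    refine h.2 (L.link_edge_unique hc hvq₁ hvx hqx hvq₁ hvs hqs rfl ?_).2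
    rw [hcol x hvx h.1 hqx.ne', hs]
  have hrs : r ≠ s := by
    rintro rfl
    exact hG.k4 v p₁ q₁ r hvp₁ hvq₁ hvr hpq hpr hqs
  refine ⟨p₁, q₁, r, s, hvp₁, hvq₁, hvr, hvs, hpq, hpr.symm, hqs, hrs, ?_, ?_, ?_, ?_⟩
  · rintro rfl
    exact hbk (hq₁.symm.trans hr)
  · rintro rfl
    exact hak (hp₁.symm.trans hs)
  · intro x y z hx hy hz hyx hyz hxz
    by_cases h1 : y = p₁
    · subst h1
      have h2 := hpnb x hx hyx
      have h3 := hpnb z hz hyz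
      grind
    by_cases h2 : y = q₁
    · subst h2
      have h2 := hqnb x hx hyx
      have h3 := hqnb z hz hyz
      grind
    -- a third vertex has no neighbour of its own colour, and at most one neighbour in `{p, q}`
    exfalso
    have hyk := hcol y hy h1 h2
    have key : ∀ x, G.Adj v x → G.Adj y x → (x = p₁ ∧ y = r) ∨ (x = q₁ ∧ y = s) := by
      intro x hx hyx
      by_cases h3 : x = p₁
      · subst h3
        exact Or.inl ⟨rfl, (hpnb y hy hyx.symm).resolve_left h2⟩
      by_cases h4 : x = q₁
      · subst h4
        exact Or.inr ⟨rfl, (hqnb y hy hyx.symm).resolve_left h1⟩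
      · exact absurd (hyk.trans (hcol x hx h3 h4).symm) (hc y hy.ne' x hx.ne' hyx)
    have h3 := key x hx hyx
    have h4 := key z hz hyz
    grind
  · intro d hd x hx h1 h2
    exact hG.colour_eq L hc hd hx.ne' hvs.ne' ((hcol x hx h1 h2).trans hs.symm)

end Critical

section Critical

variable {V : Type} {G : SimpleGraph V}

theorem Link.eq_or_eq {v p q r s x y z : V} (h : Link G v p q r s) (hx : G.Adj v x)
    (hy : G.Adj v y) (hz : G.Adj v z) (hyx : G.Adj y x) (hyz : G.Adj y z) (hxz : x ≠ z) :
    y = p ∨ y = q := by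
  rcases h.edges x y z hx hy hz hyx hyz hxz with h | h
  exacts [Or.inl h.1, Or.inr h.1]

variable [Fintype V] [DecidableEq V]

/-- The triangle `v p q` cannot be extended along each of its edges to a second triangle in such
a way that `{p, q}`, `{v, q}` and `{v, p}` are the middles of the three links: in a colouring of
`G - v`, the colours of `p` and `q` could be exchanged. -/
theorem IsCritical.false_of_middle (hG : IsCritical G) {α : ℕ} {J : Type}
    (L : LovaszSystem G α J) {v p q r s r₁ s₁ r₂ s₂ : V} (h : Link G v p q r s)
    (hp : Link G p v q r₁ s₁) (hq : Link G q v p r₂ s₂) (hrp : G.Adj r p) (hsq : G.Adj q s) :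
    False := by
  obtain ⟨c, hc⟩ := hG.colorable v
  have hpv := h.vp.ne'
  have hqv := h.vq.ne'
  have hpq := hc p hpv q hqv h.pq
  have hrs : c r = c s := h.colour c hc r h.vr hrp.ne h.r_ne_q
  have hps : c p ≠ c s := hrs ▸ (hc r h.vr.ne' p hpv hrp).symm
  have hqs : c q ≠ c s := hc q hqv s h.vs.ne' hsq
  -- all further neighbours of `v`, `p` and `q` have the colour of `s`
  have key : ∀ w w' x, G.Adj v w → G.Adj v w' → c w ≠ c s → c w' ≠ c s → w ≠ w' →
      (∀ y, G.Adj v y → y ≠ w → y ≠ w' → c y = c s) → (∃ r₁ s₁, Link G w v w' r₁ s₁) →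
      (∃ y, G.Adj v y ∧ G.Adj w y ∧ y ≠ w' ∧ c y = c s) → c w ≠ c w' →
      G.Adj w x → x ≠ v → x ≠ w' → c x = c s := by
    intro w w' x hvw hvw' hw hw' hww' hcol hl hy hne hwx hxv hxw'
    obtain ⟨r₁, s₁, hl⟩ := hl
    obtain ⟨y, hvy, hwy, hyw', hyc⟩ := hy
    have hc' : ProperOn G {w}ᶜ (fun u => if u = v then c w else c u) := by
      have hvu : ∀ u, u ≠ w → G.Adj v u → c u ≠ c w := by
        intro u hu hvu h1
        by_cases h2 : u = w'
        · subst h2; exact hne h1.symm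
        · rw [hcol u hvu hu h2] at h1
          exact hw h1.symm
      intro a ha b hb hab
      by_cases hav : a = v <;> by_cases hbv : b = v
      · subst hav; subst hbv; exact absurd hab (G.loopless.irrefl _)
      · subst hav; simpa [hbv] using (hvu b hb hab).symm
      · subst hbv; simpa [hav] using hvu a ha hab.symm
      · simpa [hav, hbv] using hc a hav b hbv hab
    have h1 := hl.colour _ hc' x hwx hxv hxw'
    have h2 := hl.colour _ hc' y hwy hvy.ne' hyw'
    have h3 : c x = c y := by simpa [hxv, hvy.ne'] using h1.trans h2.symm
    rw [h3, hyc]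
  have hcolp : ∀ x, G.Adj p x → x ≠ v → x ≠ q → c x = c s := fun x =>
    key p q x h.vp h.vq hps hqs h.pq.ne (h.colour c hc) ⟨_, _, hp⟩
      ⟨r, h.vr, hrp.symm, h.r_ne_q, hrs⟩ hpq
  have hcolq : ∀ x, G.Adj q x → x ≠ v → x ≠ p → c x = c s := fun x =>
    key q p x h.vq h.vp hqs hps h.pq.ne' (fun y h1 h2 h3 => h.colour c hc y h1 h3 h2) ⟨_, _, hq⟩
      ⟨s, h.vs, hsq, h.p_ne_s.symm, rfl⟩ hpq.symm
  have hsw : ProperOn G {v}ᶜ (fun u => if u = p then c q else if u = q then c p else c u) := by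
    intro a ha b hb hab
    have hane : a ≠ v := ha
    have hbne : b ≠ v := hb
    have h0 := hc a ha b hb hab
    dsimp only
    split_ifs with h1 h2 h3 h4 h5 h6 h7 h8
    · subst h1; subst h2; exact absurd hab (G.loopless.irrefl _)
    · exact hpq.symm
    · subst h1; rw [hcolp b hab hbne h3]; exact hqs
    · exact hpq
    · subst h4; subst h6; exact absurd hab (G.loopless.irrefl _)
    · subst h4; rw [hcolq b hab hbne h5]; exact hps
    · subst h7; rw [hcolp a hab.symm hane h4]; exact hqs.symm
    · subst h8; rw [hcolq a hab.symm hane h1]; exact hps.symm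
    · exact h0
  have h1 : (colourClass c v (c p)).card ≤ 1 := by
    rw [Finset.card_le_one]
    have : ∀ x ∈ colourClass c v (c p), x = p := by
      intro x hx
      simp only [colourClass, Finset.mem_filter, Finset.mem_univ, true_and] at hx
      by_contra hxp
      have hxq : x ≠ q := fun h => hpq (by rw [← hx.2, h])
      have := hG.colour_eq L hc hsw hx.1 hpv hx.2
      simp only [hxp, hxq, if_true, if_false] at this
      exact hpq (hx.2.symm.trans this)
    intro x hx y hy
    rw [this x hx, this y hy]
  rw [L.card_colourClass v c hc, ← L.card_colourClass v c hc (c s), Finset.card_le_one] at h1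
  exact h.r_ne_s (h1 r (by simpa [colourClass, hrs] using h.vr.ne') s
    (by simpa [colourClass] using h.vs.ne'))

/-- The vertex `t` that continues the strip `r p v q s` is found in the link of `q`, where `v` is in
the middle. -/
theorem IsCritical.exists_next (hG : IsCritical G) {α : ℕ} {J : Type} (L : LovaszSystem G α J)
    {v p q r s : V} (h : Link G v p q r s) : ∃ t, Link G q v s p t := by
  obtain ⟨p', q', r', s', hq, hv⟩ : ∃ p' q' r' s', Link G q p' q' r' s' ∧ v = p' := by
    obtain ⟨p', q', r', s', hq⟩ := hG.exists_link L q
    rcases hq.eq_or_eq h.pq.symm h.vq.symm h.qs h.vp h.vs h.p_ne_s with hv | hv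
    · exact ⟨p', q', r', s', hq, hv⟩
    · exact ⟨q', p', s', r', hq.symm, hv⟩
  subst hv
  rcases hq.edges p v s h.pq.symm h.vq.symm h.qs h.vp h.vs h.p_ne_s with
    ⟨-, ⟨h1, h2⟩ | ⟨h1, h2⟩⟩ | ⟨h1, -⟩
  · exfalso
    subst h1 h2
    have hrs' : r ≠ s' := by
      rintro rfl
      exact hG.k4 v p q r h.vp h.vq h.vr h.pq h.rp.symm hq.vs
    obtain ⟨p₁, q₁, r₁, s₁, hp⟩ := hG.exists_link L p
    have hv := hp.eq_or_eq h.rp.symm h.vp.symm h.pq h.vr h.vq h.r_ne_q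
    have hq' := hp.eq_or_eq h.vp.symm h.pq hq.qs h.vq.symm hq.vs hq.p_ne_s
    have hne := h.vq.ne
    have : ∃ r₁ s₁, Link G p v q r₁ s₁ := by
      rcases hv with rfl | rfl <;> rcases hq' with rfl | rfl
      · exact absurd rfl hne
      · exact ⟨_, _, hp⟩
      · exact ⟨_, _, hp.symm⟩
      · exact absurd rfl hne
    obtain ⟨r₁, s₁, hp⟩ := this
    exact hG.false_of_middle L h hp hq h.rp h.qs
  · subst h1 h2
    exact ⟨_, hq⟩
  · exact absurd h1 hq.pq.ne

/-- An infinite sequence of vertices, each of which has the two preceding and the two following ones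
as its link. -/
theorem IsCritical.exists_strip (hG : IsCritical G) {α : ℕ} {J : Type} (L : LovaszSystem G α J)
    [Nonempty V] :
    ∃ w : ℕ → V, ∀ i, Link G (w (i + 2)) (w (i + 1)) (w (i + 3)) (w i) (w (i + 4)) := by
  obtain ⟨p, q, r, s, h⟩ := hG.exists_link L (Classical.arbitrary V)
  let W := {x : V × V × V × V × V // Link G x.1 x.2.1 x.2.2.1 x.2.2.2.1 x.2.2.2.2}
  let next : W → W := fun x => ⟨(x.1.2.2.1, x.1.1, x.1.2.2.2.2, x.1.2.1,
    Classical.choose (hG.exists_next L x.2)), Classical.choose_spec (hG.exists_next L x.2)⟩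
  let f : ℕ → W := fun n => next^[n] ⟨(_, p, q, r, s), h⟩
  have hf : ∀ n, f (n + 1) = next (f n) := fun n => Function.iterate_succ_apply' _ _ _
  refine ⟨fun i => (f i).1.2.2.2.1, fun i => ?_⟩
  simp only [hf, next]
  exact (f i).2

end Critical

section Critical

variable {V : Type} {G : SimpleGraph V}

/-- A strip that closes up does so without a twist, with a period of at least four. -/
theorem exists_periodic [Finite V] {w : ℕ → V}
    (hw : ∀ i, Link G (w (i + 2)) (w (i + 1)) (w (i + 3)) (w i) (w (i + 4))) :
    ∃ (u : ℕ → V) (m : ℕ), 4 ≤ m ∧ (∀ k, u (k + m) = u k) ∧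
      (∀ a b, a < b → b < a + m → u a ≠ u b) ∧
      ∀ i, Link G (u (i + 2)) (u (i + 1)) (u (i + 3)) (u i) (u (i + 4)) := by
  classical
  have hex : ∃ m, 0 < m ∧ ∃ i, 2 ≤ i ∧ w i = w (i + m) := by
    obtain ⟨a, b, hab, h⟩ := Finite.exists_ne_map_eq_of_infinite fun i => w (i + 2)
    rcases lt_or_gt_of_ne hab with hlt | hlt
    · exact ⟨b - a, by omega, a + 2, by omega, by
        rw [show a + 2 + (b - a) = b + 2 by omega]; exact h⟩
    · exact ⟨a - b, by omega, b + 2, by omega, by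
        rw [show b + 2 + (a - b) = a + 2 by omega]; exact h.symm⟩
  set m := Nat.find hex with hm
  obtain ⟨hm0, i₀, hi₀, hi⟩ := Nat.find_spec hex
  rw [← hm] at hm0 hi
  have hmin : ∀ a b, 2 ≤ a → a < b → w a = w b → m ≤ b - a := fun a b ha hab h =>
    Nat.find_min' hex ⟨by omega, a, ha, by rw [show a + (b - a) = b by omega]; exact h⟩
  have hadj1 : ∀ i, G.Adj (w i) (w (i + 1)) := fun i => (hw i).rp
  have hadj2 : ∀ i, G.Adj (w i) (w (i + 2)) := fun i => (hw i).vr.symm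
  have hm3 : 4 ≤ m := by
    by_contra hlt
    obtain h | h | h : m = 1 ∨ m = 2 ∨ m = 3 := by omega
    · rw [h] at hi; exact (hadj1 i₀).ne hi
    · rw [h] at hi; exact (hadj2 i₀).ne hi
    · rw [h] at hi; exact (hw i₀).r_ne_q hi
  have hstep : ∀ i, 2 ≤ i → w i = w (i + m) → w (i + 1) = w (i + 1 + m) := by
    intro i h2 hi
    obtain ⟨j, rfl⟩ : ∃ j, i = j + 2 := ⟨i - 2, by omega⟩
    have h1 := hw j
    have h3 := hw (j + m)
    rw [show j + m + 2 = j + 2 + m by omega, ← hi] at h3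
    -- both ends of the middle edge at `j` are in the middle at `j + m`
    rcases h3.eq_or_eq h1.vp h1.vq h1.vs h1.pq.symm h1.qs h1.p_ne_s with h | h
    · exfalso
      have := hmin (j + 3) (j + m + 1) (by omega) (by omega) h
      omega
    · rw [show j + 2 + 1 + m = j + m + 3 by omega]; exact h
  have hper : ∀ k, w (i₀ + k) = w (i₀ + k + m) := by
    intro k
    induction k with
    | zero => exact hi
    | succ k ih => exact hstep (i₀ + k) (by omega) ih
  refine ⟨fun k => w (i₀ + k), m, hm3, fun k => ?_, fun a b hab hb h => ?_, fun i => ?_⟩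
  · show w (i₀ + (k + m)) = w (i₀ + k)
    rw [hper k, Nat.add_assoc]
  · have := hmin (i₀ + a) (i₀ + b) (by omega) (by omega) h
    omega
  · exact hw (i₀ + i)

/-- If any three consecutive ones of the values `f 1, …, f (m - 1)` are different, then equal
ones have indices that are congruent modulo 3. -/
theorem add_three_mul_eq {f : ℕ → Fin 3} {m : ℕ} (h1 : ∀ j, 1 ≤ j → j + 1 < m → f j ≠ f (j + 1))
    (h2 : ∀ j, 1 ≤ j → j + 2 < m → f j ≠ f (j + 2)) {i j : ℕ} (hi : 1 ≤ i) (hj : 1 ≤ j)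
    (him : i < m) (hjm : j < m) (hm : 4 ≤ m) (h : f i = f j) : i % 3 = j % 3 := by
  have h3 : ∀ j, 1 ≤ j → j + 3 < m → f (j + 3) = f j := by
    intro j hj hjm
    exact eq_of_ne_of_ne (h1 (j + 1) (by omega) (by omega)) (h2 (j + 1) (by omega) (by omega)).symm
      (h1 (j + 2) (by omega) (by omega)).symm (h1 j hj (by omega)) (h2 j hj (by omega))
  have h4 : ∀ j, 1 ≤ j → j < m → f j = f ((j - 1) % 3 + 1) := by
    intro j
    induction j using Nat.strong_induction_on with
    | _ j ih =>
      intro hj hjm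
      by_cases hlt : j < 4
      · rw [Nat.mod_eq_of_lt (by omega), Nat.sub_add_cancel hj]
      · obtain ⟨k, rfl⟩ : ∃ k, j = k + 3 := ⟨j - 3, by omega⟩
        rw [h3 k (by omega) hjm, ih k (by omega) (by omega) (by omega)]
        congr 2
        omega
  rw [h4 i hi him, h4 j hj hjm] at h
  have h5 : ∀ a b, a < 3 → b < 3 → f (a + 1) = f (b + 1) → a = b := by
    have e1 := h1 1 (by omega) (by omega)
    have e2 := h1 2 (by omega) (by omega)
    have e3 := h2 1 (by omega) (by omega)
    intro a b ha hb hab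
    interval_cases a <;> interval_cases b <;>
      first | rfl | (exfalso; revert hab; simp_all [Ne.symm])
  have := h5 _ _ (Nat.mod_lt _ (by omega)) (Nat.mod_lt _ (by omega)) h
  omega

/-- The strip closes up to a graph on `m ≡ 1` vertices modulo 3, in which the vertices at distance
one and two along the strip are adjacent, and further edges join only vertices whose distance is
`2` modulo 3. For `m = 7` this is the complement of `C₇`; beyond that, the vertices of even index
contain a `C₅` or a `P₆`. -/
theorem IsCritical.elim (hG : IsCritical G) [Fintype V] [DecidableEq V] : False := by
  obtain ⟨α, J, ⟨L⟩⟩ := hG.exists_lovaszSystem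
  have : Nonempty V := by
    by_contra h
    rw [not_nonempty_iff] at h
    exact hG.not_colorable ⟨fun _ => 0, fun x => (h.false x).elim⟩
  obtain ⟨w, hw⟩ := hG.exists_strip L
  obtain ⟨u, m, hm4, hper, hinj, hlink⟩ := exists_periodic hw
  have adj1 : ∀ i, G.Adj (u i) (u (i + 1)) := fun i => (hlink i).rp
  have adj2 : ∀ i, G.Adj (u i) (u (i + 2)) := fun i => (hlink i).vr.symm
  -- a colouring of the strip without `u k`, in which the vertices adjacent to `u k`, other than the
  -- next ones on both sides, have the same colour
  have hcol : ∀ k, ∃ c : ℕ → Fin 3, (∀ j, 1 ≤ j → j + 1 < m → c j ≠ c (j + 1)) ∧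
      (∀ j, 1 ≤ j → j + 2 < m → c j ≠ c (j + 2)) ∧ c (m - 2) = c 2 ∧
      ∀ j, 1 < j → j < m - 1 → G.Adj (u k) (u (k + j)) → c j = c 2 := by
    intro k
    obtain ⟨c, hc⟩ := hG.colorable (u k)
    have hne : ∀ j, 1 ≤ j → j < m → u (k + j) ≠ u k := fun j h1 h2 =>
      (hinj k (k + j) (by omega) (by omega)).symm
    have hl := hlink (k + m - 2)
    rw [show k + m - 2 + 2 = k + m by omega, show k + m - 2 + 1 = k + (m - 1) by omega,
      show k + m - 2 + 3 = k + 1 + m by omega, show k + m - 2 + 4 = k + 2 + m by omega,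
      show k + m - 2 = k + (m - 2) by omega, hper, hper, hper] at hl
    refine ⟨fun j => c (u (k + j)), ?_, ?_, ?_, ?_⟩
    · intro j h1 h2
      exact hc _ (hne j h1 (by omega)) _ (hne (j + 1) (by omega) h2) (adj1 _)
    · intro j h1 h2
      exact hc _ (hne j h1 (by omega)) _ (hne (j + 2) (by omega) h2) (adj2 _)
    · exact hl.colour c hc _ hl.vr hl.rp.ne hl.r_ne_q
    · intro j h1 h2 hadj
      exact hl.colour c hc _ hadj (hinj _ _ (by omega) (by omega))
        (hinj _ _ (by omega) (by omega)).symm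
  have hmod : m % 3 = 1 := by
    obtain ⟨c, h1, h2, h3, -⟩ := hcol 0
    have := add_three_mul_eq h1 h2 (i := m - 2) (j := 2) (by omega) (by omega) (by omega)
      (by omega) hm4 h3
    omega
  have hnot : ∀ k j, 1 < j → j < m - 1 → j % 3 ≠ 2 → ¬ G.Adj (u k) (u (k + j)) := by
    intro k j hj1 hj2 hj3 hadj
    obtain ⟨c, h1, h2, -, h4⟩ := hcol k
    exact hj3 (add_three_mul_eq h1 h2 (i := j) (j := 2) (by omega) (by omega) (by omega)
      (by omega) hm4 (h4 j hj1 hj2 hadj))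
  have adjm : ∀ i, G.Adj (u i) (u (i + (m - 2))) := fun i => by
    have := adj2 (i + (m - 2))
    rw [show i + (m - 2) + 2 = i + m by omega, hper] at this
    exact this.symm
  have adjm' : ∀ i, G.Adj (u i) (u (i + (m - 1))) := fun i => by
    have := adj1 (i + (m - 1))
    rw [show i + (m - 1) + 1 = i + m by omega, hper] at this
    exact this.symm
  by_cases hm : m = 4
  · subst hm
    have h := (hlink 0).r_ne_s
    rw [hper 0] at h
    exact h rfl
  by_cases hm : m = 7
  · -- multiplication by 3 modulo 7 takes the differences 1 and 6 to 3 and 4, the differences of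
    -- non-adjacent vertices of the strip
    subst hm
    refine hG.a7 (isIndContained_of_adj_iff (fun t : Fin 7 => u (3 * t.val % 7)) ?_
      (adj_iff_of_lt ?_))
    · simp only [SimpleGraph.compl_adj, SimpleGraph.cycleGraph_adj']; decide
    · have key : ∀ a b, a < b → b < 7 → (G.Adj (u a) (u b) ↔ b - a ≠ 3 ∧ b - a ≠ 4) := by
        intro a b hab hb
        obtain ⟨d, rfl⟩ : ∃ d, b = a + d := ⟨b - a, by omega⟩
        rw [Nat.add_sub_cancel_left]
        have hd : d < 7 := by omega
        have hd0 : 0 < d := by omega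
        clear hb hab
        interval_cases d
        · exact iff_of_true (adj1 a) (by decide)
        · exact iff_of_true (adj2 a) (by decide)
        · exact iff_of_false (hnot a 3 (by omega) (by omega) (by omega)) (by decide)
        · exact iff_of_false (hnot a 4 (by omega) (by omega) (by omega)) (by decide)
        · exact iff_of_true (adjm a) (by decide)
        · exact iff_of_true (adjm' a) (by decide)
      intro i j hij
      have hj : i.val < j.val := hij
      simp only [SimpleGraph.compl_adj, SimpleGraph.cycleGraph_adj']
      rcases lt_trichotomy (3 * i.val % 7) (3 * j.val % 7) with h | h | h
      · rw [key _ _ h (Nat.mod_lt _ (by omega))]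
        revert i j; decide
      · omega
      · rw [G.adj_comm, key _ _ h (Nat.mod_lt _ (by omega))]
        revert i j; decide
  have hm10 : 10 ≤ m := by omega
  -- an edge between vertices at distance 8 closes a `C₅`
  have h8 : ∀ i, ¬ G.Adj (u i) (u (i + 8)) := fun i h =>
    hG.c5 _ _ _ _ _ (adj2 i) (adj2 (i + 2)) (adj2 (i + 4)) (adj2 (i + 6)) h.symm
      (hnot i 4 (by omega) (by omega) (by omega)) (hnot i 6 (by omega) (by omega) (by omega))
      (hnot (i + 2) 4 (by omega) (by omega) (by omega))
      (hnot (i + 2) 6 (by omega) (by omega) (by omega))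
      (hnot (i + 4) 4 (by omega) (by omega) (by omega))
  by_cases hm : m = 10
  · subst hm
    exact h8 0 (adjm 0)
  exact hG.p6 _ _ _ _ _ _ (adj2 0) (adj2 2) (adj2 4) (adj2 6) (adj2 8)
    (hnot 0 4 (by omega) (by omega) (by omega)) (hnot 0 6 (by omega) (by omega) (by omega)) (h8 0)
    (hnot 0 10 (by omega) (by omega) (by omega))
    (hnot 2 4 (by omega) (by omega) (by omega)) (hnot 2 6 (by omega) (by omega) (by omega)) (h8 2)
    (hnot 4 4 (by omega) (by omega) (by omega)) (hnot 4 6 (by omega) (by omega) (by omega))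
    (hnot 6 4 (by omega) (by omega) (by omega))

/-- Without induced `P₆`, `C₅`, `K₄` and complements of `C₇`, a finite graph is 3-colourable. -/
theorem exists_properOn_three (h6 : NoP6 G) (h5 : NoC5 G) (S : Finset V)
    (h4 : ∀ a ∈ S, ∀ b ∈ S, ∀ c ∈ S, ∀ d ∈ S, G.Adj a b → G.Adj a c → G.Adj a d → G.Adj b c →
      G.Adj b d → ¬ G.Adj c d)
    (h7 : ∀ f : Fin 7 → V, (∀ i, f i ∈ S) →
      ¬ ∀ i j, (SimpleGraph.cycleGraph 7)ᶜ.Adj i j ↔ G.Adj (f i) (f j)) :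
    ∃ c : V → Fin 3, ProperOn G (S : Set V) c := by
  classical
  induction S using Finset.strongInductionOn with
  | _ S ih =>
    by_contra hcon
    have ext : ∀ c : S → Fin 3, ∃ c' : V → Fin 3, ∀ x : S, c' x = c x := fun c =>
      ⟨fun x => if h : x ∈ S then c ⟨x, h⟩ else 0, fun x => by simp⟩
    refine IsCritical.elim (G := G.induce (S : Set V)) ⟨?_, ?_, ?_, ?_, ?_, ?_⟩
    · intro a b c d e f
      exact h6 a.1 b.1 c.1 d.1 e.1 f.1
    · intro a b c d e
      exact h5 a.1 b.1 c.1 d.1 e.1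
    · intro a b c d
      exact h4 a.1 a.2 b.1 b.2 c.1 c.2 d.1 d.2
    · rintro ⟨f⟩
      exact h7 (fun i => (f i).1) (fun i => (f i).2) fun i j => f.map_rel_iff.symm
    · rintro ⟨c, hc⟩
      obtain ⟨c', hc'⟩ := ext c
      refine hcon ⟨c', fun x hx y hy hxy => ?_⟩
      rw [hc' ⟨x, hx⟩, hc' ⟨y, hy⟩]
      exact hc _ trivial _ trivial hxy
    · intro v
      obtain ⟨c, hc⟩ := ih (S.erase v.1) (Finset.erase_ssubset v.2)
        (fun a ha b hb c hc d hd => h4 a (Finset.mem_of_mem_erase ha) b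
          (Finset.mem_of_mem_erase hb) c (Finset.mem_of_mem_erase hc) d
          (Finset.mem_of_mem_erase hd))
        (fun f hf => h7 f fun i => Finset.mem_of_mem_erase (hf i))
      refine ⟨fun x => c x.1, fun x hx y hy hxy => hc _ ?_ _ ?_ hxy⟩
      · exact Finset.mem_erase.2 ⟨fun h => hx (Subtype.ext h), x.2⟩
      · exact Finset.mem_erase.2 ⟨fun h => hy (Subtype.ext h), y.2⟩

end Critical

/-! ### Sets of vertices of a 7-antihole -/

/-- The adjacency of the complement of `C₇`. -/
abbrev A7 (i j : Fin 7) : Prop := 2 ≤ (j - i).val ∧ (j - i).val ≤ 5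

/-- The set of bits of `A`, as a predicate. -/
abbrev bits (A : Fin 128) (t : Fin 7) : Prop := A.val.testBit t.val = true

theorem exists_eq_bits (P : Fin 7 → Prop) : ∃ A, P = bits A := by
  classical
  refine ⟨⟨Nat.ofBits fun t => decide (P t), Nat.ofBits_lt_two_pow _⟩, funext fun t => propext ?_⟩
  rw [bits, Nat.testBit_ofBits_lt _ _ t.isLt]
  simp

section Patterns

variable (P : Fin 7 → Prop) (J : Option (Fin 7))

/-- `P` contains a triangle of the antihole. -/
def HasTriangle : Prop := ∃ i : Fin 7, P i ∧ P (i + 2) ∧ P (i + 4)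

/-- `P` has at least two elements. -/
def HasPair : Prop := ∃ i j : Fin 7, i ≠ j ∧ P i ∧ P j

/-- If `P` contains two consecutive vertices, then also the preceding or the following one.
(Otherwise a vertex with the trace `P` is on a `C₅`.) -/
def NoMiddle : Prop := ∀ i, P i → P (i + 1) → P (i + 2) ∨ P (i - 1)

/-- No window of four consecutive vertices avoiding `J` meets `P` in one of the two vertices in the
middle only. (Such a window gives a `P₆` starting with a vertex of trace `J` and a neighbour of
trace `P`.) -/
def NoSingle : Prop := ∀ i, J ≠ some (i - 1) → J ≠ some i → J ≠ some (i + 1) → J ≠ some (i + 2) →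
  ¬ P (i - 1) → ¬ P (i + 2) → (P i ↔ P (i + 1))

/-- If `P` contains a vertex `p` next to the vertex of `J`, but not the latter, then it contains
all common neighbours of these. (Otherwise adjacent vertices of traces `P` and `J` are on a
`C₅`.) -/
def Guarded : Prop := ∀ j, J = some j → ¬ P j → ∀ p, P p → ¬ A7 p j → ∀ q, A7 p q → A7 q j → P q

/-- There is no induced path `p q r` outside `J` that meets `P` in `p` only. (Such a path gives a
`P₆` starting with two vertices of trace `J`, the second of which has a neighbour of trace `P`.) -/
def NoExit : Prop := ∀ p, P p → J ≠ some p → ∀ q, A7 p q → ¬ P q → J ≠ some q →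
  ∀ r, (r = p + 1 ∨ r = p - 1) → A7 q r → J ≠ some r → P r

variable [DecidablePred P]

instance : Decidable (HasTriangle P) := by unfold HasTriangle; infer_instance
instance : Decidable (HasPair P) := by unfold HasPair; infer_instance
instance : Decidable (NoMiddle P) := by unfold NoMiddle; infer_instance
instance : Decidable (NoSingle P J) := by unfold NoSingle; infer_instance
instance : Decidable (Guarded P J) := by unfold Guarded; infer_instance
instance : Decidable (NoExit P J) := by unfold NoExit; infer_instance

end Patterns

/-- The set of the `l` consecutive vertices starting with `s`. -/
abbrev run (s : Fin 7) (l : ℕ) (t : Fin 7) : Prop := (t - s).val < l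

/-- `P` consists of `l` consecutive vertices. -/
def IsInterval (P : Fin 7 → Prop) (l : ℕ) : Prop := ∃ s, ∀ t, P t ↔ run s l t

instance (P : Fin 7 → Prop) [DecidablePred P] (l : ℕ) : Decidable (IsInterval P l) := by
  unfold IsInterval; infer_instance

theorem IsInterval.eq {P : Fin 7 → Prop} {l : ℕ} (h : IsInterval P l) : ∃ s, P = run s l :=
  h.imp fun _ hs => funext fun t => propext (hs t)

/-! The following facts are checked for all subsets of the antihole, encoded by their bits. -/

set_option maxRecDepth 100000 in
theorem bits_small_exit : ∀ A, HasPair (bits A) → ¬ HasTriangle (bits A) → NoMiddle (bits A) →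
    ∀ J, NoSingle (bits A) J → Guarded (bits A) J → ¬ NoExit (bits A) J := by
  decide +kernel

set_option maxRecDepth 100000 in
theorem bits_small_run : ∀ A, HasPair (bits A) → ¬ HasTriangle (bits A) → NoMiddle (bits A) →
    ∀ J, NoSingle (bits A) J → Guarded (bits A) J →
      IsInterval (bits A) 3 ∨ IsInterval (bits A) 4 := by
  decide +kernel

set_option maxRecDepth 100000 in
theorem bits_big_run : ∀ A, HasTriangle (bits A) → ¬ (∀ t, bits A t) → NoMiddle (bits A) →
    ∀ J, Guarded (bits A) J → NoExit (bits A) J →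
      IsInterval (bits A) 5 ∨ IsInterval (bits A) 6 := by
  decide +kernel

set_option maxRecDepth 100000 in
theorem bits_big_exit : ∀ A, HasTriangle (bits A) → ∀ t₀ : Fin 7, ¬ bits A t₀ → ∀ J, J ≠ some t₀ →
    ∃ p r : Fin 7, bits A p ∧ ¬ bits A r ∧ A7 p r ∧ J ≠ some p ∧ J ≠ some r := by
  decide +kernel

/-- The 4-colouring of the antihole in which `k` is alone in its class. -/
def col (k t : Fin 7) : Fin 4 := ⟨((t - k).val + 1) / 2, by omega⟩

/-- There is an edge of the antihole, outside `J`, with one end only in `P` and the other only in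
`P'`. -/
def Crossing (P P' : Fin 7 → Prop) (J : Option (Fin 7)) : Prop :=
  ∃ p q : Fin 7, P p ∧ ¬ P' p ∧ P' q ∧ ¬ P q ∧ A7 p q ∧ J ≠ some p ∧ J ≠ some q

instance (P P' : Fin 7 → Prop) [DecidablePred P] [DecidablePred P'] (J : Option (Fin 7)) :
    Decidable (Crossing P P' J) := by unfold Crossing; infer_instance

set_option maxRecDepth 100000 in
theorem crossing_small_run : ∀ l ∈ [3, 4], ∀ l' ∈ [3, 4], ∀ s J, Guarded (run s l) J →
    ∀ s', Guarded (run s' l') J → ∀ p, run s l p → ¬ run s' l' p →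
      ∀ q, run s' l' q → ¬ run s l q → Crossing (run s l) (run s' l') J := by
  decide +kernel

/-- `P` misses the class of `p` in the colouring `col k`. -/
def Misses (P : Fin 7 → Prop) (k p : Fin 7) : Prop := ∀ t, P t → col k t ≠ col k p

instance (P : Fin 7 → Prop) [DecidablePred P] (k p : Fin 7) : Decidable (Misses P k p) := by
  unfold Misses; infer_instance

/-- There is an edge of the antihole joining the classes of `p` and `q` in the colouring `col k`,
with one end only in `P` and the other only in `P'`. -/
def ColourCrossing (P P' : Fin 7 → Prop) (k p q : Fin 7) : Prop :=
  ∃ p' q' : Fin 7, P q' ∧ ¬ P' q' ∧ P' p' ∧ ¬ P p' ∧ A7 q' p' ∧ col k p' = col k p ∧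
    col k q' = col k q

instance (P P' : Fin 7 → Prop) [DecidablePred P] [DecidablePred P'] (k p q : Fin 7) :
    Decidable (ColourCrossing P P' k p q) := by unfold ColourCrossing; infer_instance

set_option maxRecDepth 100000 in
theorem crossing_big_run : ∀ l ∈ [5, 6], ∀ l' ∈ [5, 6], ∀ k s p, Misses (run s l) k p →
    ∀ s' q, Misses (run s' l') k q → col k p ≠ col k q →
      ColourCrossing (run s l) (run s' l') k p q := by
  decide +kernel

set_option maxRecDepth 100000 in
theorem bits_matching : ∀ A, (∀ t, bits A t → ¬ bits A (t + 1)) →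
    (Finset.univ.filter fun t => ¬ bits A (t - 1)).card ≤ 4 →
      ∃ k : Fin 7, ∀ t, bits A t ↔ t = k + 1 ∨ t = k + 3 ∨ t = k + 5 := by
  decide +kernel

/-- Every 4-colouring of the antihole has one class of size one and three classes that consist of
two consecutive vertices. -/
theorem exists_col {c : Fin 7 → Fin 4} (hc : ∀ s t, A7 s t → c s ≠ c t) :
    ∃ k, ∀ s t, c s = c t ↔ col k s = col k t := by
  have hcons : ∀ s t, c s = c t → s = t ∨ t = s + 1 ∨ s = t + 1 := by
    intro s t h
    have h1 : ¬ A7 s t := fun h1 => hc s t h1 h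
    clear h hc
    revert s t; decide
  obtain ⟨A, hA⟩ := exists_eq_bits fun t => c t = c (t + 1)
  have hA' : ∀ t, bits A t ↔ c t = c (t + 1) := fun t => by rw [← hA]
  obtain ⟨k, hk⟩ := bits_matching A (by
    intro t h1 h2
    rw [hA'] at h1 h2
    refine hc t (t + 1 + 1) ?_ (h1.trans h2)
    clear h1 h2
    revert t; decide) (by
    refine (Finset.card_le_card_of_injOn c (t := Finset.univ) (fun _ _ => by simp) ?_).trans
      (by simp)
    intro s hs t ht h
    simp only [Finset.coe_filter, Finset.mem_univ, true_and, Set.mem_ofPred_eq, hA',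
      sub_add_cancel] at hs ht
    rcases hcons s t h with h1 | h1 | h1
    · exact h1
    · subst h1; exact absurd (by simpa using h) ht
    · subst h1; exact absurd (by simpa using h.symm) hs)
  refine ⟨k, fun s t => ?_⟩
  have h1 : c s = c t ↔ s = t ∨ (t = s + 1 ∧ bits A s) ∨ (s = t + 1 ∧ bits A t) := by
    constructor
    · intro h
      rcases hcons s t h with h1 | h1 | h1
      · exact Or.inl h1
      · exact Or.inr (Or.inl ⟨h1, (hA' s).2 (h1 ▸ h)⟩)
      · exact Or.inr (Or.inr ⟨h1, (hA' t).2 (h1 ▸ h.symm)⟩)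
    · rintro (rfl | ⟨rfl, h⟩ | ⟨rfl, h⟩)
      · rfl
      · exact (hA' s).1 h
      · exact ((hA' t).1 h).symm
  rw [h1, hk, hk]
  clear h1 hk hA' hA hcons hc
  revert k s t; decide

/-! ### Traces of vertices on a 7-antihole -/

section Traces

variable {V : Type} {G : SimpleGraph V} {v : Antihole G}

theorem adj_antihole (v : Antihole G) (i j : Fin 7) : G.Adj (v i) (v j) ↔ A7 i j := by
  rw [v.map_rel_iff, SimpleGraph.compl_adj, SimpleGraph.cycleGraph_adj']
  revert i j; decide

/-- The set of the neighbours of `x` in the antihole. -/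
abbrev trace (v : Antihole G) (x : V) (t : Fin 7) : Prop := G.Adj x (v t)

/-- `y` has exactly the neighbours `J` in the antihole, that is, one or none. -/
def Weak (v : Antihole G) (J : Option (Fin 7)) (y : V) : Prop := ∀ t, G.Adj y (v t) ↔ J = some t

theorem weak_or (v : Antihole G) (x : V) : (∃ J, Weak v J x) ∨
    (HasPair (trace v x) ∧ ¬ HasTriangle (trace v x)) ∨ HasTriangle (trace v x) := by
  by_cases h3 : HasTriangle (trace v x)
  · exact Or.inr (Or.inr h3)
  by_cases h2 : HasPair (trace v x)
  · exact Or.inr (Or.inl ⟨h2, h3⟩)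
  refine Or.inl ?_
  by_cases h1 : ∃ j, G.Adj x (v j)
  · obtain ⟨j, hj⟩ := h1
    refine ⟨some j, fun t => ⟨fun ht => ?_, fun ht => ?_⟩⟩
    · by_contra hne
      exact h2 ⟨j, t, fun h => hne (by rw [h]), hj, ht⟩
    · obtain rfl := Option.some_injective _ ht
      exact hj
  · exact ⟨none, fun t => ⟨fun ht => (h1 ⟨t, ht⟩).elim, fun ht => by simp at ht⟩⟩

theorem Weak.not_hasPair {J : Option (Fin 7)} {y : V} (h : Weak v J y) :
    ¬ HasPair (trace v y) := by
  rintro ⟨i, j, hij, hi, hj⟩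
  exact hij (Option.some_injective _ (((h i).1 hi).symm.trans ((h j).1 hj)))

theorem HasTriangle.hasPair {P : Fin 7 → Prop} (h : HasTriangle P) : HasPair P := by
  obtain ⟨i, h0, h2, -⟩ := h
  exact ⟨i, i + 2, by clear h0 h2; revert i; decide, h0, h2⟩

theorem hasPair_antihole (v : Antihole G) (t : Fin 7) : HasPair (trace v (v t)) :=
  ⟨t + 2, t + 3, by revert t; decide, (adj_antihole v _ _).2 (by revert t; decide),
    (adj_antihole v _ _).2 (by revert t; decide)⟩

theorem mem_setY_union_setZ {y : V} : y ∈ setY G v ∪ setZ G v ↔ ∃ J, Weak v J y := by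
  have hX : y ∉ Set.range v → (y ∈ setX G v ↔ ∃ j, G.Adj y (v j)) := by
    intro hy
    constructor
    · rintro ⟨-, _, ⟨j, rfl⟩, hj⟩
      exact ⟨j, hj.symm⟩
    · rintro ⟨j, hj⟩
      exact ⟨hy, v j, ⟨j, rfl⟩, hj.symm⟩
  constructor
  · rintro (hy | ⟨-, j, hj⟩)
    · refine ⟨none, fun t => ⟨fun ht => ?_, fun ht => by simp at ht⟩⟩
      have hyv : y ∉ Set.range v := fun h => hy (Or.inl h)
      exact (hy (Or.inr ((hX hyv).2 ⟨t, ht⟩))).elim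
    · exact ⟨some j, fun t => (hj t).trans
        ⟨fun h => by rw [h], fun h => (Option.some_injective _ h).symm⟩⟩
  · rintro ⟨J, hJ⟩
    have hyv : y ∉ Set.range v := by
      rintro ⟨t, rfl⟩
      exact hJ.not_hasPair (hasPair_antihole v t)
    rcases J with _ | j
    · left
      rintro (h | h)
      · exact hyv h
      · obtain ⟨j, hj⟩ := (hX hyv).1 h
        simpa using (hJ j).1 hj
    · right
      refine ⟨(hX hyv).2 ⟨j, (hJ j).2 rfl⟩, j, fun t => (hJ t).trans ?_⟩
      exact ⟨fun h => (Option.some_injective _ h).symm, fun h => by rw [h]⟩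

theorem exists_weak_iff {y : V} :
    (∃ J, Weak v J y) ↔ ¬ HasPair (trace v y) := by
  refine ⟨fun ⟨J, hJ⟩ => hJ.not_hasPair, fun h => ?_⟩
  rcases weak_or v y with h1 | h1 | h1
  exacts [h1, (h h1.1).elim, (h h1.hasPair).elim]

theorem mem_setG'_iff {x : V} :
    x ∈ setG' G v ↔ HasPair (trace v x) := by
  have key := mem_setY_union_setZ (v := v) (y := x)
  rw [exists_weak_iff] at key
  constructor
  · rintro (⟨t, rfl⟩ | ⟨hX, hZ⟩)
    · exact hasPair_antihole v t
    · by_contra h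
      rcases key.2 h with h | h
      exacts [h (Or.inr hX), hZ h]
  · intro h
    by_contra hx
    refine absurd h (key.1 ?_)
    by_cases hZ : x ∈ setZ G v
    · exact Or.inr hZ
    · refine Or.inl fun hx' => hx ?_
      rcases hx' with hx' | hx'
      exacts [Or.inl hx', Or.inr ⟨hx', hZ⟩]

theorem noMiddle_trace (h5 : NoC5 G) (v : Antihole G) (x : V) : NoMiddle (trace v x) := by
  intro i h0 h1
  by_contra! hcon
  refine h5 x (v i) (v (i + 2)) (v (i - 1)) (v (i + 1)) h0 ?_ ?_ ?_ h1.symm hcon.1 hcon.2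
    ?_ ?_ ?_ <;> rw [adj_antihole] <;> clear hcon h0 h1 <;> revert i <;> decide

theorem Weak.noSingle (h6 : NoP6 G) {J : Option (Fin 7)} {x y : V} (hy : Weak v J y)
    (hxy : G.Adj x y) : NoSingle (trace v x) J := by
  intro i j0 j1 j2 j3 h0 h3
  rw [Ne, ← hy] at j0 j1 j2 j3
  by_contra hcon
  rw [iff_iff_and_or_not_and_not] at hcon
  push Not at hcon
  by_cases h1 : G.Adj x (v i)
  · refine h6 y x (v i) (v (i + 2)) (v (i - 1)) (v (i + 1)) hxy.symm h1 ?_ ?_ ?_ j1 j3 j0 j2 h3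
      h0 (hcon.1 h1) ?_ ?_ ?_ <;> rw [adj_antihole] <;> clear hcon h0 h1 h3 j0 j1 j2 j3 <;>
      revert i <;> decide
  · have h2 : G.Adj x (v (i + 1)) := by_contra fun h2 => h1 (by tauto)
    refine h6 y x (v (i + 1)) (v (i - 1)) (v (i + 2)) (v i) hxy.symm h2 ?_ ?_ ?_ j2 j0 j3 j1 h0
      h3 h1 ?_ ?_ ?_ <;> rw [adj_antihole] <;> clear hcon h0 h1 h2 h3 j0 j1 j2 j3 <;>
      revert i <;> decide

theorem Weak.guarded (h5 : NoC5 G) {J : Option (Fin 7)} {x y : V} (hy : Weak v J y)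
    (hxy : G.Adj x y) : Guarded (trace v x) J := by
  rintro j rfl hxj p hxp hpj q hpq hqj
  by_contra hxq
  refine h5 y x (v p) (v q) (v j) hxy.symm hxp ((adj_antihole v _ _).2 hpq)
    ((adj_antihole v _ _).2 hqj) ((hy j).2 rfl).symm ?_ ?_ hxq hxj ?_
  · rw [hy]
    rintro h
    rw [Option.some_injective _ h] at hxj
    exact hxj hxp
  · rw [hy]
    rintro h
    rw [Option.some_injective _ h] at hqj
    simp [A7] at hqj
  · rwa [adj_antihole]

theorem Weak.noExit (h6 : NoP6 G) {J : Option (Fin 7)} {x y y' : V} (hy : Weak v J y)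
    (hy' : Weak v J y') (hxy : G.Adj x y) (hyy : G.Adj y y') (hxy' : ¬ G.Adj x y') :
    NoExit (trace v x) J := by
  intro p hp jp q hpq hq jq r hr hqr jr
  by_contra hxr
  refine h6 y' y x (v p) (v q) (v r) hyy.symm hxy.symm hp ((adj_antihole v _ _).2 hpq)
    ((adj_antihole v _ _).2 hqr) (fun h => hxy' h.symm) ?_ ?_ ?_ ?_ ?_ ?_ hq hxr ?_
  · rwa [hy']
  · rwa [hy']
  · rwa [hy']
  · rwa [hy]
  · rwa [hy]
  · rwa [hy]
  · rw [adj_antihole]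
    clear hp hpq jp hq hxr hqr jr
    rcases hr with rfl | rfl <;> revert p <;> decide

theorem weak_trace_aux : ∀ (j : Fin 7) (J : Option (Fin 7)), J ≠ some j →
    NoSingle (fun t => some j = some t) J → ¬ Guarded (fun t => some j = some t) J := by
  decide +kernel

/-- Adjacent vertices with at most one neighbour in the antihole have the same trace. -/
theorem Weak.eq (h6 : NoP6 G) (h5 : NoC5 G) {J J' : Option (Fin 7)} {y y' : V} (hy : Weak v J y)
    (hy' : Weak v J' y') (hyy : G.Adj y y') : J = J' := by
  have key : ∀ {J J' : Option (Fin 7)} {y y' : V}, Weak v J y → Weak v J' y' → G.Adj y y' →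
      ∀ j, J = some j → J' = some j := by
    rintro J J' y y' hy hy' hyy j rfl
    by_contra hne
    have h : trace v y = fun t => some j = some t := funext fun t => propext (hy t)
    exact weak_trace_aux j J' hne (h ▸ hy'.noSingle h6 hyy) (h ▸ hy'.guarded h5 hyy)
  rcases J with _ | j
  · rcases J' with _ | j'
    · rfl
    · exact key hy' hy hyy.symm j' rfl
  · exact (key hy hy' hyy j rfl).symm

/-- A small vertex adjacent to a weak vertex is adjacent to all weak neighbours of the latter. -/
theorem adj_of_small (h6 : NoP6 G) (h5 : NoC5 G) {J : Option (Fin 7)} {x y y' : V}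
    (h2 : HasPair (trace v x)) (h3 : ¬ HasTriangle (trace v x)) (hy : Weak v J y)
    (hy' : Weak v J y') (hxy : G.Adj x y) (hyy : G.Adj y y') : G.Adj x y' := by
  by_contra hxy'
  obtain ⟨A, hA⟩ := exists_eq_bits (trace v x)
  exact bits_small_exit A (hA ▸ h2) (hA ▸ h3) (hA ▸ noMiddle_trace h5 v x) J
    (hA ▸ hy.noSingle h6 hxy) (hA ▸ hy.guarded h5 hxy) (hA ▸ hy.noExit h6 hy' hxy hyy hxy')

theorem Weak.isInterval_small (h6 : NoP6 G) (h5 : NoC5 G) {J : Option (Fin 7)} {x y : V}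
    (h2 : HasPair (trace v x)) (h3 : ¬ HasTriangle (trace v x)) (hy : Weak v J y)
    (hxy : G.Adj x y) : IsInterval (trace v x) 3 ∨ IsInterval (trace v x) 4 := by
  obtain ⟨A, hA⟩ := exists_eq_bits (trace v x)
  rw [hA]
  exact bits_small_run A (hA ▸ h2) (hA ▸ h3) (hA ▸ noMiddle_trace h5 v x) J
    (hA ▸ hy.noSingle h6 hxy) (hA ▸ hy.guarded h5 hxy)

theorem Weak.isInterval_big (h6 : NoP6 G) (h5 : NoC5 G) {J : Option (Fin 7)} {x y y' : V}
    (h3 : HasTriangle (trace v x)) (hx : ¬ ∀ t, G.Adj x (v t)) (hy : Weak v J y)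
    (hy' : Weak v J y') (hxy : G.Adj x y) (hyy : G.Adj y y') (hxy' : ¬ G.Adj x y') :
    IsInterval (trace v x) 5 ∨ IsInterval (trace v x) 6 := by
  obtain ⟨A, hA⟩ := exists_eq_bits (trace v x)
  have hx' : ¬ ∀ t, trace v x t := hx
  rw [hA] at hx' ⊢
  exact bits_big_run A (hA ▸ h3) hx' (hA ▸ noMiddle_trace h5 v x) J
    (hA ▸ hy.guarded h5 hxy) (hA ▸ hy.noExit h6 hy' hxy hyy hxy')

/-- If a big vertex `b` separates the first from the second and third of three weak vertices
`y₁ ~ y₂ ~ y₃`, then these form a triangle: otherwise they start a `P₆` leaving through `b`. -/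
theorem adj_of_big (h6 : NoP6 G) {J : Option (Fin 7)} {b y₁ y₂ y₃ : V} {t₀ : Fin 7}
    (h3 : HasTriangle (trace v b)) (ht₀ : ¬ G.Adj b (v t₀)) (hJ : J ≠ some t₀)
    (hy₁ : Weak v J y₁) (hy₂ : Weak v J y₂) (hy₃ : Weak v J y₃) (hb₁ : G.Adj b y₁)
    (hb₂ : ¬ G.Adj b y₂) (hb₃ : ¬ G.Adj b y₃) (h12 : G.Adj y₁ y₂) (h23 : G.Adj y₂ y₃) :
    G.Adj y₁ y₃ := by
  by_contra h13
  obtain ⟨A, hA⟩ := exists_eq_bits (trace v b)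
  have ht₀' : ¬ trace v b t₀ := ht₀
  rw [hA] at h3 ht₀'
  obtain ⟨p, r, hp, hr, hpr, jp, jr⟩ := bits_big_exit A h3 t₀ ht₀' J hJ
  rw [← hA] at hp hr
  rw [Ne] at jp jr
  exact h6 y₃ y₂ y₁ b (v p) (v r) h23.symm h12.symm hb₁.symm hp ((adj_antihole v _ _).2 hpr)
    (fun h => h13 h.symm) (fun h => hb₃ h.symm) (by rwa [hy₃]) (by rwa [hy₃])
    (fun h => hb₂ h.symm) (by rwa [hy₂]) (by rwa [hy₂]) (by rwa [hy₁]) (by rwa [hy₁]) hr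

/-- Two small neighbours of a weak vertex with incomparable traces are adjacent. -/
theorem Weak.adj_small (h6 : NoP6 G) (h5 : NoC5 G) {J : Option (Fin 7)} {x x' y : V} {p q : Fin 7}
    (hy : Weak v J y) (h2 : HasPair (trace v x)) (h3 : ¬ HasTriangle (trace v x))
    (h2' : HasPair (trace v x')) (h3' : ¬ HasTriangle (trace v x')) (hxy : G.Adj x y)
    (hxy' : G.Adj x' y) (hp : G.Adj x (v p)) (hp' : ¬ G.Adj x' (v p)) (hq : ¬ G.Adj x (v q))
    (hq' : G.Adj x' (v q)) : G.Adj x x' := by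
  by_contra hxx
  have hI : ∃ l ∈ [3, 4], IsInterval (trace v x) l := by
    simpa using hy.isInterval_small h6 h5 h2 h3 hxy
  have hI' : ∃ l ∈ [3, 4], IsInterval (trace v x') l := by
    simpa using hy.isInterval_small h6 h5 h2' h3' hxy'
  obtain ⟨l, hl, hI⟩ := hI
  obtain ⟨l', hl', hI'⟩ := hI'
  obtain ⟨s, hs⟩ := hI.eq
  obtain ⟨s', hs'⟩ := hI'.eq
  have hcr := crossing_small_run l hl l' hl' s J (hs ▸ hy.guarded h5 hxy) s'
    (hs' ▸ hy.guarded h5 hxy') p (hs ▸ hp) (hs' ▸ hp') q (hs' ▸ hq') (hs ▸ hq)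
  rw [← hs, ← hs'] at hcr
  obtain ⟨c, c', h1, h2, h3, h4, h5', h6', h7⟩ := hcr
  exact h5 y x (v c) (v c') x' hxy.symm h1 ((adj_antihole v _ _).2 h5') h3.symm hxy'
    (by rwa [hy]) (by rwa [hy]) h4 hxx (fun h => h2 h.symm)

end Traces

/-! ### Colour lists after propagation -/

set_option maxRecDepth 100000 in
theorem bits_hasPair : ∀ A, HasPair (bits A) → NoMiddle (bits A) →
    ∃ s t, A7 s t ∧ bits A s ∧ bits A t := by
  decide +kernel

section Lists

variable {V : Type} {G : SimpleGraph V} {v : Antihole G} {c : Fin 7 → Fin 4}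
  {L : V → Finset (Fin 4)} {i : Fin 4} {J : Option (Fin 7)}

/-- The lists `L` are closed under propagation, and they are the given colours on the antihole. -/
structure Propagated (v : Antihole G) (c : Fin 7 → Fin 4) (L : V → Finset (Fin 4)) : Prop where
  antihole : ∀ t, L (v t) = {c t}
  closed : ∀ x k w, L x = {k} → G.Adj x w → k ∉ L w

/-- The list of `y` contains all colours other than `i`. -/
def Full (L : V → Finset (Fin 4)) (i : Fin 4) (y : V) : Prop := ∀ k, k ≠ i → k ∈ L y

theorem Propagated.ne (h : Propagated v c L) {s t : Fin 7} (hst : A7 s t) : c s ≠ c t := by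
  have := h.closed (v s) (c s) (v t) (h.antihole s) ((adj_antihole v s t).2 hst)
  rw [h.antihole] at this
  simpa using this

theorem Propagated.ne_of_mem (h : Propagated v c L) {x : V} {k : Fin 4} {t : Fin 7} (hk : k ∈ L x)
    (hx : G.Adj x (v t)) : c t ≠ k := by
  rintro rfl
  exact h.closed (v t) (c t) x (h.antihole t) hx.symm hk

theorem Propagated.exists_eq (h : Propagated v c L) (β : Fin 4) : ∃ t, c t = β := by
  obtain ⟨k, hk⟩ := exists_col fun s t => h.ne
  have hinj : Function.Injective fun l : Fin 4 => c (![k, k + 1, k + 3, k + 5] l) := by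
    intro l l' hll
    have h1 := (hk _ _).1 hll
    clear hll hk
    revert k l l'; decide
  obtain ⟨l, hl⟩ := Finite.surjective_of_injective hinj β
  exact ⟨_, hl⟩

theorem Propagated.exists_pair (h : Propagated v c L) (h5 : NoC5 G) {x : V}
    (h2 : HasPair (trace v x)) : ∃ a b, a ≠ b ∧ a ∉ L x ∧ b ∉ L x ∧ ∃ s t, G.Adj x (v s) ∧
      G.Adj x (v t) ∧ c s = a ∧ c t = b := by
  obtain ⟨A, hA⟩ := exists_eq_bits (trace v x)
  obtain ⟨s, t, hst, hs, ht⟩ := bits_hasPair A (hA ▸ h2) (hA ▸ noMiddle_trace h5 v x)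
  rw [← hA] at hs ht
  exact ⟨c s, c t, h.ne hst, fun hk => h.ne_of_mem hk hs rfl, fun hk => h.ne_of_mem hk ht rfl,
    s, t, hs, ht, rfl, rfl⟩

theorem Propagated.weak_of_full (h : Propagated v c L) (h5 : NoC5 G) {y : V} (hy : Full L i y) :
    ∃ J, Weak v J y := by
  have key : ¬ HasPair (trace v y) := by
    intro h2
    obtain ⟨a, b, hab, ha, hb, -⟩ := h.exists_pair h5 h2
    have hai : a = i := by_contra fun hne => ha (hy a hne)
    have hbi : b = i := by_contra fun hne => hb (hy b hne)
    exact hab (hai.trans hbi.symm)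
  rcases weak_or v y with h1 | h1 | h1
  · exact h1
  · exact (key h1.1).elim
  · exact (key h1.hasPair).elim

theorem Propagated.eq_of_big (h : Propagated v c L) {x : V} (h3 : HasTriangle (trace v x))
    {m m' : Fin 4} (hm : m ∈ L x) (hm' : m' ∈ L x) : m = m' := by
  obtain ⟨t, h0, h2, h4⟩ := h3
  have e1 : c t ≠ c (t + 2) := h.ne (by clear h0 h2 h4; revert t; decide)
  have e2 : c t ≠ c (t + 4) := h.ne (by clear h0 h2 h4 e1; revert t; decide)
  have e3 : c (t + 2) ≠ c (t + 4) := h.ne (by clear h0 h2 h4 e1 e2; revert t; decide)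
  have key : ∀ a b d m m' : Fin 4, a ≠ b → a ≠ d → b ≠ d → a ≠ m → b ≠ m → d ≠ m → a ≠ m' →
    b ≠ m' → d ≠ m' → m = m' := by decide
  exact key _ _ _ m m' e1 e2 e3 (h.ne_of_mem hm h0) (h.ne_of_mem hm h2) (h.ne_of_mem hm h4)
    (h.ne_of_mem hm' h0) (h.ne_of_mem hm' h2) (h.ne_of_mem hm' h4)

/-- A big vertex adjacent to a vertex with a full list has no colour other than `i` left. -/
theorem Propagated.not_big (h : Propagated v c L) {x y : V} (h3 : HasTriangle (trace v x))
    (hxy : G.Adj x y) (hy : Full L i y) {m : Fin 4} (hm : m ∈ L x) : m = i := by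
  by_contra hmi
  exact h.closed x m y (Finset.eq_singleton_iff_unique_mem.2
    ⟨hm, fun m' hm' => h.eq_of_big h3 hm' hm⟩) hxy (hy m hmi)

/-- The big vertex `b` forbids the colour `β` to all its neighbours. -/
structure Forbids (v : Antihole G) (L : V → Finset (Fin 4)) (b : V) (β : Fin 4) : Prop where
  big : HasTriangle (trace v b)
  notMem : ∀ w, G.Adj b w → β ∉ L w

theorem Propagated.adj_of_forbids (h : Propagated v c L) (h6 : NoP6 G) {b y y₁ y₂ y₃ : V}
    {β : Fin 4} (hb : Forbids v L b β) (hβ : β ≠ i) (hy : Full L i y) (hyJ : Weak v J y)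
    (hy₁ : Weak v J y₁) (hy₂ : Weak v J y₂) (hy₃ : Weak v J y₃) (hb₁ : G.Adj b y₁)
    (hb₂ : ¬ G.Adj b y₂) (hb₃ : ¬ G.Adj b y₃) (h12 : G.Adj y₁ y₂) (h23 : G.Adj y₂ y₃) :
    G.Adj y₁ y₃ := by
  obtain ⟨t₀, rfl⟩ := h.exists_eq β
  refine adj_of_big h6 hb.big (t₀ := t₀) (fun ht => hb.notMem _ ht (by simp [h.antihole])) ?_
    hy₁ hy₂ hy₃ hb₁ hb₂ hb₃ h12 h23
  rintro rfl
  exact h.ne_of_mem (hy _ hβ) ((hyJ t₀).2 rfl) rfl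

theorem PropagationStep.subset {L L' : V → Finset (Fin 4)} (h : PropagationStep G L L') (x : V) :
    L' x ⊆ L x := by
  obtain ⟨-, u, k, -, h1, h2⟩ := h
  by_cases hux : G.Adj u x
  · rw [h1 x hux]; exact Finset.erase_subset _ _
  · rw [h2 x hux]

theorem subset_of_propagation {L L' : V → Finset (Fin 4)}
    (h : Relation.ReflTransGen (PropagationStep G) L L') (x : V) : L' x ⊆ L x := by
  induction h with
  | refl => exact Finset.Subset.refl _
  | tail _ h ih => exact (h.subset x).trans ih

/-- If the list of a weak vertex is not full, but that of a weak neighbour is, then it has lost a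
colour to a big neighbour. Indeed, consider the weak vertices that can be reached from a vertex
with a full list through weak vertices not losing a colour to a big neighbour: these keep
full lists, because a neighbour of one of them that is small, or weak with a reduced list, is a
neighbour of all of them. -/
theorem Propagated.exists_forbids (h : Propagated v c L) (h6 : NoP6 G) (h5 : NoC5 G)
    {L₀ : V → Finset (Fin 4)} (h0 : ∀ J y, Weak v J y → L₀ y = Finset.univ)
    (hist : Relation.ReflTransGen (PropagationStep G) L₀ L) {y z : V} (hyJ : Weak v J y)
    (hzJ : Weak v J z) (hyz : G.Adj y z) (hy : Full L i y) (hz : ¬ Full L i z) :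
    ∃ b β, Forbids v L b β ∧ β ≠ i ∧ G.Adj b z := by
  by_contra hcon
  let N : V → Prop := fun w => ∃ b β, Forbids v L b β ∧ β ≠ i ∧ G.Adj b w
  let S : V → Prop := Relation.ReflTransGen (fun a b => G.Adj a b ∧ Weak v J b ∧ ¬ N b) y
  have hyN : ¬ N y := fun ⟨b, β, hb, hβ, hby⟩ => hb.notMem y hby (hy β hβ)
  have hS : ∀ w, S w → Weak v J w ∧ ¬ N w := by
    intro w hw
    rcases hw.cases_tail with rfl | ⟨a, -, -, hw⟩
    · exact ⟨hyJ, hyN⟩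
    · exact hw
  have hSz : S z := Relation.ReflTransGen.single ⟨hyz, hzJ, hcon⟩
  -- the invariant of the propagation
  have inv : ∀ L', Relation.ReflTransGen (PropagationStep G) L₀ L' →
      Relation.ReflTransGen (PropagationStep G) L' L → ∀ w, S w → Full L' i w := by
    intro L' hL'
    induction hL' with
    | refl =>
      intro _ w hw k _
      rw [h0 J w (hS w hw).1]
      exact Finset.mem_univ k
    | @tail L₁ L₂ _ hstep ih =>
      intro hrest w hw k hki
      have ih := ih (Relation.ReflTransGen.head hstep hrest)
      obtain ⟨-, u, β, hu, h1, h2⟩ := hstep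
      by_contra hk
      have huw : G.Adj u w := by
        by_contra huw
        rw [h2 w huw] at hk
        exact hk (ih w hw k hki)
      rw [h1 w huw, Finset.mem_erase, not_and_or, not_not] at hk
      obtain rfl := hk.resolve_right (not_not.2 (ih w hw k hki))
      have hforb : ∀ x, G.Adj u x → k ∉ L x := fun x hx hkx => by
        have := subset_of_propagation hrest x hkx
        rw [h1 x hx] at this
        exact Finset.notMem_erase _ _ this
      -- the colour propagates to `y` along the path from `y` to `w`
      have hback : ∀ a b, S a → S b → G.Adj a b → G.Adj u b → G.Adj u a := by
        intro a b ha hb hab hub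
        obtain ⟨haJ, haN⟩ := hS a ha
        obtain ⟨hbJ, hbN⟩ := hS b hb
        rcases weak_or v u with ⟨J', hu'⟩ | ⟨hu2, hu3⟩ | hu3
        · obtain rfl := hu'.eq h6 h5 hbJ hub
          by_cases huN : N u
          · obtain ⟨b', β', hb', hβ', hbu⟩ := huN
            exact h.adj_of_forbids h6 hb' hβ' hy hyJ hu' hbJ haJ hbu
              (fun hx => hbN ⟨b', β', hb', hβ', hx⟩) (fun hx => haN ⟨b', β', hb', hβ', hx⟩)
              hub hab.symm
          · exfalso
            have hfull := ih u (hb.tail ⟨hub.symm, hu', huN⟩)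
            obtain ⟨m, hmi, hmk⟩ : ∃ m, m ≠ i ∧ m ≠ k := by
              clear * -
              revert i k; decide
            have := hfull m hmi
            rw [hu] at this
            exact hmk (Finset.mem_singleton.1 this)
        · exact adj_of_small h6 h5 hu2 hu3 hbJ haJ hub hab.symm
        · exact (hbN ⟨u, k, ⟨hu3, hforb⟩, hki, hub⟩).elim
      have huy : ∀ w, S w → G.Adj u w → G.Adj u y := by
        intro w hw
        induction hw with
        | refl => exact id
        | @tail a b ha hab ih => exact fun hub => ih (hback a b ha (ha.tail hab) hab.1 hub)
      exact hforb y (huy w hw huw) (hy k hki)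
  exact hz (inv L hist .refl z hSz)

/-- A vertex whose list is not full and contains a colour other than `i`, if adjacent to one of
two adjacent vertices with full lists, is adjacent to both. -/
theorem Propagated.adj_of_full (h : Propagated v c L) (h6 : NoP6 G) (h5 : NoC5 G)
    {L₀ : V → Finset (Fin 4)} (h0 : ∀ J y, Weak v J y → L₀ y = Finset.univ)
    (hist : Relation.ReflTransGen (PropagationStep G) L₀ L) {y y' z : V} (hy : Full L i y)
    (hy' : Full L i y') (hyy : G.Adj y y') (hz : ¬ Full L i z) {m : Fin 4} (hm : m ∈ L z)
    (hmi : m ≠ i) (hzy : G.Adj z y) : G.Adj z y' := by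
  obtain ⟨J, hyJ⟩ := h.weak_of_full h5 hy
  obtain ⟨J', hyJ'⟩ := h.weak_of_full h5 hy'
  obtain rfl := hyJ.eq h6 h5 hyJ' hyy
  rcases weak_or v z with ⟨J', hz'⟩ | ⟨hz2, hz3⟩ | hz3
  · obtain rfl := hz'.eq h6 h5 hyJ hzy
    obtain ⟨b, β, hb, hβ, hbz⟩ := h.exists_forbids h6 h5 h0 hist hyJ hz' hzy.symm hy hz
    exact h.adj_of_forbids h6 hb hβ hy hyJ hz' hyJ hyJ' hbz (fun hx => hb.notMem y hx (hy β hβ))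
      (fun hx => hb.notMem y' hx (hy' β hβ)) hzy hyy
  · exact adj_of_small h6 h5 hz2 hz3 hyJ hyJ' hzy hyy
  · exact (hmi (h.not_big hz3 hzy hy hm)).elim

/-- A colour that is missing in the list of a small neighbour of a full vertex, where `i` is
missing too, appears on its trace. -/
theorem Propagated.exists_mem_trace (h : Propagated v c L) (h5 : NoC5 G) {z : V}
    (h2 : HasPair (trace v z)) (hz : ((L z).erase i).card = 2) {k : Fin 4}
    (hk : k ∉ (L z).erase i) : ∃ t, G.Adj z (v t) ∧ c t = k := by
  obtain ⟨a, b, hab, ha, hb, s, t, hs, ht, rfl, rfl⟩ := h.exists_pair h5 h2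
  have key : ∀ (M : Finset (Fin 4)) (a b k : Fin 4), M.card = 2 → a ∉ M → b ∉ M → a ≠ b → k ∉ M →
    k = a ∨ k = b := by decide +kernel
  rcases key _ _ _ k hz (fun hx => ha (Finset.mem_of_mem_erase hx))
    (fun hx => hb (Finset.mem_of_mem_erase hx)) hab hk with rfl | rfl
  exacts [⟨s, hs, rfl⟩, ⟨t, ht, rfl⟩]

theorem exists_mem_sdiff {M M' : Finset (Fin 4)} (hM : M.card = 2) (hM' : M'.card = 2)
    (hne : M ≠ M') : ∃ k, k ∈ M ∧ k ∉ M' := by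
  by_contra! hcon
  exact hne (Finset.eq_of_subset_of_card_le hcon (hM'.trans hM.symm).le)

/-- Two neighbours of a vertex with a full list, which have two colours other than `i` each, are
adjacent unless these are the same colours. -/
theorem Propagated.adj_of_card_eq_two (h : Propagated v c L) (h6 : NoP6 G) (h5 : NoC5 G)
    (hC : ∀ x, ¬ ∀ t, G.Adj x (v t))
    {L₀ : V → Finset (Fin 4)} (h0 : ∀ J y, Weak v J y → L₀ y = Finset.univ)
    (hist : Relation.ReflTransGen (PropagationStep G) L₀ L) {y z z' : V} (hy : Full L i y)
    (hzy : G.Adj z y) (hzy' : G.Adj z' y) (hz : ((L z).erase i).card = 2)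
    (hz' : ((L z').erase i).card = 2) (hne : (L z).erase i ≠ (L z').erase i) : G.Adj z z' := by
  obtain ⟨J, hyJ⟩ := h.weak_of_full h5 hy
  have notfull : ∀ z, ((L z).erase i).card = 2 → ¬ Full L i z := by
    intro z hz hfull
    have h1 : (Finset.univ.erase i : Finset (Fin 4)) ⊆ (L z).erase i := fun k hk =>
      Finset.mem_erase.2 ⟨Finset.ne_of_mem_erase hk, hfull k (Finset.ne_of_mem_erase hk)⟩
    have h2 := Finset.card_le_card h1
    rw [Finset.card_erase_of_mem (Finset.mem_univ i), hz] at h2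
    simp at h2
  have notbig : ∀ z, G.Adj z y → ((L z).erase i).card = 2 → ¬ HasTriangle (trace v z) := by
    intro z hzy hz h3
    obtain ⟨m, hm⟩ := Finset.card_pos.1 (hz.symm ▸ Nat.two_pos : 0 < ((L z).erase i).card)
    exact Finset.ne_of_mem_erase hm (h.not_big h3 hzy hy (Finset.mem_of_mem_erase hm))
  obtain ⟨k, hk, hk'⟩ := exists_mem_sdiff hz hz' hne
  obtain ⟨l, hl', hl⟩ := exists_mem_sdiff hz' hz hne.symm
  rcases weak_or v z with ⟨J₁, hzJ⟩ | ⟨hz2, hz3⟩ | hz3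
  · rcases weak_or v z' with ⟨J₂, hzJ'⟩ | ⟨hz2', hz3'⟩ | hz3'
    · obtain rfl := hzJ.eq h6 h5 hyJ hzy
      obtain rfl := hzJ'.eq h6 h5 hyJ hzy'
      by_contra hzz
      obtain ⟨b, β, hb, hβ, hbz⟩ :=
        h.exists_forbids h6 h5 h0 hist hyJ hzJ hzy.symm hy (notfull z hz)
      obtain ⟨b', β', hb', hβ', hbz'⟩ :=
        h.exists_forbids h6 h5 h0 hist hyJ hzJ' hzy'.symm hy (notfull z' hz')
      have hby : ¬ G.Adj b y := fun hx => hb.notMem y hx (hy β hβ)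
      have hby' : ¬ G.Adj b' y := fun hx => hb'.notMem y hx (hy β' hβ')
      have hM : ∀ {b β z}, Forbids v L b β → β ≠ i → G.Adj b z → ((L z).erase i).card = 2 →
          (L z).erase i = (Finset.univ.erase i).erase β := by
        intro b β z hb hβ hbz hz
        refine Finset.eq_of_subset_of_card_le ?_ ?_
        · intro m hm
          rw [Finset.mem_erase] at hm
          rw [Finset.mem_erase, Finset.mem_erase]
          exact ⟨fun hmβ => hb.notMem z hbz (hmβ ▸ hm.2), hm.1, Finset.mem_univ _⟩
        · rw [hz, Finset.card_erase_of_mem (Finset.mem_erase.2 ⟨hβ, Finset.mem_univ _⟩),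
            Finset.card_erase_of_mem (Finset.mem_univ i)]
          simp
      have hββ : β ≠ β' := by
        rintro rfl
        exact hne ((hM hb hβ hbz hz).trans (hM hb' hβ' hbz' hz').symm)
      have hbz₂ : ¬ G.Adj b z' := fun hx =>
        hne ((hM hb hβ hbz hz).trans (hM hb hβ hx hz').symm)
      have hbz₂' : ¬ G.Adj b' z := fun hx =>
        hne ((hM hb' hβ' hx hz).trans (hM hb' hβ' hbz' hz').symm)
      by_cases hbb : G.Adj b b'
      · exact h5 y z b b' z' hzy.symm hbz.symm hbb hbz' hzy' (fun hx => hby hx.symm)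
          (fun hx => hby' hx.symm) (fun hx => hbz₂' hx.symm) hzz hbz₂
      -- an edge of the antihole between the classes of `β` and `β'` completes a `P₆`
      · have hI : ∃ l ∈ [5, 6], IsInterval (trace v b) l := by
          simpa using hzJ.isInterval_big h6 h5 hb.big (hC b) hyJ hbz hzy hby
        have hI' : ∃ l ∈ [5, 6], IsInterval (trace v b') l := by
          simpa using hzJ'.isInterval_big h6 h5 hb'.big (hC b') hyJ hbz' hzy' hby'
        obtain ⟨l₁, hl₁, hI⟩ := hI
        obtain ⟨l₂, hl₂, hI'⟩ := hI'
        obtain ⟨s, hs⟩ := hI.eq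
        obtain ⟨s', hs'⟩ := hI'.eq
        obtain ⟨p, hp⟩ := h.exists_eq β
        obtain ⟨q, hq⟩ := h.exists_eq β'
        obtain ⟨k, hk⟩ := exists_col fun s t => h.ne
        have hmiss : ∀ {b β p}, Forbids v L b β → c p = β → Misses (trace v b) k p := by
          rintro b β p hb rfl t ht hcol
          refine hb.notMem _ ht ?_
          rw [h.antihole, (hk t p).2 hcol]
          exact Finset.mem_singleton_self _
        have hcr := crossing_big_run l₁ hl₁ l₂ hl₂ k s p (hs ▸ hmiss hb hp) s' q
          (hs' ▸ hmiss hb' hq) (fun hx => hββ (by rw [← hp, ← hq]; exact (hk p q).2 hx))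
        rw [← hs, ← hs'] at hcr
        obtain ⟨p', q', h1, h2, h3, h4, h7, h8, h9⟩ := hcr
        have hJ : ∀ {t r β}, c r = β → col k t = col k r → β ≠ i → ¬ G.Adj y (v t) := by
          rintro t r β rfl hcol hβ ht
          rw [← hk] at hcol
          exact h.ne_of_mem (hy _ hβ) ht hcol
        have hp' := hJ hp h8 hβ
        have hq' := hJ hq h9 hβ'
        rw [hyJ] at hp' hq'
        exact h6 z b (v q') (v p') b' z' hbz.symm h1 ((adj_antihole v _ _).2 h7)
          (G.adj_symm h3) hbz' (by rwa [hzJ]) (by rwa [hzJ]) (fun hx => hbz₂' hx.symm) hzz h4 hbb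
          hbz₂ (fun hx => h2 hx.symm) (by rw [G.adj_comm]; rwa [hzJ'])
          (by rw [G.adj_comm]; rwa [hzJ'])
    · obtain rfl := hzJ.eq h6 h5 hyJ hzy
      exact (adj_of_small h6 h5 hz2' hz3' hyJ hzJ hzy' hzy.symm).symm
    · exact (notbig z' hzy' hz' hz3').elim
  · rcases weak_or v z' with ⟨J₂, hzJ'⟩ | ⟨hz2', hz3'⟩ | hz3'
    · obtain rfl := hzJ'.eq h6 h5 hyJ hzy'
      exact adj_of_small h6 h5 hz2 hz3 hyJ hzJ' hzy hzy'.symm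
    · obtain ⟨p, hp, rfl⟩ := h.exists_mem_trace h5 hz2 hz hl
      obtain ⟨q, hq, rfl⟩ := h.exists_mem_trace h5 hz2' hz' hk'
      exact hyJ.adj_small h6 h5 hz2 hz3 hz2' hz3' hzy hzy' hp
        (fun hx => h.ne_of_mem (Finset.mem_of_mem_erase hl') hx rfl)
        (fun hx => h.ne_of_mem (Finset.mem_of_mem_erase hk) hx rfl) hq
    · exact (notbig z' hzy' hz' hz3').elim
  · exact (notbig z hzy hz hz3).elim

end Lists

/-! ### The list 3-colouring problems of Step 4 as binary constraint problems -/

section Test4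

variable {V : Type} (G : SimpleGraph V) (L : V → Finset (Fin 4)) (i : Fin 4) (x : V)

/-- The colour `k` is left for the neighbour `w` of `x` when `i` is excluded and the colours of
the neighbours of `w` with only one colour are deleted. -/
def Reduced (w : V) (k : Fin 4) : Prop :=
  k ∈ L w ∧ k ≠ i ∧ ∀ z, G.Adj x z → G.Adj z w → (L z).erase i ≠ {k}

/-- The neighbours of `x` that are left with all colours other than `i`. -/
def Free (w : V) : Prop := G.Adj x w ∧ ∀ k, k ≠ i → Reduced G L i x w k

/-- The neighbours of `x` that are left with at most two colours. -/
def Core (w : V) : Prop := G.Adj x w ∧ ¬ Free G L i x w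

/-- `a` and `b` have two adjacent common neighbours in `N(x)`. -/
def Diamond (a b : V) : Prop :=
  ∃ p q, G.Adj x p ∧ G.Adj x q ∧ G.Adj p q ∧ G.Adj a p ∧ G.Adj a q ∧ G.Adj b p ∧ G.Adj b q

/-- The colours for the variables of the constraint problem, which are all vertices; those outside
the core get a dummy value. -/
def CoreColour (w : V) (k : Fin 4) : Prop :=
  (Core G L i x w ∧ Reduced G L i x w k) ∨ (¬ Core G L i x w ∧ k = 0)

/-- Adjacent vertices must not have the same colour, and the ends of a diamond must not have
different colours. -/
def CoreConflict (a : V) (k : Fin 4) (b : V) (l : Fin 4) : Prop :=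
  Core G L i x a ∧ Core G L i x b ∧ ((G.Adj a b ∧ k = l) ∨ (Diamond G x a b ∧ k ≠ l))

variable {G L i x}

theorem coreConflict_symm {a b : V} {k l : Fin 4} (h : CoreConflict G L i x a k b l) :
    CoreConflict G L i x b l a k := by
  obtain ⟨ha, hb, ⟨hab, hk⟩ | ⟨⟨p, q, h1, h2, h3, h4, h5, h6, h7⟩, hk⟩⟩ := h
  · exact ⟨hb, ha, Or.inl ⟨hab.symm, hk.symm⟩⟩
  · exact ⟨hb, ha, Or.inr ⟨⟨p, q, h1, h2, h3, h6, h7, h4, h5⟩, hk.symm⟩⟩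

theorem exists_two_coreColour (G : SimpleGraph V) (L : V → Finset (Fin 4)) (i : Fin 4) (x w : V) :
    ∃ a b, ∀ k, CoreColour G L i x w k → k = a ∨ k = b := by
  by_cases hw : Core G L i x w
  · have : ∃ m, m ≠ i ∧ ¬ Reduced G L i x w m := by
      by_contra! hcon
      exact hw.2 ⟨hw.1, hcon⟩
    obtain ⟨m, hmi, hm⟩ := this
    obtain ⟨a, b, hab⟩ : ∃ a b, ∀ k, k ≠ i → k ≠ m → k = a ∨ k = b := by
      clear hm hw
      revert i m; decide
    refine ⟨a, b, fun k hk => ?_⟩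
    rcases hk with ⟨-, hk⟩ | ⟨hk, -⟩
    · exact hab k hk.2.1 (fun h => hm (h ▸ hk))
    · exact (hk hw).elim
  · refine ⟨0, 0, fun k hk => ?_⟩
    rcases hk with ⟨hk, -⟩ | ⟨-, hk⟩
    · exact (hw hk).elim
    · exact Or.inl hk

theorem exists_coreColour_of_test4 (h : Test4 G L x i) :
    ∃ f : V → Fin 4, (∀ w, CoreColour G L i x w (f w)) ∧
      ∀ a b, ¬ CoreConflict G L i x a (f a) b (f b) := by
  classical
  obtain ⟨f, hf, hfa⟩ := h
  have hfL : ∀ w, G.Adj x w → f w ∈ L w ∧ f w ≠ i := fun w hw => by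
    simpa using hf w hw
  refine ⟨fun w => if Core G L i x w then f w else 0, fun w => ?_, fun a b hab => ?_⟩
  · dsimp only
    by_cases hw : Core G L i x w
    · rw [if_pos hw]
      refine Or.inl ⟨hw, (hfL w hw.1).1, (hfL w hw.1).2, fun z hxz hzw hz => ?_⟩
      have : f z ∈ (L z).erase i := Finset.mem_erase.2 ⟨(hfL z hxz).2, (hfL z hxz).1⟩
      rw [hz, Finset.mem_singleton] at this
      exact hfa z hxz w hw.1 hzw this
    · rw [if_neg hw]
      exact Or.inr ⟨hw, rfl⟩
  · obtain ⟨ha, hb, hab⟩ := hab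
    dsimp only at hab
    rw [if_pos ha, if_pos hb] at hab
    rcases hab with ⟨hab, h⟩ | ⟨⟨p, q, hp, hq, hpq, hap, haq, hbp, hbq⟩, h⟩
    · exact hfa a ha.1 b hb.1 hab h
    · have key : ∀ i a b p q : Fin 4, a ≠ i → b ≠ i → p ≠ i → q ≠ i → p ≠ q → a ≠ p → a ≠ q →
          b ≠ p → b ≠ q → a = b := by decide +kernel
      exact h (key i _ _ _ _ (hfL a ha.1).2 (hfL b hb.1).2 (hfL p hp).2 (hfL q hq).2
        (hfa p hp q hq hpq) (hfa a ha.1 p hp hap) (hfa a ha.1 q hq haq) (hfa b hb.1 p hp hbp)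
        (hfa b hb.1 q hq hbq))

/-- A colouring `f` of the core extends to the free vertices, component by component. A component
without neighbours in the core is 3-colourable. Otherwise the neighbours of a component in the core
are complete to it. If the component has an edge, then these neighbours have the same colour by the
diamond constraints, and it is 2-colourable because it has no triangle. A single free vertex sees at
most two colours in the core: there are no three neighbours in the core with pairwise different
lists, because there is no `K₅`; and two with the same list, both adjacent to one with another
list, have the same colour by the diamond constraints. -/
theorem test4_of_exists_coreColour [Finite V] {v : Antihole G} {c : Fin 7 → Fin 4}
    (h : Propagated v c L) (h6 : NoP6 G) (h5 : NoC5 G) (hK5 : G.CliqueFree 5)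
    (hC : ∀ (v : Antihole G) (x : V), ¬ ∀ t, G.Adj x (v t))
    {L₀ : V → Finset (Fin 4)} (h0 : ∀ J y, Weak v J y → L₀ y = Finset.univ)
    (hist : Relation.ReflTransGen (PropagationStep G) L₀ L) {f : V → Fin 4}
    (hf : ∀ w, CoreColour G L i x w (f w)) (hfa : ∀ a b, ¬ CoreConflict G L i x a (f a) b (f b)) :
    Test4 G L x i := by
  classical
  have := Fintype.ofFinite V
  have hfR : ∀ w, Core G L i x w → Reduced G L i x w (f w) := fun w hw =>
    ((hf w).resolve_right fun h => h.1 hw).2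
  have hfull : ∀ {w}, Free G L i x w → Full L i w := fun hw k hk => (hw.2 k hk).1
  have hK5' : ∀ a b d e, G.Adj x a → G.Adj x b → G.Adj x d → G.Adj x e → G.Adj a b → G.Adj a d →
      G.Adj a e → G.Adj b d → G.Adj b e → ¬ G.Adj d e := by
    intro a b d e h1 h2 h3 h4 h5 h6 h7 h8 h9 h10
    refine hK5 {x, a, b, d, e} ⟨?_, ?_⟩
    · simp [SimpleGraph.isClique_insert, *]
    · simp [*, h1.ne, h2.ne, h3.ne, h4.ne, h5.ne, h6.ne, h7.ne, h8.ne, h9.ne, h10.ne]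
  have hmem : ∀ {z}, Core G L i x z → f z ∈ (L z).erase i := fun hz =>
    Finset.mem_erase.2 ⟨(hfR _ hz).2.1, (hfR _ hz).1⟩
  have hsingle : ∀ {z w}, Free G L i x w → G.Adj x z → G.Adj z w → ∀ {k}, (L z).erase i ≠ {k} := by
    intro z w hw hxz hzw k hk
    have hki : k ≠ i := by
      have : k ∈ (L z).erase i := by rw [hk]; exact Finset.mem_singleton_self k
      exact Finset.ne_of_mem_erase this
    exact (hw.2 k hki).2.2 z hxz hzw hk
  -- a core vertex with a full list would have lost a colour to a neighbour with a single colour,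
  -- which then were adjacent to `w`
  have hnotfull : ∀ {z w}, Free G L i x w → Core G L i x z → G.Adj z w → ¬ Full L i z := by
    intro z w hw hz hzw hzf
    have : ∃ k, k ≠ i ∧ ¬ Reduced G L i x z k := by
      by_contra! hcon
      exact hz.2 ⟨hz.1, hcon⟩
    obtain ⟨k, hki, hk⟩ := this
    obtain ⟨z', hxz', hzz', hz'⟩ : ∃ z', G.Adj x z' ∧ G.Adj z' z ∧ (L z').erase i = {k} := by
      by_contra! hcon
      exact hk ⟨hzf k hki, hki, hcon⟩
    have hkz' : k ∈ L z' := Finset.mem_of_mem_erase (hz' ▸ Finset.mem_singleton_self k)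
    refine hsingle hw hxz' (h.adj_of_full h6 h5 h0 hist hzf (hfull hw) hzw ?_ hkz' hki hzz') hz'
    intro hfull'
    obtain ⟨m, hmi, hmk⟩ : ∃ m, m ≠ i ∧ m ≠ k := by clear * -; revert i k; decide
    have : m ∈ (L z').erase i := Finset.mem_erase.2 ⟨hmi, hfull' m hmi⟩
    rw [hz', Finset.mem_singleton] at this
    exact hmk this
  -- vertices of the core adjacent to a free vertex have two colours left
  have hcard : ∀ {z w}, Free G L i x w → Core G L i x z → G.Adj z w →
      ((L z).erase i).card = 2 := by
    intro z w hw hz hzw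
    have key : ∀ (M : Finset (Fin 4)) (i k : Fin 4), k ∈ M → i ∉ M → (∀ k, M ≠ {k}) →
      (¬ ∀ k, k ≠ i → k ∈ M) → M.card = 2 := by decide +kernel
    refine key _ i (f z) (hmem hz) (Finset.notMem_erase _ _) (fun k => hsingle hw hz.1 hzw) ?_
    intro hfz
    exact hnotfull hw hz hzw fun k hk => Finset.mem_of_mem_erase (hfz k hk)
  have hhom : ∀ {z w w'}, Free G L i x w → Free G L i x w' → Core G L i x z → G.Adj z w →
      G.Adj w w' → G.Adj z w' := fun hw hw' hz hzw hww =>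
    h.adj_of_full h6 h5 h0 hist (hfull hw) (hfull hw') hww (hnotfull hw hz hzw) (hfR _ hz).1
      (hfR _ hz).2.1 hzw
  have hdia : ∀ {a b p q}, Core G L i x a → Core G L i x b → G.Adj x p → G.Adj x q → G.Adj p q →
      G.Adj a p → G.Adj a q → G.Adj b p → G.Adj b q → f a = f b := by
    intro a b p q ha hb hp hq hpq hap haq hbp hbq
    by_contra hne
    exact hfa a b ⟨ha, hb, Or.inr ⟨⟨p, q, hp, hq, hpq, hap, haq, hbp, hbq⟩, hne⟩⟩
  -- a free vertex sees at most two colours in the core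
  have hpoint : ∀ w, Free G L i x w → ∃ k, k ≠ i ∧ ∀ z, Core G L i x z → G.Adj z w → f z ≠ k := by
    intro w hw
    by_contra! hcon
    have : Nonempty V := ⟨w⟩
    choose! z hz hzw hfz using hcon
    have hsame : ∀ a b d, a ≠ i → b ≠ i → d ≠ i → a ≠ b → a ≠ d → b ≠ d →
        (L (z a)).erase i = (L (z b)).erase i → (L (z a)).erase i = (L (z d)).erase i := by
      intro a b d ha hb hd hab had hbd heq
      by_contra hne
      have h1 := h.adj_of_card_eq_two h6 h5 (hC v) h0 hist (hfull hw) (hzw a ha) (hzw d hd)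
        (hcard hw (hz a ha) (hzw a ha)) (hcard hw (hz d hd) (hzw d hd)) hne
      have h2 := h.adj_of_card_eq_two h6 h5 (hC v) h0 hist (hfull hw) (hzw b hb) (hzw d hd)
        (hcard hw (hz b hb) (hzw b hb)) (hcard hw (hz d hd) (hzw d hd)) (heq ▸ hne)
      have := hdia (hz a ha) (hz b hb) (hz d hd).1 hw.1 (hzw d hd) h1 (hzw a ha) h2 (hzw b hb)
      rw [hfz a ha, hfz b hb] at this
      exact hab this
    obtain ⟨a, b, d, ha, hb, hd, hab, had, hbd⟩ : ∃ a b d : Fin 4, a ≠ i ∧ b ≠ i ∧ d ≠ i ∧ a ≠ b ∧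
      a ≠ d ∧ b ≠ d := by clear * -; revert i; decide
    by_cases e1 : (L (z a)).erase i = (L (z b)).erase i
    · have e2 := hsame a b d ha hb hd hab had hbd e1
      have m1 := hmem (hz a ha)
      have m2 := hmem (hz b hb)
      have m3 := hmem (hz d hd)
      rw [hfz a ha] at m1
      rw [← e1, hfz b hb] at m2
      rw [← e2, hfz d hd] at m3
      have h3 : ({a, b, d} : Finset (Fin 4)).card ≤ ((L (z a)).erase i).card := by
        refine Finset.card_le_card ?_
        simp [Finset.insert_subset_iff, m1, m2, m3]
      rw [hcard hw (hz a ha) (hzw a ha), Finset.card_eq_three.2 ⟨a, b, d, hab, had, hbd, rfl⟩] at h3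
      omega
    · have e2 : (L (z a)).erase i ≠ (L (z d)).erase i := fun h =>
        e1 (hsame a d b ha hd hb had hab hbd.symm h)
      have e3 : (L (z b)).erase i ≠ (L (z d)).erase i := fun h =>
        e1 (hsame b d a hb hd ha hbd hab.symm had.symm h).symm
      have adj := fun a b ha hb => h.adj_of_card_eq_two h6 h5 (hC v) h0 hist (hfull hw)
        (hzw a ha) (hzw b hb) (hcard hw (hz a ha) (hzw a ha)) (hcard hw (hz b hb) (hzw b hb))
      exact hK5' w (z a) (z b) (z d) hw.1 (hz a ha).1 (hz b hb).1 (hz d hd).1 (hzw a ha).symm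
        (hzw b hb).symm (hzw d hd).symm (adj a b ha hb e1) (adj a d ha hd e2) (adj b d hb hd e3)
  -- colourings of the components of the free part
  let F := G.induce {w | Free G L i x w}
  have hcomp : ∀ K : F.ConnectedComponent, ∃ g : V → Fin 4, ∀ w (hw : Free G L i x w),
      F.connectedComponentMk ⟨w, hw⟩ = K → g w ≠ i ∧ (∀ z, Core G L i x z → G.Adj z w →
        f z ≠ g w) ∧ ∀ w' (hw' : Free G L i x w'), F.connectedComponentMk ⟨w', hw'⟩ = K →
          G.Adj w w' → g w ≠ g w' := by
    intro K
    let E : Finset V := Finset.univ.filter fun w => ∃ hw : Free G L i x w,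
      F.connectedComponentMk ⟨w, hw⟩ = K
    have hE : ∀ {w}, w ∈ E ↔ ∃ hw : Free G L i x w, F.connectedComponentMk ⟨w, hw⟩ = K := by
      simp [E]
    by_cases hedge : ∃ p ∈ E, ∃ q ∈ E, G.Adj p q
    swap
    · have : ∀ w, ∃ k, Free G L i x w → k ≠ i ∧ ∀ z, Core G L i x z → G.Adj z w → f z ≠ k := by
        intro w
        by_cases hw : Free G L i x w
        · obtain ⟨k, hk⟩ := hpoint w hw
          exact ⟨k, fun _ => hk⟩
        · exact ⟨0, fun h => (hw h).elim⟩
      choose g hg using this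
      refine ⟨g, fun w hw hwK => ⟨(hg w hw).1, (hg w hw).2, fun w' hw' hwK' hww => ?_⟩⟩
      exact (hedge ⟨w, hE.2 ⟨hw, hwK⟩, w', hE.2 ⟨hw', hwK'⟩, hww⟩).elim
    by_cases hbd : ∃ z w, w ∈ E ∧ Core G L i x z ∧ G.Adj z w
    · -- all neighbours in the core are complete to the component
      have hall : ∀ z, Core G L i x z → (∃ w ∈ E, G.Adj z w) → ∀ w ∈ E, G.Adj z w := by
        rintro z hz ⟨w₀, hw₀, hzw₀⟩ w hw
        obtain ⟨hw₀, rfl⟩ := hE.1 hw₀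
        obtain ⟨hw, hK⟩ := hE.1 hw
        obtain ⟨p⟩ := SimpleGraph.ConnectedComponent.exact hK.symm
        have : ∀ (a b : {w | Free G L i x w}) (p : F.Walk a b), G.Adj z a → G.Adj z b := by
          intro a b p
          induction p with
          | nil => exact id
          | cons hadj _ ih =>
            exact fun hza => ih (hhom (Subtype.prop _) (Subtype.prop _) hz hza hadj)
        exact this _ _ p hzw₀
      obtain ⟨z₀, w₀, hw₀, hz₀, hzw₀⟩ := hbd
      have hz₀E := hall z₀ hz₀ ⟨w₀, hw₀, hzw₀⟩
      obtain ⟨p, hp, q, hq, hpq⟩ := hedge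
      have hcol : ∀ z, Core G L i x z → ∀ w ∈ E, G.Adj z w → f z = f z₀ := by
        intro z hz w hw hzw
        have hzE := hall z hz ⟨w, hw, hzw⟩
        exact hdia hz hz₀ (hE.1 hp).1.1 (hE.1 hq).1.1 hpq (hzE p hp) (hzE q hq) (hz₀E p hp)
          (hz₀E q hq)
      obtain ⟨g, hg⟩ := exists_properOn_two h6 h5 E (by
        intro a ha b hb d hd hab hbd had
        exact hK5' z₀ a b d hz₀.1 (hE.1 ha).1.1 (hE.1 hb).1.1 (hE.1 hd).1.1 (hz₀E a ha) (hz₀E b hb)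
          (hz₀E d hd) hab had hbd)
      obtain ⟨k, l, hkl, hki, hli, hk, hl⟩ : ∃ k l : Fin 4, k ≠ l ∧ k ≠ i ∧ l ≠ i ∧ f z₀ ≠ k ∧
        f z₀ ≠ l := by clear * -; generalize f z₀ = m; revert i m; decide
      refine ⟨fun w => if g w = 0 then k else l, fun w hw hwK => ⟨?_, fun z hz hzw => ?_,
        fun w' hw' hwK' hww => ?_⟩⟩
      · dsimp only; split_ifs <;> assumption
      · rw [hcol z hz w (hE.2 ⟨hw, hwK⟩) hzw]
        dsimp only; split_ifs <;> assumption
      · have := hg w (hE.2 ⟨hw, hwK⟩) w' (hE.2 ⟨hw', hwK'⟩) hww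
        have h01 : ∀ a b : Fin 2, a ≠ b → (a = 0 ∧ b ≠ 0) ∨ (a ≠ 0 ∧ b = 0) := by decide
        rcases h01 _ _ this with ⟨h1, h2⟩ | ⟨h1, h2⟩
        · simpa [h1, h2] using hkl
        · simpa [h1, h2] using hkl.symm
    · obtain ⟨g, hg⟩ := exists_properOn_three h6 h5 E (by
        intro a ha b hb d hd e he
        exact hK5' a b d e (hE.1 ha).1.1 (hE.1 hb).1.1 (hE.1 hd).1.1 (hE.1 he).1.1) (by
        intro v' hv' hadj
        refine hC ⟨⟨v', fun s t hst => ?_⟩, fun {s t} => (hadj s t).symm⟩ x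
          fun t => (hE.1 (hv' t)).1.1
        have h1 : ∀ l, (SimpleGraph.cycleGraph 7)ᶜ.Adj s l ↔ (SimpleGraph.cycleGraph 7)ᶜ.Adj t l :=
          fun l => by rw [hadj, hadj, hst]
        clear * - h1
        simp only [SimpleGraph.compl_adj, SimpleGraph.cycleGraph_adj'] at h1
        revert s t; decide)
      refine ⟨fun w => i.succAbove (g w), fun w hw hwK => ⟨Fin.succAbove_ne _ _,
        fun z hz hzw => (hbd ⟨z, w, hE.2 ⟨hw, hwK⟩, hz, hzw⟩).elim, fun w' hw' hwK' hww heq => ?_⟩⟩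
      exact hg w (hE.2 ⟨hw, hwK⟩) w' (hE.2 ⟨hw', hwK'⟩) hww (Fin.succAbove_right_injective heq)
  choose g hg using hcomp
  have hcore : ∀ {w}, G.Adj x w → ¬ Free G L i x w → Core G L i x w := fun h1 h2 => ⟨h1, h2⟩
  refine ⟨fun w => if hw : Free G L i x w then g (F.connectedComponentMk ⟨w, hw⟩) w else f w,
    fun w hxw => ?_, fun a hxa b hxb hab => ?_⟩
  · dsimp only
    rw [Finset.sdiff_singleton_eq_erase]
    by_cases hw : Free G L i x w
    · rw [dif_pos hw]
      have := (hg _ w hw rfl).1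
      exact Finset.mem_erase.2 ⟨this, hfull hw _ this⟩
    · rw [dif_neg hw]
      exact hmem (hcore hxw hw)
  · dsimp only
    by_cases ha : Free G L i x a <;> by_cases hb : Free G L i x b
    · have hK : F.connectedComponentMk ⟨b, hb⟩ = F.connectedComponentMk ⟨a, ha⟩ := by
        refine SimpleGraph.ConnectedComponent.sound (SimpleGraph.Adj.reachable ?_)
        exact hab.symm
      rw [dif_pos ha, dif_pos hb, hK]
      exact (hg _ a ha rfl).2.2 b hb hK hab
    · rw [dif_pos ha, dif_neg hb]
      exact ((hg _ a ha rfl).2.1 b (hcore hxb hb) hab.symm).symm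
    · rw [dif_neg ha, dif_pos hb]
      exact (hg _ b hb rfl).2.1 a (hcore hxa ha) hab
    · rw [dif_neg ha, dif_neg hb]
      exact fun heq => hfa a b ⟨hcore hxa ha, hcore hxb hb, Or.inl ⟨hab, heq⟩⟩

end Test4

/-! ### The tests of Steps 5 and 6 as 2SAT instances -/

section Formula

variable {V : Type} {G : SimpleGraph V} {v : Antihole G}

theorem exists_true_of_satisfies {U : Set V} {L Q₁ : V → Finset (Fin 4)}
    {Q₂ : V → V → Finset (Fin 4 × Fin 4)} {a : V × Fin 4 → Bool}
    (ha : ∀ cl ∈ coloringFormula G U L Q₁ Q₂, a cl.1.1 = cl.1.2 ∨ a cl.2.1 = cl.2.2) {x : V}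
    (hx : x ∈ U) (hL : ∃ i j, L x ⊆ {i, j}) : ∃ k ∈ L x, a (x, k) = true := by
  have h1 : ∀ i j, L x ⊆ {i, j} → a (x, i) = true ∨ a (x, j) = true := fun i j h =>
    ha (((x, i), true), ((x, j), true)) (Or.inl (Or.inl (Or.inl (Or.inl ⟨x, hx, i, j, h, rfl⟩))))
  have h2 : ∀ i j, i ≠ j → a (x, i) = false ∨ a (x, j) = false := fun i j h =>
    ha (((x, i), false), ((x, j), false)) (Or.inl (Or.inl (Or.inl (Or.inr ⟨x, hx, i, j, h, rfl⟩))))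
  have h3 : ∀ i, L x ⊆ {i} → a (x, i) = true := fun i hi => by
    simpa using h1 i i (by simpa using hi)
  obtain ⟨i, j, hij⟩ := hL
  by_contra! hcon
  have hne : L x ≠ ∅ := by
    intro h
    have e0 := h3 0 (by simp [h])
    have e1 := h3 1 (by simp [h])
    have := h2 0 1 (by decide)
    simp [e0, e1] at this
  by_cases hi : i ∈ L x
  · by_cases hj : j ∈ L x
    · rcases h1 i j hij with h | h
      exacts [hcon i hi h, hcon j hj h]
    · refine hcon i hi (h3 i fun k hk => ?_)
      rcases Finset.mem_insert.1 (hij hk) with h | h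
      · simp [h]
      · exact (hj (Finset.mem_singleton.1 h ▸ hk)).elim
  · have hj : L x ⊆ {j} := fun k hk => by
      rcases Finset.mem_insert.1 (hij hk) with h | h
      · exact (hi (h ▸ hk)).elim
      · exact h
    rcases Finset.subset_singleton_iff.1 hj with h | h
    · exact hne h
    · exact hcon j (by simp [h]) (h3 j hj)

/-- The list colouring problem is equivalent to its 2SAT instance, if the lists have at most two
elements (or some list is empty). -/
theorem exists_coloring_iff_satisfiable {U : Set V} {L Q₁ : V → Finset (Fin 4)}
    {Q₂ : V → V → Finset (Fin 4 × Fin 4)}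
    (hL : (∃ x ∈ U, L x = ∅) ∨ ∀ x ∈ U, ∃ i j, L x ⊆ {i, j}) :
    (∃ f, IsListColoring G U L f ∧ (∀ x ∈ U, f x ∉ Q₁ x) ∧
      ∀ x ∈ U, ∀ y ∈ U, x ≠ y → (f x, f y) ∉ Q₂ x y) ↔
      (coloringFormula G U L Q₁ Q₂).Satisfiable := by
  constructor
  · rintro ⟨f, ⟨hfL, hfa⟩, hf₁, hf₂⟩
    refine ⟨fun p => decide (f p.1 = p.2), ?_⟩
    rintro cl ((((⟨x, hx, i, j, h, rfl⟩ | ⟨x, hx, i, j, h, rfl⟩) | ⟨x, hx, y, hy, h, i, rfl⟩) |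
      ⟨x, hx, i, h, rfl⟩) | ⟨x, hx, y, hy, hxy, i, j, h, rfl⟩)
    · simpa using h (hfL x hx)
    · simp only [decide_eq_false_iff_not, ← not_and_or]
      rintro ⟨h1, h2⟩
      exact h (h1.symm.trans h2)
    · simp only [decide_eq_false_iff_not, ← not_and_or]
      rintro ⟨h1, h2⟩
      exact hfa x hx y hy h (h1.trans h2.symm)
    · simp only [decide_eq_false_iff_not, or_self]
      rintro rfl
      exact hf₁ x hx h
    · simp only [decide_eq_false_iff_not, ← not_and_or]
      rintro ⟨rfl, rfl⟩
      exact hf₂ x hx y hy hxy h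
  · rintro ⟨a, ha⟩
    have hL' : ∀ x ∈ U, ∃ k ∈ L x, a (x, k) = true := by
      rcases hL with ⟨x, hx, h⟩ | hL
      · obtain ⟨k, hk, -⟩ := exists_true_of_satisfies ha hx ⟨0, 0, by simp [h]⟩
        simp [h] at hk
      · exact fun x hx => exists_true_of_satisfies ha hx (hL x hx)
    choose! f hf hfa using hL'
    refine ⟨f, ⟨hf, fun x hx y hy hxy heq => ?_⟩, fun x hx h => ?_, fun x hx y hy hxy h => ?_⟩
    · have := ha _ (Or.inl (Or.inl (Or.inr ⟨x, hx, y, hy, hxy, f x, rfl⟩)))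
      simp only at this
      have h2 := hfa y hy
      rw [← heq] at h2
      rw [hfa x hx, h2] at this
      simp at this
    · have := ha _ (Or.inl (Or.inr ⟨x, hx, f x, h, rfl⟩))
      simp [hfa x hx] at this
    · have := ha _ (Or.inr ⟨x, hx, y, hy, hxy, f x, f y, h, rfl⟩)
      simp [hfa x hx, hfa y hy] at this

theorem sdiff_pair_subset : ∀ i j : Fin 4, i ≠ j →
    ∃ k l, ∀ M : Finset (Fin 4), M \ {i, j} ⊆ {k, l} := by
  have key : ∀ i j : Fin 4, i ≠ j → ∃ k l, ∀ m, m ≠ i → m ≠ j → m = k ∨ m = l := by decide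
  intro i j hij
  obtain ⟨k, l, h⟩ := key i j hij
  refine ⟨k, l, fun M m hm => ?_⟩
  simp only [Finset.mem_sdiff, Finset.mem_insert, Finset.mem_singleton, not_or] at hm ⊢
  exact h m hm.2.1 hm.2.2

theorem Propagated.exists_subset_pair {c : Fin 7 → Fin 4} {L : V → Finset (Fin 4)}
    (h : Propagated v c L) (h5 : NoC5 G) {x : V} (h2 : HasPair (trace v x)) :
    ∃ i j, L x ⊆ {i, j} := by
  obtain ⟨a, b, hab, ha, hb, -⟩ := h.exists_pair h5 h2
  obtain ⟨i, j, hij⟩ := sdiff_pair_subset a b hab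
  refine ⟨i, j, fun m hm => hij (L x) ?_⟩
  simp only [Finset.mem_sdiff, Finset.mem_insert, Finset.mem_singleton, not_or]
  exact ⟨hm, fun h => ha (h ▸ hm), fun h => hb (h ▸ hm)⟩

theorem test5_iff_satisfiable (L : V → Finset (Fin 4)) (x y : V) {i j : Fin 4} (hij : i ≠ j) :
    Test5 G L x y i j ↔ (coloringFormula G (G.neighborSet x ∩ G.neighborSet y)
      (fun w => L w \ {i, j}) (fun _ => ∅) (fun _ _ => ∅)).Satisfiable := by
  rw [← exists_coloring_iff_satisfiable]
  · simp [Test5]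
  · obtain ⟨k, l, h⟩ := sdiff_pair_subset i j hij
    exact Or.inr fun w _ => ⟨k, l, h _⟩

theorem IsStep3.notMem {L₀ L : V → Finset (Fin 4)} (h : IsStep3 G L₀ L) {x w : V} {k : Fin 4}
    (hx : L x = {k}) (hxw : G.Adj x w) : k ∉ L w := by
  classical
  intro hk
  refine h.2 (fun u => if G.Adj x u then (L u).erase k else L u) ⟨fun heq => ?_, x, k, hx,
    fun u hu => if_pos hu, fun u hu => if_neg hu⟩
  have := congrFun heq w
  rw [if_pos hxw] at this
  rw [← this] at hk
  exact Finset.notMem_erase _ _ hk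

theorem IsColoringOf.exists_antihole {r : Fin 7 → Option V} {c : V → Option (Fin 4)}
    (hc : IsColoringOf G (setCR G v r) c) :
    ∃ c' : Fin 7 → Fin 4, (∀ t, c (v t) = some (c' t)) ∧ ∀ s t, A7 s t → c' s ≠ c' t := by
  have hmem : ∀ t, v t ∈ setCR G v r := fun t => Or.inl ⟨t, rfl⟩
  choose c' hc' using fun t => Option.isSome_iff_exists.1 ((hc.1 (v t)).2 (hmem t))
  refine ⟨c', hc', fun s t hst h => ?_⟩
  refine hc.2 (v s) (hmem s) (v t) (hmem t) ((adj_antihole v s t).2 hst) ?_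
  rw [hc', hc', h]

/-- After Step 3, the lists of the vertices coloured in Step 6 have at most two elements, unless a
list is empty. -/
theorem exists_empty_or_small (h5 : NoC5 G) {r : Fin 7 → Option V} {c : V → Option (Fin 4)}
    (hc : IsColoringOf G (setCR G v r) c) {L : V → Finset (Fin 4)}
    (hL : IsStep3 G (initLists c) L) :
    (∃ x ∈ setG' G v, L x = ∅) ∨ ∀ x ∈ setG' G v, ∃ i j, L x ⊆ {i, j} := by
  by_cases hempty : ∃ x ∈ setG' G v, L x = ∅
  · exact Or.inl hempty
  refine Or.inr ?_
  obtain ⟨c', hc', -⟩ := hc.exists_antihole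
  have hv : ∀ t, L (v t) = {c' t} := by
    intro t
    have h1 : L (v t) ⊆ {c' t} := by
      have := subset_of_propagation hL.1 (v t)
      rwa [initLists, hc'] at this
    exact (Finset.subset_singleton_iff.1 h1).resolve_left
      fun h => hempty ⟨v t, Or.inl ⟨t, rfl⟩, h⟩
  have hP : Propagated v c' L := ⟨hv, fun x k w hx hxw => hL.notMem hx hxw⟩
  exact fun x hx => hP.exists_subset_pair h5 (mem_setG'_iff.1 hx)

theorem test6_iff_satisfiable (h5 : NoC5 G) {r : Fin 7 → Option V} {it : Iteration V}
    (hit : IsIteration G v r it) : Test6 G v it.L it.Q₁ it.Q₂ ↔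
      (coloringFormula G (setG' G v) it.L it.Q₁ it.Q₂).Satisfiable :=
  exists_coloring_iff_satisfiable (exists_empty_or_small h5 hit.step2 hit.step3)

end Formula

/-! ### The colourings of `C ∪ R` -/

section Candidates

variable {V : Type} {G : SimpleGraph V} {v : Antihole G}

open Classical in
/-- The colouring that extends `col k` by the colour `w i` for the vertex `r i`. -/
noncomputable def extendCol (v : Antihole G) (r : Fin 7 → Option V) (k : Fin 7) (w : Fin 7 → Fin 4)
    (x : V) : Option (Fin 4) :=
  if h : ∃ t, x = v t then some (col k h.choose)
  else if h : ∃ i, r i = some x then some (w h.choose) else none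

/-- The parameters `k` and `w` give a colouring of `G[C ∪ R]`. The colour of an index without a
vertex of `R` is fixed, so that different parameters give different colourings. -/
structure ValidCol (v : Antihole G) (r : Fin 7 → Option V) (k : Fin 7) (w : Fin 7 → Fin 4) :
    Prop where
  none : ∀ i, r i = none → w i = 0
  antihole : ∀ i x, r i = some x → ∀ t, G.Adj x (v t) → w i ≠ col k t
  same : ∀ i j x, r i = some x → r j = some x → w i = w j
  adj : ∀ i j x y, r i = some x → r j = some y → G.Adj x y → w i ≠ w j

theorem extendCol_antihole (r : Fin 7 → Option V) (k : Fin 7) (w : Fin 7 → Fin 4) (t : Fin 7) :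
    extendCol v r k w (v t) = some (col k t) := by
  have h : ∃ t', v t = v t' := ⟨t, rfl⟩
  rw [extendCol, dif_pos h]
  congr 2
  exact (v.injective h.choose_spec).symm

theorem IsStep1.not_antihole {r : Fin 7 → Option V} (hr : IsStep1 G v r) {i : Fin 7} {x : V}
    (hx : r i = some x) : ¬ ∃ t, x = v t := by
  rintro ⟨t, rfl⟩
  exact ((hr i).2 _ hx).1.1.1.1.1 ⟨t, rfl⟩

theorem extendCol_some {r : Fin 7 → Option V} (hr : IsStep1 G v r) {k : Fin 7}
    {w : Fin 7 → Fin 4} (hw : ValidCol v r k w) {i : Fin 7} {x : V} (hx : r i = some x) :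
    extendCol v r k w x = some (w i) := by
  have h : ∃ i, r i = some x := ⟨i, hx⟩
  rw [extendCol, dif_neg (hr.not_antihole hx), dif_pos h]
  congr 1
  exact hw.same _ _ x h.choose_spec hx

theorem extendCol_none {r : Fin 7 → Option V} {k : Fin 7} {w : Fin 7 → Fin 4} {x : V}
    (hx : x ∉ setCR G v r) : extendCol v r k w x = none := by
  rw [extendCol, dif_neg (fun ⟨t, ht⟩ => hx (Or.inl ⟨t, ht.symm⟩)),
    dif_neg (fun h : ∃ i, r i = some x => hx (Or.inr h))]

theorem col_ne {k s t : Fin 7} : A7 s t → col k s ≠ col k t := by revert k s t; decide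

theorem isColoringOf_extendCol {r : Fin 7 → Option V} (hr : IsStep1 G v r) {k : Fin 7}
    {w : Fin 7 → Fin 4} (hw : ValidCol v r k w) :
    IsColoringOf G (setCR G v r) (extendCol v r k w) := by
  refine ⟨fun x => ⟨fun h => ?_, ?_⟩, ?_⟩
  · by_contra hx
    rw [extendCol_none hx] at h
    simp at h
  · rintro (⟨t, rfl⟩ | ⟨i, hi⟩)
    · rw [extendCol_antihole]; rfl
    · rw [extendCol_some hr hw hi]; rfl
  · rintro x (⟨s, rfl⟩ | ⟨i, hi⟩) y (⟨t, rfl⟩ | ⟨j, hj⟩) hxy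
    · rw [extendCol_antihole, extendCol_antihole]
      exact fun h => col_ne ((adj_antihole v s t).1 hxy) (Option.some_injective _ h)
    · rw [extendCol_antihole, extendCol_some hr hw hj]
      exact fun h => hw.antihole j y hj s hxy.symm (Option.some_injective _ h).symm
    · rw [extendCol_antihole, extendCol_some hr hw hi]
      exact fun h => hw.antihole i x hi t hxy (Option.some_injective _ h)
    · rw [extendCol_some hr hw hi, extendCol_some hr hw hj]
      exact fun h => hw.adj i j x y hi hj hxy (Option.some_injective _ h)

theorem exists_col_eq (k : Fin 7) (m : Fin 4) : ∃ t, col k t = m := by revert k m; decide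

/-- The index `k` is determined by the partition into the classes of `col k`. -/
theorem eq_of_col_iff {k k' : Fin 7} :
    (∀ s t, col k s = col k t → col k' s = col k' t) → k = k' := by
  revert k k'; decide

theorem eq_of_sameUpToColors {r : Fin 7 → Option V} (hr : IsStep1 G v r) {k k' : Fin 7}
    {w w' : Fin 7 → Fin 4} (hw : ValidCol v r k w) (hw' : ValidCol v r k' w')
    (h : SameUpToColors (extendCol v r k w) (extendCol v r k' w')) : k = k' ∧ w = w' := by
  obtain ⟨σ, hσ⟩ := h
  have h1 : ∀ t, col k' t = σ (col k t) := fun t => by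
    have := hσ (v t)
    rw [extendCol_antihole, extendCol_antihole] at this
    exact Option.some_injective _ this
  obtain rfl : k = k' := eq_of_col_iff fun s t hst => by rw [h1, h1, hst]
  have h2 : ∀ m, σ m = m := fun m => by
    obtain ⟨t, rfl⟩ := exists_col_eq k m
    exact (h1 t).symm
  refine ⟨rfl, funext fun i => ?_⟩
  rcases hi : r i with _ | x
  · rw [hw.none i hi, hw'.none i hi]
  · have := hσ x
    rw [extendCol_some hr hw hi, extendCol_some hr hw' hi] at this
    have := Option.some_injective _ this
    rw [h2] at this
    exact this.symm

theorem exists_validCol {r : Fin 7 → Option V} (hr : IsStep1 G v r) {c : V → Option (Fin 4)}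
    (hc : IsColoringOf G (setCR G v r) c) :
    ∃ k w, ValidCol v r k w ∧ SameUpToColors (extendCol v r k w) c := by
  obtain ⟨c', hc', hne⟩ := hc.exists_antihole
  obtain ⟨k, hk⟩ := exists_col hne
  choose τ hτ using exists_col_eq k
  -- the permutation of the colours taking `col k` to `c'`
  have hinj : Function.Injective fun m => c' (τ m) := fun m m' h => by
    have := (hk _ _).1 h
    rwa [hτ, hτ] at this
  let σ := Equiv.ofBijective _ (Finite.injective_iff_bijective.1 hinj)
  have hσ : ∀ t, σ (col k t) = c' t := fun t => (hk _ _).2 (hτ _)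
  have hR : ∀ i x, r i = some x → ∃ m, c x = some (σ m) := fun i x hx => by
    obtain ⟨m, hm⟩ := Option.isSome_iff_exists.1 ((hc.1 x).2 (Or.inr ⟨i, hx⟩))
    exact ⟨σ.symm m, by rw [hm, σ.apply_symm_apply]⟩
  have hw : ∃ w : Fin 7 → Fin 4, (∀ i, r i = none → w i = 0) ∧
      ∀ i x, r i = some x → c x = some (σ (w i)) := by
    have : ∀ i, ∃ m : Fin 4, (r i = none → m = 0) ∧ ∀ x, r i = some x → c x = some (σ m) := by
      intro i
      rcases hi : r i with _ | x
      · exact ⟨0, fun _ => rfl, fun x hx => by simp at hx⟩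
      · obtain ⟨m, hm⟩ := hR i x hi
        exact ⟨m, fun h => by simp at h, fun y hy => Option.some_injective _ hy ▸ hm⟩
    choose w hw using this
    exact ⟨w, fun i => (hw i).1, fun i => (hw i).2⟩
  obtain ⟨w, hw0, hw⟩ := hw
  have hvalid : ValidCol v r k w := by
    refine ⟨hw0, fun i x hx t hxt heq => ?_, fun i j x hi hj => ?_, fun i j x y hi hj hxy heq => ?_⟩
    · refine hc.2 x (Or.inr ⟨i, hx⟩) (v t) (Or.inl ⟨t, rfl⟩) hxt ?_
      rw [hw i x hx, hc', heq, hσ]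
    · have := (hw i x hi).symm.trans (hw j x hj)
      exact σ.injective (Option.some_injective _ this)
    · refine hc.2 x (Or.inr ⟨i, hi⟩) y (Or.inr ⟨j, hj⟩) hxy ?_
      rw [hw i x hi, hw j y hj, heq]
  refine ⟨k, w, hvalid, σ, fun x => ?_⟩
  by_cases hx : x ∈ setCR G v r
  · rcases hx with ⟨t, rfl⟩ | ⟨i, hi⟩
    · rw [extendCol_antihole, hc', Option.map_some, hσ]
    · rw [extendCol_some hr hvalid hi, hw i x hi, Option.map_some]
  · rw [extendCol_none hx]
    have := mt (hc.1 x).1 hx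
    simpa using this

open Classical in
/-- The parameters of the 4-colourings of `C ∪ R`, one for each colouring up to permutations of the
colours. -/
noncomputable def validCols (v : Antihole G) (r : Fin 7 → Option V) :
    Finset (Fin 7 × (Fin 7 → Fin 4)) :=
  Finset.univ.filter fun p => ValidCol v r p.1 p.2

/-- There are at most two colours for each vertex of `R`, and only one colour for the vertex whose
index precedes the vertex of the antihole with a colour of its own. -/
theorem card_validCols_le {r : Fin 7 → Option V} (hr : IsStep1 G v r) :
    (validCols v r).card ≤ 7 * 2 ^ 6 := by
  classical
  let A : Fin 7 → Fin 7 → Finset (Fin 4) := fun k i =>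
    Finset.univ.filter fun m => m ≠ col k i ∧ m ≠ col k (i + 1) ∧ m ≠ col k (i + 2)
  let B : Fin 7 → Fin 7 → Finset (Fin 4) := fun k i => if r i = none then {0} else A k i
  have hA : ∀ k i, (A k i).card ≤ if i = k - 1 then 1 else 2 := by decide
  have hB : ∀ k i, (B k i).card ≤ if i = k - 1 then 1 else 2 := by
    intro k i
    by_cases h : r i = none
    · simp only [B, h, if_true, Finset.card_singleton]
      split_ifs <;> decide
    · simp only [B, h, if_false]
      exact hA k i
  have hprod : ∀ k : Fin 7, ∏ i, (if i = k - 1 then 1 else 2) = 2 ^ 6 := by decide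
  have hsub : validCols v r ⊆ Finset.univ.biUnion fun k : Fin 7 =>
      (Fintype.piFinset (B k)).map ⟨fun w => (k, w), fun _ _ h => (Prod.mk.inj h).2⟩ := by
    rintro ⟨k, w⟩ hw
    have hw : ValidCol v r k w := (Finset.mem_filter.1 hw).2
    simp only [Finset.mem_biUnion, Finset.mem_univ, true_and, Finset.mem_map]
    refine ⟨k, w, Fintype.mem_piFinset.2 fun i => ?_, rfl⟩
    rcases hi : r i with _ | x
    · simp [B, hi, hw.none i hi]
    · have hcand := ((hr i).2 x hi).1
      simp only [B, hi, A, reduceCtorEq, if_false, Finset.mem_filter, Finset.mem_univ, true_and]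
      exact ⟨hw.antihole i x hi _ hcand.2.1, hw.antihole i x hi _ hcand.2.2.1,
        hw.antihole i x hi _ hcand.2.2.2.1⟩
  refine (Finset.card_le_card hsub).trans (Finset.card_biUnion_le.trans ?_)
  refine (Finset.sum_le_card_nsmul _ _ (2 ^ 6) fun k _ => ?_).trans (by simp)
  rw [Finset.card_map, Fintype.card_piFinset, ← hprod k]
  exact Finset.prod_le_prod' fun i _ => hB k i

theorem exists_list_colorings {r : Fin 7 → Option V} (hr : IsStep1 G v r) :
    ∃ l : List (V → Option (Fin 4)), l.length ≤ 7 * 2 ^ 6 ∧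
      ∀ c, IsColoringOf G (setCR G v r) c → ∃ c' ∈ l, SameUpToColors c' c := by
  classical
  refine ⟨(validCols v r).toList.map fun p => extendCol v r p.1 p.2, ?_, fun c hc => ?_⟩
  · rw [List.length_map, Finset.length_toList]
    exact card_validCols_le hr
  · obtain ⟨k, w, hw, hs⟩ := exists_validCol hr hc
    exact ⟨_, List.mem_map.2 ⟨(k, w), Finset.mem_toList.2
      (Finset.mem_filter.2 ⟨Finset.mem_univ _, hw⟩), rfl⟩, hs⟩

end Candidates

/-! ### Reading the input -/

section Primitives

variable {Γ : Type} {e d : Γ → Data} {n : Γ → ℕ}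

/-- The loop that moves along a list and extends a unary numeral in each step. -/
theorem encodeNat_length_aux (l : List Data) (k : ℕ) : ∃ t, t ≤ (l.length + 1) *
      (20 * (Data.node (encodeList l) (encodeNat (k + l.length))).size) ∧
    Prog.Eval (.loop .hd (.pair (.seq .hd .tl) (.pair .nil .tl)))
      (.node (encodeList l) (encodeNat k)) (.node .leaf (encodeNat (k + l.length))) t := by
  induction l generalizing k with
  | nil =>
    refine ⟨_, ?_, .loop_done (.hd_node _ _)⟩
    simp only [encodeList, List.length_nil, Data.size, Nat.add_zero]
    omega
  | cons a l ih =>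
    obtain ⟨t, ht, hE⟩ := ih (k + 1)
    rw [Poly.encodeNat_succ] at hE
    have hk : k + 1 + l.length = k + (l.length + 1) := by omega
    rw [hk] at ht hE
    refine ⟨_, ?_, .loop_step (.hd_node _ _) (.pair (.seq (.hd_node _ _) (.tl_node _ _))
      (.pair (.nil _) (.tl_node _ _))) hE⟩
    simp only [encodeList, List.length_cons, Data.size, Poly.size_encodeNat] at ht ⊢
    have : (l.length + 1) * (20 * (1 + (encodeList l).size + (2 * (k + (l.length + 1)) + 1))) ≤
        (l.length + 1) *
          (20 * (1 + (1 + a.size + (encodeList l).size) + (2 * (k + (l.length + 1)) + 1))) := by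
      gcongr; omega
    rw [Nat.add_mul (l.length + 1), Nat.one_mul]
    omega

theorem length_le_size_encodeList (l : List Data) : l.length ≤ (encodeList l).size := by
  induction l with
  | nil => exact Nat.zero_le _
  | cons a l ih => simp only [encodeList, Data.size, List.length_cons]; omega

theorem Poly.length {l : Γ → List Data} (h : Poly e fun γ => encodeList (l γ)) :
    Poly e fun γ => encodeNat (l γ).length := by
  refine h.comp (Poly.snd (d₁ := fun _ => .leaf) (Poly.comp (d₁ := fun γ =>
    .node (encodeList (l γ)) (encodeNat 0)) ((Poly.id _).node (Poly.leaf _)) ?_))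
  refine ⟨.loop .hd (.pair (.seq .hd .tl) (.pair .nil .tl)), (.X + 1) * (80 * .X), fun γ => ?_⟩
  obtain ⟨t, ht, hE⟩ := encodeNat_length_aux (l γ) 0
  rw [Nat.zero_add] at hE ht
  refine ⟨t, ht.trans ?_, hE⟩
  have := length_le_size_encodeList (l γ)
  simp only [Polynomial.eval_mul, Polynomial.eval_add, Polynomial.eval_X, Polynomial.eval_one,
    Polynomial.eval_ofNat]
  refine Nat.mul_le_mul ?_ ?_ <;> simp only [Data.size, Poly.size_encodeNat] <;> omega

open Classical in
/-- A conditional, where the computation of the first branch need only be correct for the instances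
that satisfy the condition. -/
theorem Poly.iteOn {p : Γ → Prop} {d' : Γ → Data} (hp : Dec e p)
    (h₁ : Poly (fun γ : {γ // p γ} => e γ) fun γ => d γ) (h₂ : Poly e d') :
    Poly e fun γ => if p γ then d γ else d' γ := by
  obtain ⟨B, b, hB⟩ := hp
  obtain ⟨P, p', hP⟩ := h₁
  obtain ⟨Q, q, hQ⟩ := h₂
  refine ⟨.ite B P Q, b + p' + q + .X, fun γ => ?_⟩
  obtain ⟨r, hr, hEr⟩ := hB γ
  obtain ⟨t, ht, hEt⟩ := hQ γ
  simp only [Polynomial.eval_add, Polynomial.eval_X]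
  split_ifs with h
  · obtain ⟨s, hs, hEs⟩ := hP ⟨γ, h⟩
    change s ≤ p'.eval (e γ).size at hs
    simp only [h, decide_true, encodeBool] at hEr
    exact ⟨_, by omega, .ite_true hEr hEs⟩
  · simp only [h, decide_false, encodeBool] at hEr
    exact ⟨_, by omega, .ite_false hEr hEt⟩

/-- A conjunction, where the second condition is evaluated only if the first holds. -/
theorem Dec.andOn {p q : Γ → Prop} (hp : Dec e p)
    (hq : Dec (fun γ : {γ // p γ} => e γ) fun γ => q γ) : Dec e fun γ => p γ ∧ q γ := by
  have := Poly.iteOn hp (d := fun γ => encodeBool (@decide (q γ) (Classical.dec _))) hq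
    (Poly.const e (encodeBool .false))
  unfold Dec
  convert this using 2 with γ
  by_cases h : p γ
  · rw [if_pos h]
    congr 1
    simp [h]
  · simp [h]

theorem Dec.eqNat {x y : Γ → ℕ} (hx : Poly e fun γ => encodeNat (x γ))
    (hy : Poly e fun γ => encodeNat (y γ)) : Dec e fun γ => x γ = y γ :=
  ((Dec.le hx hy).and (Dec.le hy hx)).congr fun γ => by omega

theorem encodeOption_eq {α : Type} (f : α → Data) (o : Option α) :
    encodeOption f o = encodeList (o.toList.map f) := by
  cases o <;> rfl

theorem Dec.eqNone {α : Γ → Type} {enc : ∀ γ, α γ → Data} {o : ∀ γ, Option (α γ)}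
    (h : Poly e fun γ => encodeOption (enc γ) (o γ)) : Dec e fun γ => o γ = none := by
  simp only [encodeOption_eq] at h
  refine (Dec.eq_nil h).congr fun γ => ?_
  cases o γ <;> simp

theorem Dec.eqSome {o : ∀ γ, Option (Fin (n γ))} {x : ∀ γ, Fin (n γ)}
    (h : Poly e fun γ => encodeOption (fun x => encodeNat x.val) (o γ))
    (hx : Poly e fun γ => encodeNat (x γ)) : Dec e fun γ => o γ = some (x γ) := by
  have h1 : Poly e fun γ => encodeNat ((o γ).elim 0 Fin.val) := by
    refine h.comp ⟨.hd, .X, fun γ =>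
      ⟨(encodeOption (fun x => encodeNat x.val) (o γ)).size, by simp, ?_⟩⟩
    dsimp only
    cases o γ
    · exact .hd_leaf
    · exact .hd_node _ _
  refine ((Dec.eqNone h).not.and (Dec.eqNat h1 hx)).congr fun γ => ?_
  cases o γ <;> simp [Fin.ext_iff]

open Classical in
/-- The first index with the property `p`. -/
noncomputable def firstIndex {m : ℕ} (p : Fin m → Prop) : Option (Fin m) :=
  (List.finRange m).find? fun x => decide (p x)

theorem not_of_firstIndex_eq_none {m : ℕ} {p : Fin m → Prop} (h : firstIndex p = none)
    (x : Fin m) : ¬ p x := by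
  have := List.find?_eq_none.1 h x (List.mem_finRange x)
  simpa using this

theorem of_firstIndex_eq_some {m : ℕ} {p : Fin m → Prop} {x : Fin m}
    (h : firstIndex p = some x) : p x := by
  have := List.find?_some h
  simpa using this

theorem Poly.firstIndex (hn : Poly e fun γ => encodeNat (n γ)) {p : ∀ γ, Fin (n γ) → Prop}
    (h : Dec (ext e n) fun x => p x.1 x.2) :
    Poly e fun γ => encodeOption (fun x => encodeNat x.val) (firstIndex (p γ)) := by
  classical
  have := loopDown (e := e) (n := n) (st := fun γ k => encodeOption (fun x => encodeNat x.val)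
    (((List.finRange (n γ)).drop k).find? fun x => decide (p γ x))) hn ?_ ?_ ?_
  · convert this using 2
    unfold PhaseTwo.firstIndex
    simp
  · convert leaf e with γ
    rw [List.drop_of_length_le (by simp)]
    rfl
  · have h1 := Poly.ite (e := fun x : (γ : Γ) × Fin (n γ) => .node (ext e n x)
      (encodeOption (fun x => encodeNat x.val)
        (((List.finRange (n x.1)).drop (x.2 + 1)).find? fun y => decide (p x.1 y))))
      (p := fun x => p x.1 x.2) (d₁ := fun x => .node (encodeNat x.2) .leaf) h.keep
      ((Poly.var e n).keep.node (Poly.leaf _)) (Poly.id _).snd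
    convert h1 using 2 with x
    rw [List.drop_eq_getElem_cons (i := x.2) (by simp), List.find?_cons]
    by_cases hx : p x.1 x.2
    · simp [hx, encodeOption]
    · simp [hx]
  · obtain ⟨q, hq⟩ := hn.size_le
    refine ⟨q + 3, fun γ k _ => ?_⟩
    have h1 := hq γ
    rw [size_encodeNat] at h1
    simp only [Polynomial.eval_add, Polynomial.eval_ofNat]
    rcases ((List.finRange (n γ)).drop k).find? fun x => decide (p γ x) with _ | x
    · simp only [encodeOption, Data.size]; omega
    · simp only [encodeOption, Data.size, size_encodeNat]
      have := x.isLt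
      omega

end Primitives

/-- An input of the algorithm: an admissible graph with a 7-antihole. -/
structure Instance where
  n : ℕ
  G : SimpleGraph (Fin n)
  v : Antihole G
  adm : IsAdmissible G

/-- The encoding of the input. -/
noncomputable def encodeInst (J : Instance) : Data := encodeInput J.G J.v

section Input

variable {Γ : Type} {e : Γ → Data} {I : Γ → Instance}

theorem Poly.order (hI : Poly e fun γ => encodeInst (I γ)) :
    Poly e fun γ => encodeNat (I γ).n := by
  have := Poly.length (l := fun γ => List.ofFn fun x : Fin (I γ).n => encodeFun fun y =>
    encodeBool (@decide ((I γ).G.Adj x y) (Classical.dec _))) hI.fst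
  simpa using this

theorem Dec.adj (hI : Poly e fun γ => encodeInst (I γ)) {x y : ∀ γ, Fin (I γ).n}
    (hx : Poly e fun γ => encodeNat (x γ)) (hy : Poly e fun γ => encodeNat (y γ)) :
    Dec e fun γ => (I γ).G.Adj (x γ) (y γ) := by
  have h1 := Poly.lookup (m := fun γ => (I γ).n) (T := fun γ x => encodeFun fun y =>
    encodeBool (@decide ((I γ).G.Adj x y) (Classical.dec _))) hI.fst hx
  exact Poly.lookup (m := fun γ => (I γ).n) (T := fun γ y =>
    encodeBool (@decide ((I γ).G.Adj (x γ) y) (Classical.dec _))) h1 hy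

theorem Poly.antihole (hI : Poly e fun γ => encodeInst (I γ)) (t : Fin 7) :
    Poly e fun γ => encodeNat ((I γ).v t) :=
  Poly.lookupConst (T := fun γ t => encodeNat ((I γ).v t)) hI.snd t

variable {x : ∀ γ, Fin (I γ).n}

theorem Dec.trace (hI : Poly e fun γ => encodeInst (I γ)) (hx : Poly e fun γ => encodeNat (x γ))
    (t : Fin 7) : Dec e fun γ => trace (I γ).v (x γ) t :=
  Dec.adj hI hx (Poly.antihole hI t)

theorem Dec.eqAntihole (hI : Poly e fun γ => encodeInst (I γ))
    (hx : Poly e fun γ => encodeNat (x γ)) (t : Fin 7) : Dec e fun γ => x γ = (I γ).v t :=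
  Dec.eq (m := fun γ => (I γ).n) hx (Poly.antihole hI t)

theorem Dec.hasPair (hI : Poly e fun γ => encodeInst (I γ))
    (hx : Poly e fun γ => encodeNat (x γ)) :
    Dec e fun γ => HasPair (PhaseTwo.trace (I γ).v (x γ)) :=
  Dec.exFixed fun i => Dec.exFixed fun j =>
    (Dec.const e (i ≠ j)).and ((Dec.trace hI hx i).and (Dec.trace hI hx j))

theorem Dec.hasTriangle (hI : Poly e fun γ => encodeInst (I γ))
    (hx : Poly e fun γ => encodeNat (x γ)) :
    Dec e fun γ => HasTriangle (PhaseTwo.trace (I γ).v (x γ)) :=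
  Dec.exFixed fun i => (Dec.trace hI hx i).and ((Dec.trace hI hx (i + 2)).and
    (Dec.trace hI hx (i + 4)))

end Input

/-- Membership in `S` in terms of adjacencies: a triangle of the antihole consists of the vertices
`i`, `i + 2` and `i + 4` for some `i`. -/
theorem mem_setS_iff {V : Type} {G : SimpleGraph V} {v : Antihole G} {x : V} :
    x ∈ setS G v ↔ (∀ t, x ≠ v t) ∧ HasPair (trace v x) ∧ ¬ HasTriangle (trace v x) ∧
      ∃ y, ¬ HasPair (trace v y) ∧ G.Adj x y := by
  have hbig : x ∈ setX G v → (x ∈ setBig G v ↔ HasTriangle (trace v x)) := by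
    intro hX
    constructor
    · rintro ⟨-, i, j, k, hij, hjk, hik, hi, hj, hk⟩
      rw [adj_antihole] at hij hjk hik
      obtain ⟨m, h0, h2, h4⟩ : ∃ m : Fin 7, (m = i ∨ m = j ∨ m = k) ∧
          (m + 2 = i ∨ m + 2 = j ∨ m + 2 = k) ∧ (m + 4 = i ∨ m + 4 = j ∨ m + 4 = k) := by
        clear hi hj hk
        revert i j k; decide
      have h : ∀ t, (t = i ∨ t = j ∨ t = k) → G.Adj x (v t) := fun t ht => by
        rcases ht with rfl | rfl | rfl <;> assumption
      exact ⟨m, h _ h0, h _ h2, h _ h4⟩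
    · rintro ⟨i, h0, h2, h4⟩
      refine ⟨hX, i, i + 2, i + 4, ?_, ?_, ?_, h0, h2, h4⟩ <;> rw [adj_antihole] <;>
        clear h0 h2 h4 <;> revert i <;> decide
  have hG' := mem_setG'_iff (v := v) (x := x)
  constructor
  · rintro ⟨⟨hX, hZ, hB⟩, y, hy, hxy⟩
    refine ⟨fun t ht => hX.1 ⟨t, ht.symm⟩, hG'.1 (Or.inr ⟨hX, hZ⟩), fun h => hB ((hbig hX).2 h), y,
      ?_, hxy⟩
    rwa [← exists_weak_iff, ← mem_setY_union_setZ]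
  · rintro ⟨hv, h2, h3, y, hy, hxy⟩
    rw [← exists_weak_iff, ← mem_setY_union_setZ] at hy
    rcases hG'.2 h2 with ⟨t, rfl⟩ | ⟨hX, hZ⟩
    · exact (hv t rfl).elim
    · exact ⟨⟨hX, hZ, fun h => h3 ((hbig hX).1 h)⟩, y, hy, hxy⟩

section Choices

variable {Γ : Type} {e : Γ → Data} {I : Γ → Instance} {x : ∀ γ, Fin (I γ).n}

theorem Dec.isCandidate (hI : Poly e fun γ => encodeInst (I γ))
    (hx : Poly e fun γ => encodeNat (x γ)) (i : Fin 7) :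
    Dec e fun γ => IsCandidate (I γ).G (I γ).v i (x γ) := by
  have hS : Dec e fun γ => x γ ∈ setS (I γ).G (I γ).v := by
    have hy : Poly (ext e fun γ => (I γ).n) fun p => encodeNat p.2 := Poly.var _ _
    have hI' : Poly (ext e fun γ => (I γ).n) fun p => encodeInst (I p.1) := hI.lift
    have hx' : Poly (ext e fun γ => (I γ).n) fun p => encodeNat (x p.1) := hx.lift
    have h1 := Dec.ex (e := e) (n := fun γ => (I γ).n) (Poly.order hI)
      (p := fun γ y => ¬ HasPair (PhaseTwo.trace (I γ).v y) ∧ (I γ).G.Adj (x γ) y)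
      ((Dec.hasPair hI' hy).not.and (Dec.adj hI' hx' hy))
    exact ((Dec.allFixed fun t => (Dec.eqAntihole hI hx t).not).and ((Dec.hasPair hI hx).and
      ((Dec.hasTriangle hI hx).not.and h1))).congr fun γ => mem_setS_iff.symm
  exact hS.and ((Dec.trace hI hx i).and ((Dec.trace hI hx (i + 1)).and
    ((Dec.trace hI hx (i + 2)).and (Dec.trace hI hx (i - 1)).not)))

/-- The choices of Step 1: the first candidates, among those with priority if there are any. -/
noncomputable def chosenVertex (J : Instance) (i : Fin 7) : Option (Fin J.n) :=
  firstIndex fun u => IsCandidate J.G J.v i u ∧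
    ((∃ w, IsCandidate J.G J.v i w ∧ ¬ J.G.Adj w (J.v (i + 3))) → ¬ J.G.Adj u (J.v (i + 3)))

theorem isStep1_chosenVertex (J : Instance) : IsStep1 J.G J.v (chosenVertex J) := by
  intro i
  refine ⟨fun h u hu => ?_, fun u hu => of_firstIndex_eq_some hu⟩
  have hno := not_of_firstIndex_eq_none h
  by_cases hex : ∃ w, IsCandidate J.G J.v i w ∧ ¬ J.G.Adj w (J.v (i + 3))
  · obtain ⟨w, hw, hw'⟩ := hex
    exact hno w ⟨hw, fun _ => hw'⟩
  · exact hno u ⟨hu, fun h => (hex h).elim⟩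

theorem Poly.chosenVertex (hI : Poly e fun γ => encodeInst (I γ)) :
    Poly e fun γ => encodeFun fun i : Fin 7 =>
      encodeOption (fun x => encodeNat x.val) (chosenVertex (I γ) i) := by
  refine Poly.encodeFunConst fun i => Poly.firstIndex (Poly.order hI) ?_
  have hI' : Poly (ext e fun γ => (I γ).n) fun p => encodeInst (I p.1) := hI.lift
  have hy : Poly (ext e fun γ => (I γ).n) fun p => encodeNat p.2 := Poly.var _ _
  have hz : Poly (ext (ext e fun γ => (I γ).n) fun p => (I p.1).n) fun p => encodeNat p.2 :=
    Poly.var _ _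
  have hI'' : Poly (ext (ext e fun γ => (I γ).n) fun p => (I p.1).n)
      fun p => encodeInst (I p.1.1) := hI'.lift
  have h1 := Dec.ex (e := ext e fun γ => (I γ).n) (n := fun p => (I p.1).n) (Poly.order hI')
    (p := fun p w => IsCandidate (I p.1).G (I p.1).v i w ∧ ¬ (I p.1).G.Adj w ((I p.1).v (i + 3)))
    ((Dec.isCandidate hI'' hz i).and (Dec.trace hI'' hz (i + 3)).not)
  exact (Dec.isCandidate hI' hy i).and (h1.imp (Dec.trace hI' hy (i + 3)).not)

end Choices

/-! ### Propagation of single colours -/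

section Propagate

variable {n : ℕ} (G : SimpleGraph (Fin n)) (L : Fin n → Finset (Fin 4))

/-- The rule of Step 3 applies to the vertex `u`. -/
def Active (u : Fin n) : Prop := ∃ m, L u = {m} ∧ ∃ w, G.Adj u w ∧ m ∈ L w

open Classical in
/-- The rule of Step 3, applied to the first vertex where this changes the lists. -/
noncomputable def propagate (x : Fin n) : Finset (Fin 4) :=
  (L x).filter fun d => ¬ ∃ u, firstIndex (Active G L) = some u ∧ G.Adj u x ∧ L u = {d}

variable {G L}

theorem mem_propagate {x : Fin n} {d : Fin 4} : d ∈ propagate G L x ↔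
    d ∈ L x ∧ ¬ ∃ u, firstIndex (Active G L) = some u ∧ G.Adj u x ∧ L u = {d} := by
  simp only [propagate, Finset.mem_filter]

theorem PropagationStep.exists_active {L' : Fin n → Finset (Fin 4)} (h : PropagationStep G L L') :
    ∃ u, Active G L u := by
  obtain ⟨hne, x, i, hx, h1, h2⟩ := h
  refine ⟨x, i, hx, ?_⟩
  by_contra! hcon
  refine hne (funext fun u => ?_)
  by_cases hu : G.Adj x u
  · rw [h1 u hu, Finset.erase_eq_of_notMem (hcon u hu)]
  · exact h2 u hu

theorem propagate_eq_self_or : (propagate G L = L ∧ ∀ u, ¬ Active G L u) ∨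
    PropagationStep G L (propagate G L) := by
  rcases hu : firstIndex (Active G L) with _ | u
  · refine Or.inl ⟨funext fun x => Finset.ext fun d => ?_, not_of_firstIndex_eq_none hu⟩
    rw [mem_propagate, hu]
    simp
  · obtain ⟨m, hm, w, huw, hw⟩ := of_firstIndex_eq_some hu
    have key : ∀ x d, d ∈ propagate G L x ↔ d ∈ L x ∧ ¬ (G.Adj u x ∧ m = d) := fun x d => by
      rw [mem_propagate, hu]
      simp [hm]
    refine Or.inr ⟨fun h => ?_, u, m, hm, fun x hx => ?_, fun x hx => ?_⟩
    · rw [← h, key] at hw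
      exact hw.2 ⟨huw, rfl⟩
    · ext d
      rw [key, Finset.mem_erase]
      simp only [hx, true_and]
      tauto
    · ext d
      rw [key]
      simp [hx]

theorem PropagationStep.sum_card_lt {L' : Fin n → Finset (Fin 4)} (h : PropagationStep G L L') :
    ∑ x, (L' x).card < ∑ x, (L x).card := by
  refine Finset.sum_lt_sum (fun x _ => Finset.card_le_card (h.subset x)) ?_
  by_contra! hcon
  exact h.1 (funext fun x =>
    Finset.eq_of_subset_of_card_le (h.subset x) (hcon x (Finset.mem_univ x)))

/-- Every application shortens a list, so that `4 * n` of them suffice. -/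
theorem isStep3_iterate_propagate (L : Fin n → Finset (Fin 4)) :
    IsStep3 G L ((propagate G)^[4 * n] L) := by
  constructor
  · generalize 4 * n = k
    induction k with
    | zero => exact .refl
    | succ k ih =>
      rw [Function.iterate_succ_apply']
      rcases propagate_eq_self_or (G := G) (L := (propagate G)^[k] L) with h | h
      · rwa [h.1]
      · exact ih.tail h
  · have hfix := iterate_fixed_of_measure (f := propagate G) (fun L => ∑ x, (L x).card)
      (fun L => propagate_eq_self_or.imp And.left PropagationStep.sum_card_lt) (4 * n) L (by
        refine (Finset.sum_le_card_nsmul _ _ 4 fun x _ => ?_).trans (by simp [Nat.mul_comm])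
        exact (Finset.card_le_univ _).trans (by simp))
    intro L' hL'
    obtain ⟨u, hu⟩ := hL'.exists_active
    rcases propagate_eq_self_or (G := G) (L := (propagate G)^[4 * n] L) with h | h
    · exact h.2 u hu
    · exact h.1 hfix

end Propagate

section StartLists

variable {V : Type} {G : SimpleGraph V} {v : Antihole G}

theorem mem_initLists {c : V → Option (Fin 4)} {x : V} {d : Fin 4} :
    d ∈ initLists c x ↔ ∀ m, c x = some m → m = d := by
  rw [initLists]
  cases c x <;> simp [eq_comm]

open Classical in
/-- The lists after the rule of Step 3 has been applied to the vertices of the antihole. To start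
with these keeps their own lists from becoming empty. -/
noncomputable def startLists (v : Antihole G) (c : V → Option (Fin 4)) (k : Fin 7) (x : V) :
    Finset (Fin 4) :=
  (initLists c x).filter fun d => ∀ t, G.Adj x (v t) → col k t ≠ d

theorem mem_startLists {c : V → Option (Fin 4)} {k : Fin 7} {x : V} {d : Fin 4} :
    d ∈ startLists v c k x ↔ (∀ m, c x = some m → m = d) ∧ ∀ t, G.Adj x (v t) → col k t ≠ d := by
  classical
  simp only [startLists, Finset.mem_filter, mem_initLists]

theorem reflTransGen_erase {L L' : V → Finset (Fin 4)} {x : V} {i : Fin 4} (hx : L x = {i})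
    (h1 : ∀ u, G.Adj x u → L' u = (L u).erase i) (h2 : ∀ u, ¬ G.Adj x u → L' u = L u) :
    Relation.ReflTransGen (PropagationStep G) L L' := by
  by_cases h : L' = L
  · rw [h]
  · exact .single ⟨h, x, i, hx, h1, h2⟩

theorem reflTransGen_startLists {c : V → Option (Fin 4)} {k : Fin 7}
    (hc : ∀ t, c (v t) = some (col k t)) :
    Relation.ReflTransGen (PropagationStep G) (initLists c) (startLists v c k) := by
  classical
  -- the lists after the rule has been applied to the first `m` vertices of the antihole
  let M : ℕ → V → Finset (Fin 4) := fun m x =>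
    (initLists c x).filter fun d => ∀ t : Fin 7, t.val < m → G.Adj x (v t) → col k t ≠ d
  have hM : ∀ m ≤ 7, Relation.ReflTransGen (PropagationStep G) (initLists c) (M m) := by
    intro m hm
    induction m with
    | zero =>
      have : M 0 = initLists c := by
        funext x
        simp [M]
      rw [this]
    | succ m ih =>
      refine (ih (by omega)).trans
        (reflTransGen_erase (x := v ⟨m, hm⟩) (i := col k ⟨m, hm⟩) ?_ ?_ ?_)
      · refine Finset.eq_singleton_iff_unique_mem.2 ⟨?_, fun d hd => ?_⟩
        · refine Finset.mem_filter.2 ⟨mem_initLists.2 fun d hd => ?_, fun t _ ht => ?_⟩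
          · rw [hc] at hd
            exact (Option.some_injective _ hd).symm
          · exact (col_ne ((adj_antihole v _ _).1 ht)).symm
        · exact (mem_initLists.1 (Finset.mem_filter.1 hd).1 _ (hc _)).symm
      · intro u hu
        ext d
        simp only [M, Finset.mem_filter, Finset.mem_erase]
        constructor
        · rintro ⟨h1, h2⟩
          exact ⟨(h2 ⟨m, hm⟩ (Nat.lt_succ_self m) hu.symm).symm, h1,
            fun t ht => h2 t (Nat.lt_succ_of_lt ht)⟩
        · rintro ⟨h1, h2, h3⟩
          refine ⟨h2, fun t ht hut => ?_⟩
          rcases Nat.lt_succ_iff_lt_or_eq.1 ht with h | h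
          · exact h3 t h hut
          · obtain rfl : t = ⟨m, hm⟩ := Fin.ext h
            exact h1.symm
      · intro u hu
        ext d
        simp only [M, Finset.mem_filter]
        refine and_congr_right fun _ =>
          ⟨fun h t ht => h t (Nat.lt_succ_of_lt ht), fun h t ht hut => ?_⟩
        rcases Nat.lt_succ_iff_lt_or_eq.1 ht with h' | h'
        · exact h t h' hut
        · obtain rfl : t = ⟨m, hm⟩ := Fin.ext h'
          exact (hu hut.symm).elim
  have := hM 7 le_rfl
  convert this using 1
  funext x
  ext d
  rw [mem_startLists, Finset.mem_filter, mem_initLists]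
  exact and_congr_right fun _ => ⟨fun h t _ => h t, fun h t => h t t.isLt⟩

/-- If the colours of the antihole have been deleted from the lists of the neighbours, then no
single colour left for a vertex can be deleted from the list of a vertex of the antihole. -/
theorem antihole_of_propagation {L L' : V → Finset (Fin 4)} {k : Fin 7}
    (h : Relation.ReflTransGen (PropagationStep G) L L') (hv : ∀ t, L (v t) = {col k t})
    (hN : ∀ t u, G.Adj u (v t) → col k t ∉ L u) (t : Fin 7) : L' (v t) = {col k t} := by
  induction h with
  | refl => exact hv t
  | tail hL hstep ih =>
    obtain ⟨-, x, i, hx, h1, h2⟩ := hstep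
    by_cases hxt : G.Adj x (v t)
    · rw [h1 _ hxt, ih]
      refine Finset.erase_eq_of_notMem fun hi => ?_
      rw [Finset.mem_singleton] at hi
      have := subset_of_propagation hL x (by rw [hx]; exact Finset.mem_singleton_self i)
      exact hN t x hxt (hi ▸ this)
    · rw [h2 _ hxt, ih]

theorem propagated_of_startLists {c : V → Option (Fin 4)} {k : Fin 7}
    (hc : ∀ t, c (v t) = some (col k t)) {L : V → Finset (Fin 4)}
    (hL : IsStep3 G (startLists v c k) L) : Propagated v (col k) L := by
  refine ⟨antihole_of_propagation hL.1 (fun t => ?_) fun t u hu hmem => ?_,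
    fun x m w hx hxw => hL.notMem hx hxw⟩
  · refine Finset.eq_singleton_iff_unique_mem.2 ⟨mem_startLists.2 ⟨fun d hd => ?_, fun s ht => ?_⟩,
      fun d hd => ((mem_startLists.1 hd).1 _ (hc _)).symm⟩
    · rw [hc] at hd
      exact (Option.some_injective _ hd).symm
    · exact (col_ne ((adj_antihole v _ _).1 ht)).symm
  · exact (mem_startLists.1 hmem).2 t hu rfl

/-- The vertices coloured in Step 2 have two neighbours in the antihole. -/
theorem IsStep1.initLists_eq_univ {r : Fin 7 → Option V} (hr : IsStep1 G v r)
    {c : V → Option (Fin 4)} (hc : IsColoringOf G (setCR G v r) c) {J : Option (Fin 7)} {y : V}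
    (hy : Weak v J y) : initLists c y = Finset.univ := by
  have hy' := hy.not_hasPair
  have hnot : y ∉ setCR G v r := by
    rintro (⟨t, rfl⟩ | ⟨i, hi⟩)
    · exact hy' (hasPair_antihole v t)
    · exact hy' (mem_setS_iff.1 ((hr i).2 y hi).1.1).2.1
  have : c y = none := by
    have := mt (hc.1 y).1 hnot
    simpa using this
  rw [initLists, this]

end StartLists

/-! ### A run of the algorithm -/

section Iteration

variable (J : Instance) (k : Fin 7) (w : Fin 7 → Fin 4)

/-- The colouring of Step 2 with the parameters `k` and `w`. -/
noncomputable def chosenColouring : Fin J.n → Option (Fin 4) := extendCol J.v (chosenVertex J) k w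

/-- The lists after Step 3. -/
noncomputable def finalLists : Fin J.n → Finset (Fin 4) :=
  (propagate J.G)^[4 * J.n] (startLists J.v (chosenColouring J k w) k)

open Classical in
/-- The sets `Q(x)` of Step 4. -/
noncomputable def excludedColours (x : Fin J.n) : Finset (Fin 4) :=
  Finset.univ.filter fun i => i ∈ finalLists J k w x ∧ ¬ Test4 J.G (finalLists J k w) x i

open Classical in
/-- The sets `Q(x, y)` of Step 5. -/
noncomputable def excludedPairs (x y : Fin J.n) : Finset (Fin 4 × Fin 4) :=
  Finset.univ.filter fun p => x ≠ y ∧ p.1 ∈ finalLists J k w x ∧ p.2 ∈ finalLists J k w y ∧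
    p.1 ≠ p.2 ∧ ¬ Test5 J.G (finalLists J k w) x y p.1 p.2

open Classical in
/-- The iteration of Steps 2-6 with the parameters `k` and `w`. -/
noncomputable def iteration : Iteration (Fin J.n) where
  c := chosenColouring J k w
  L := finalLists J k w
  Q₁ := excludedColours J k w
  Q₂ := excludedPairs J k w
  passed := decide (Test6 J.G J.v (finalLists J k w) (excludedColours J k w) (excludedPairs J k w))

variable {J k w}

theorem isColoringOf_chosenColouring (hw : ValidCol J.v (chosenVertex J) k w) :
    IsColoringOf J.G (setCR J.G J.v (chosenVertex J)) (chosenColouring J k w) :=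
  isColoringOf_extendCol (isStep1_chosenVertex J) hw

theorem propagated_finalLists : Propagated J.v (col k) (finalLists J k w) :=
  propagated_of_startLists (extendCol_antihole _ k w) (isStep3_iterate_propagate _)

theorem isStep3_finalLists : IsStep3 J.G (initLists (chosenColouring J k w)) (finalLists J k w) :=
  ⟨(reflTransGen_startLists (extendCol_antihole _ k w)).trans (isStep3_iterate_propagate _).1,
    (isStep3_iterate_propagate _).2⟩

theorem test4_finalLists_iff (hw : ValidCol J.v (chosenVertex J) k w) {x : Fin J.n} {i : Fin 4} :
    Test4 J.G (finalLists J k w) x i ↔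
    ∃ f : Fin J.n → Fin 4, (∀ y, CoreColour J.G (finalLists J k w) i x y (f y)) ∧
      ∀ a b, ¬ CoreConflict J.G (finalLists J k w) i x a (f a) b (f b) := by
  refine ⟨exists_coreColour_of_test4, fun ⟨f, hf, hfa⟩ => ?_⟩
  exact test4_of_exists_coreColour (propagated_finalLists)
    (noP6_of_not_isIndContained J.adm.P6_free) (noC5_of_not_isIndContained J.adm.C5_free)
    J.adm.clean.no_K5 (fun v x hx => (J.adm.clean.antihole v).no_complete ⟨x, hx⟩)
    (fun _ _ hy => (isStep1_chosenVertex J).initLists_eq_univ (isColoringOf_chosenColouring hw) hy)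
    isStep3_finalLists.1 hf hfa

theorem isIteration_iteration (hw : ValidCol J.v (chosenVertex J) k w) :
    IsIteration J.G J.v (chosenVertex J) (iteration J k w) where
  step2 := isColoringOf_chosenColouring hw
  step3 := isStep3_finalLists
  step4 x i := by simp [iteration, excludedColours]
  step5 x y i j := by simp [iteration, excludedPairs]
  step6 := by simp [iteration]

end Iteration

section Run

variable (J : Instance)

open Classical in
/-- The parameters of the iterations, in a fixed order. -/
noncomputable def parameters : List (Fin 7 × (Fin 7 → Fin 4)) :=
  Finset.univ.toList.filter fun p => ValidCol J.v (chosenVertex J) p.1 p.2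

/-- The run of the algorithm that tries all colourings. -/
noncomputable def fullRun : Run (Fin J.n) where
  r := chosenVertex J
  iterations := (parameters J).map fun p => iteration J p.1 p.2
  answer := (parameters J).any fun p => (iteration J p.1 p.2).passed

theorem mem_parameters {J : Instance} {p : Fin 7 × (Fin 7 → Fin 4)} :
    p ∈ parameters J ↔ ValidCol J.v (chosenVertex J) p.1 p.2 := by
  simp [parameters]

theorem nodup_parameters : (parameters J).Nodup := (Finset.nodup_toList _).filter _

theorem length_iterations_fullRun : (fullRun J).iterations.length ≤ 7 * 2 ^ 6 := by
  classical
  refine le_trans (le_of_eq ?_) (card_validCols_le (isStep1_chosenVertex J))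
  rw [fullRun, List.length_map, ← List.toFinset_card_of_nodup (nodup_parameters J)]
  congr 1
  ext p
  simp [mem_parameters, validCols]

theorem isRun_fullRun : IsRun J.G J.v (fullRun J) where
  step1 := isStep1_chosenVertex J
  iteration it hit := by
    obtain ⟨p, hp, rfl⟩ := List.mem_map.1 hit
    exact isIteration_iteration (mem_parameters.1 hp)
  distinct := by
    refine List.pairwise_map.2 ((nodup_parameters J).imp_of_mem ?_)
    intro p q hp hq hne h
    refine hne ?_
    obtain ⟨h1, h2⟩ := eq_of_sameUpToColors (isStep1_chosenVertex J) (mem_parameters.1 hp)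
      (mem_parameters.1 hq) h
    exact Prod.ext h1 h2
  answer := by simp [fullRun]
  exhaustive _ c hc := by
    obtain ⟨k, w, hw, h⟩ := exists_validCol (isStep1_chosenVertex J) hc
    exact ⟨_, List.mem_map.2 ⟨(k, w), mem_parameters.2 hw, rfl⟩, h⟩

end Run

/-! ### Computing the colourings and the lists -/

section Colouring

variable {Γ : Type} {e : Γ → Data} {I : Γ → Instance} {x y : ∀ γ, Fin (I γ).n}

theorem Dec.exVertex (hI : Poly e fun γ => encodeInst (I γ)) {p : ∀ γ, Fin (I γ).n → Prop}
    (h : Dec (ext e fun γ => (I γ).n) fun q => p q.1 q.2) : Dec e fun γ => ∃ x, p γ x :=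
  Dec.ex (Poly.order hI) h

theorem Dec.allVertex (hI : Poly e fun γ => encodeInst (I γ)) {p : ∀ γ, Fin (I γ).n → Prop}
    (h : Dec (ext e fun γ => (I γ).n) fun q => p q.1 q.2) : Dec e fun γ => ∀ x, p γ x :=
  Dec.all (Poly.order hI) h

theorem Dec.chosenVertex (hI : Poly e fun γ => encodeInst (I γ))
    (hx : Poly e fun γ => encodeNat (x γ))
    (i : Fin 7) : Dec e fun γ => chosenVertex (I γ) i = some (x γ) :=
  Dec.eqSome (Poly.lookupConst (Poly.chosenVertex hI) i) hx

theorem Dec.validCol (hI : Poly e fun γ => encodeInst (I γ)) (k : Fin 7) (w : Fin 7 → Fin 4) :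
    Dec e fun γ => ValidCol (I γ).v (PhaseTwo.chosenVertex (I γ)) k w := by
  have hI' : Poly (ext e fun γ => (I γ).n) fun p => encodeInst (I p.1) := hI.lift
  have hx : Poly (ext e fun γ => (I γ).n) fun p => encodeNat p.2 := Poly.var _ _
  have hI'' : Poly (ext (ext e fun γ => (I γ).n) fun p => (I p.1).n)
      fun p => encodeInst (I p.1.1) := hI'.lift
  have hx' : Poly (ext (ext e fun γ => (I γ).n) fun p => (I p.1).n) fun p => encodeNat p.1.2 :=
    hx.lift
  have hy : Poly (ext (ext e fun γ => (I γ).n) fun p => (I p.1).n) fun p => encodeNat p.2 :=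
    Poly.var _ _
  have h1 : Dec e fun γ => ∀ i, PhaseTwo.chosenVertex (I γ) i = none → w i = 0 :=
    Dec.allFixed fun i => (Dec.eqNone (Poly.lookupConst (Poly.chosenVertex hI) i)).imp
      (Dec.const e _)
  have h2 : Dec e fun γ => ∀ i x, PhaseTwo.chosenVertex (I γ) i = some x →
      ∀ t, (I γ).G.Adj x ((I γ).v t) → w i ≠ col k t :=
    Dec.allFixed fun i => Dec.allVertex hI ((Dec.chosenVertex hI' hx i).imp
      (Dec.allFixed fun t => (Dec.trace hI' hx t).imp (Dec.const _ _)))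
  have h3 : Dec e fun γ => ∀ i j x, PhaseTwo.chosenVertex (I γ) i = some x →
      PhaseTwo.chosenVertex (I γ) j = some x → w i = w j :=
    Dec.allFixed fun i => Dec.allFixed fun j => Dec.allVertex hI ((Dec.chosenVertex hI' hx i).imp
      ((Dec.chosenVertex hI' hx j).imp (Dec.const _ _)))
  have h4 : Dec e fun γ => ∀ i j x y, PhaseTwo.chosenVertex (I γ) i = some x →
      PhaseTwo.chosenVertex (I γ) j = some y → (I γ).G.Adj x y → w i ≠ w j :=
    Dec.allFixed fun i => Dec.allFixed fun j => Dec.allVertex hI (Dec.allVertex hI'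
      ((Dec.chosenVertex hI'' hx' i).imp ((Dec.chosenVertex hI'' hy j).imp
        ((Dec.adj hI'' hx' hy).imp (Dec.const _ _)))))
  exact (h1.and (h2.and (h3.and h4))).congr fun γ =>
    ⟨fun h => ⟨h.1, h.2.1, h.2.2.1, h.2.2.2⟩, fun h => ⟨h.none, h.antihole, h.same, h.adj⟩⟩

variable {k : Fin 7} {w : Fin 7 → Fin 4}

theorem chosenColouring_eq_some_iff {J : Instance} (hw : ValidCol J.v (chosenVertex J) k w)
    {x : Fin J.n} {m : Fin 4} : chosenColouring J k w x = some m ↔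
      (∃ t, x = J.v t ∧ col k t = m) ∨ ∃ i, chosenVertex J i = some x ∧ w i = m := by
  constructor
  · intro h
    have hx : x ∈ setCR J.G J.v (chosenVertex J) := by
      by_contra hx
      rw [chosenColouring, extendCol_none hx] at h
      simp at h
    rcases hx with ⟨t, rfl⟩ | ⟨i, hi⟩
    · rw [chosenColouring, extendCol_antihole] at h
      exact Or.inl ⟨t, rfl, Option.some_injective _ h⟩
    · rw [chosenColouring, extendCol_some (isStep1_chosenVertex J) hw hi] at h
      exact Or.inr ⟨i, hi, Option.some_injective _ h⟩
  · rintro (⟨t, rfl, rfl⟩ | ⟨i, hi, rfl⟩)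
    · exact extendCol_antihole _ _ _ _
    · exact extendCol_some (isStep1_chosenVertex J) hw hi

theorem Dec.chosenColouring (hI : Poly e fun γ => encodeInst (I γ))
    (hw : ∀ γ, ValidCol (I γ).v (PhaseTwo.chosenVertex (I γ)) k w)
    (hx : Poly e fun γ => encodeNat (x γ)) (m : Fin 4) :
    Dec e fun γ => chosenColouring (I γ) k w (x γ) = some m := by
  have h1 : Dec e fun γ => ∃ t, x γ = (I γ).v t ∧ col k t = m :=
    Dec.exFixed fun t => (Dec.eqAntihole hI hx t).and (Dec.const _ _)
  have h2 : Dec e fun γ => ∃ i, PhaseTwo.chosenVertex (I γ) i = some (x γ) ∧ w i = m :=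
    Dec.exFixed fun i => (Dec.chosenVertex hI hx i).and (Dec.const _ _)
  exact (h1.or h2).congr fun γ => (chosenColouring_eq_some_iff (hw γ)).symm

theorem Poly.optionColour {o : Γ → Option (Fin 4)} (h : ∀ m, Dec e fun γ => o γ = some m) :
    Poly e fun γ => encodeOption (fun i : Fin 4 => encodeNat i) (o γ) := by
  classical
  have key : ∀ l : List (Fin 4), Poly e fun γ =>
      if o γ ∈ l.map some then encodeOption (fun i : Fin 4 => encodeNat i) (o γ) else .leaf := by
    intro l
    induction l with
    | nil => simpa using Poly.leaf e
    | cons a l ih =>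
      have := Poly.ite (h a)
        (Poly.const e (encodeOption (fun i : Fin 4 => encodeNat i) (some a))) ih
      convert this using 2 with γ
      by_cases ha : o γ = some a
      · simp [ha]
      · simp [ha]
  convert key (List.finRange 4) using 2 with γ
  cases o γ <;> simp [encodeOption]

theorem Poly.chosenColouring (hI : Poly e fun γ => encodeInst (I γ))
    (hw : ∀ γ, ValidCol (I γ).v (PhaseTwo.chosenVertex (I γ)) k w) :
    Poly e fun γ => encodeFun fun x =>
      encodeOption (fun i : Fin 4 => encodeNat i) (chosenColouring (I γ) k w x) := by
  have hI' : Poly (ext e fun γ => (I γ).n) fun p => encodeInst (I p.1) := hI.lift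
  have hx : Poly (ext e fun γ => (I γ).n) fun p => encodeNat p.2 := Poly.var _ _
  exact Poly.tabulate (Poly.order hI) (Poly.optionColour fun m =>
    Dec.chosenColouring hI' (fun p => hw p.1) hx m)

end Colouring

section Lists

variable {Γ : Type} {e : Γ → Data} {I : Γ → Instance} {x y : ∀ γ, Fin (I γ).n}
  {k : Fin 7} {w : Fin 7 → Fin 4} {L : ∀ γ, Fin (I γ).n → Finset (Fin 4)}

theorem Poly.startLists (hI : Poly e fun γ => encodeInst (I γ))
    (hw : ∀ γ, ValidCol (I γ).v (PhaseTwo.chosenVertex (I γ)) k w) :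
    Poly e fun γ => encodeFun fun x =>
      encodeColors (startLists (I γ).v (PhaseTwo.chosenColouring (I γ) k w) k x) := by
  have hI' : Poly (ext e fun γ => (I γ).n) fun p => encodeInst (I p.1) := hI.lift
  have hx : Poly (ext e fun γ => (I γ).n) fun p => encodeNat p.2 := Poly.var _ _
  refine Poly.colorTable (Poly.order hI) fun d => ?_
  have h1 : Dec (ext e fun γ => (I γ).n) fun p =>
      ∀ m, PhaseTwo.chosenColouring (I p.1) k w p.2 = some m → m = d :=
    Dec.allFixed fun m => (Dec.chosenColouring hI' (fun p => hw p.1) hx m).imp (Dec.const _ _)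
  have h2 : Dec (ext e fun γ => (I γ).n) fun p =>
      ∀ t, (I p.1).G.Adj p.2 ((I p.1).v t) → col k t ≠ d :=
    Dec.allFixed fun t => (Dec.trace hI' hx t).imp (Dec.const _ _)
  exact (h1.and h2).congr fun p => mem_startLists.symm

theorem Dec.list_eq_singleton (hL : Poly e fun γ => encodeFun fun x => encodeColors (L γ x))
    (hx : Poly e fun γ => encodeNat (x γ)) (m : Fin 4) : Dec e fun γ => L γ (x γ) = {m} :=
  (Dec.allFixed fun d => (Dec.mem_table hL hx d).iff (Dec.const e (d = m))).congr fun γ => by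
    simp [Finset.ext_iff]

theorem Dec.active (hI : Poly e fun γ => encodeInst (I γ))
    (hL : Poly e fun γ => encodeFun fun x => encodeColors (L γ x))
    (hx : Poly e fun γ => encodeNat (x γ)) : Dec e fun γ => Active (I γ).G (L γ) (x γ) := by
  have hI' : Poly (ext e fun γ => (I γ).n) fun p => encodeInst (I p.1) := hI.lift
  have hx' : Poly (ext e fun γ => (I γ).n) fun p => encodeNat (x p.1) := hx.lift
  have hy : Poly (ext e fun γ => (I γ).n) fun p => encodeNat p.2 := Poly.var _ _
  have hL' : Poly (ext e fun γ => (I γ).n) fun p => encodeFun fun x => encodeColors (L p.1 x) :=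
    hL.lift
  exact Dec.exFixed fun m => (Dec.list_eq_singleton hL hx m).and (Dec.exVertex hI
    ((Dec.adj hI' hx' hy).and (Dec.mem_table hL' hy m)))

theorem Dec.mem_propagate (hI : Poly e fun γ => encodeInst (I γ))
    (hL : Poly e fun γ => encodeFun fun x => encodeColors (L γ x))
    (hx : Poly e fun γ => encodeNat (x γ)) (d : Fin 4) :
    Dec e fun γ => d ∈ propagate (I γ).G (L γ) (x γ) := by
  have hI' : Poly (ext e fun γ => (I γ).n) fun p => encodeInst (I p.1) := hI.lift
  have hx' : Poly (ext e fun γ => (I γ).n) fun p => encodeNat (x p.1) := hx.lift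
  have hu : Poly (ext e fun γ => (I γ).n) fun p => encodeNat p.2 := Poly.var _ _
  have hL' : Poly (ext e fun γ => (I γ).n) fun p => encodeFun fun x => encodeColors (L p.1 x) :=
    hL.lift
  have hfirst : Poly e fun γ => encodeOption (fun x => encodeNat x.val)
      (PhaseTwo.firstIndex (Active (I γ).G (L γ))) :=
    Poly.firstIndex (Poly.order hI) (Dec.active hI' hL' hu)
  have hfirst' : Poly (ext e fun γ => (I γ).n) fun p => encodeOption (fun x => encodeNat x.val)
      (PhaseTwo.firstIndex (Active (I p.1).G (L p.1))) := hfirst.lift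
  have h1 := Dec.exVertex hI (p := fun γ u => PhaseTwo.firstIndex (Active (I γ).G (L γ)) = some u ∧
    (I γ).G.Adj u (x γ) ∧ L γ u = {d}) ((Dec.eqSome hfirst' hu).and ((Dec.adj hI' hu hx').and
      (Dec.list_eq_singleton hL' hu d)))
  exact ((Dec.mem_table hL hx d).and h1.not).congr fun γ => PhaseTwo.mem_propagate.symm

theorem Poly.finalLists (hI : Poly e fun γ => encodeInst (I γ))
    (hw : ∀ γ, ValidCol (I γ).v (PhaseTwo.chosenVertex (I γ)) k w) :
    Poly e fun γ => encodeFun fun x => encodeColors (finalLists (I γ) k w x) := by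
  refine Poly.iterate_table (f := fun γ => propagate (I γ).G) (Poly.order hI)
    (Poly.four_mul (Poly.order hI)) (Poly.startLists hI hw) fun d => ?_
  have hI' : Poly (withTable e fun γ => (I γ).n) fun p => encodeInst (I p.1) := hI.weaken
  have hL : Poly (withTable e fun γ => (I γ).n) fun p => encodeFun fun x => encodeColors (p.2 x) :=
    (Poly.id _).snd
  have hI'' : Poly (ext (withTable e fun γ => (I γ).n) fun p => (I p.1).n)
      fun p => encodeInst (I p.1.1) := hI'.lift
  have hL' : Poly (ext (withTable e fun γ => (I γ).n) fun p => (I p.1).n)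
      fun p => encodeFun fun x => encodeColors (p.1.2 x) := hL.lift
  have hx : Poly (ext (withTable e fun γ => (I γ).n) fun p => (I p.1).n)
      fun p => encodeNat p.2 := Poly.var _ _
  exact Dec.mem_propagate hI'' hL' hx d

end Lists

/-! ### Computing the tests -/

section Tests

variable {Γ : Type} {e : Γ → Data} {I : Γ → Instance} {x y z : ∀ γ, Fin (I γ).n}
  {L : ∀ γ, Fin (I γ).n → Finset (Fin 4)}

theorem Dec.reduced (hI : Poly e fun γ => encodeInst (I γ))
    (hL : Poly e fun γ => encodeFun fun x => encodeColors (L γ x))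
    (hx : Poly e fun γ => encodeNat (x γ)) (hy : Poly e fun γ => encodeNat (y γ)) (i k : Fin 4) :
    Dec e fun γ => Reduced (I γ).G (L γ) i (x γ) (y γ) k := by
  have hI' : Poly (ext e fun γ => (I γ).n) fun p => encodeInst (I p.1) := hI.lift
  have hL' : Poly (ext e fun γ => (I γ).n) fun p => encodeFun fun x => encodeColors (L p.1 x) :=
    hL.lift
  have hx' : Poly (ext e fun γ => (I γ).n) fun p => encodeNat (x p.1) := hx.lift
  have hy' : Poly (ext e fun γ => (I γ).n) fun p => encodeNat (y p.1) := hy.lift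
  have hz : Poly (ext e fun γ => (I γ).n) fun p => encodeNat p.2 := Poly.var _ _
  have h1 : Dec (ext e fun γ => (I γ).n) fun p => (L p.1 p.2).erase i = {k} :=
    (Dec.allFixed fun d => ((Dec.const _ (d ≠ i)).and (Dec.mem_table hL' hz d)).iff
      (Dec.const _ (d = k))).congr fun p => by
        simp only [Finset.ext_iff, Finset.mem_erase, Finset.mem_singleton]
  exact (Dec.mem_table hL hy k).and ((Dec.const e (k ≠ i)).and (Dec.allVertex hI
    ((Dec.adj hI' hx' hz).imp ((Dec.adj hI' hz hy').imp h1.not))))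

theorem Dec.core (hI : Poly e fun γ => encodeInst (I γ))
    (hL : Poly e fun γ => encodeFun fun x => encodeColors (L γ x))
    (hx : Poly e fun γ => encodeNat (x γ)) (hy : Poly e fun γ => encodeNat (y γ)) (i : Fin 4) :
    Dec e fun γ => Core (I γ).G (L γ) i (x γ) (y γ) := by
  have h1 : Dec e fun γ => Free (I γ).G (L γ) i (x γ) (y γ) :=
    (Dec.adj hI hx hy).and (Dec.allFixed fun k => (Dec.const e (k ≠ i)).imp
      (Dec.reduced hI hL hx hy i k))
  exact (Dec.adj hI hx hy).and h1.not

theorem Dec.diamond (hI : Poly e fun γ => encodeInst (I γ))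
    (hx : Poly e fun γ => encodeNat (x γ)) (hy : Poly e fun γ => encodeNat (y γ))
    (hz : Poly e fun γ => encodeNat (z γ)) :
    Dec e fun γ => Diamond (I γ).G (x γ) (y γ) (z γ) := by
  have hI' : Poly (ext e fun γ => (I γ).n) fun p => encodeInst (I p.1) := hI.lift
  have hp : Poly (ext e fun γ => (I γ).n) fun p => encodeNat p.2 := Poly.var _ _
  have hI'' : Poly (ext (ext e fun γ => (I γ).n) fun p => (I p.1).n)
      fun p => encodeInst (I p.1.1) := hI'.lift
  have hp' : Poly (ext (ext e fun γ => (I γ).n) fun p => (I p.1).n) fun p => encodeNat p.1.2 :=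
    hp.lift
  have hq : Poly (ext (ext e fun γ => (I γ).n) fun p => (I p.1).n) fun p => encodeNat p.2 :=
    Poly.var _ _
  have hx' : Poly (ext (ext e fun γ => (I γ).n) fun p => (I p.1).n) fun p => encodeNat (x p.1.1) :=
    (hx.lift (n := fun γ => (I γ).n)).lift
  have hy' : Poly (ext (ext e fun γ => (I γ).n) fun p => (I p.1).n) fun p => encodeNat (y p.1.1) :=
    (hy.lift (n := fun γ => (I γ).n)).lift
  have hz' : Poly (ext (ext e fun γ => (I γ).n) fun p => (I p.1).n) fun p => encodeNat (z p.1.1) :=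
    (hz.lift (n := fun γ => (I γ).n)).lift
  exact Dec.exVertex hI (Dec.exVertex hI' ((Dec.adj hI'' hx' hp').and ((Dec.adj hI'' hx' hq).and
    ((Dec.adj hI'' hp' hq).and ((Dec.adj hI'' hy' hp').and ((Dec.adj hI'' hy' hq).and
      ((Dec.adj hI'' hz' hp').and (Dec.adj hI'' hz' hq))))))))

theorem Dec.exists_coreColour (hI : Poly e fun γ => encodeInst (I γ))
    (hL : Poly e fun γ => encodeFun fun x => encodeColors (L γ x))
    (hx : Poly e fun γ => encodeNat (x γ)) (i : Fin 4) :
    Dec e fun γ => ∃ f : Fin (I γ).n → Fin 4,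
      (∀ y, CoreColour (I γ).G (L γ) i (x γ) y (f y)) ∧
        ∀ a b, ¬ CoreConflict (I γ).G (L γ) i (x γ) a (f a) b (f b) := by
  have hI' : Poly (ext e fun γ => (I γ).n) fun p => encodeInst (I p.1) := hI.lift
  have hL' : Poly (ext e fun γ => (I γ).n) fun p => encodeFun fun x => encodeColors (L p.1 x) :=
    hL.lift
  have hx' : Poly (ext e fun γ => (I γ).n) fun p => encodeNat (x p.1) := hx.lift
  have hy : Poly (ext e fun γ => (I γ).n) fun p => encodeNat p.2 := Poly.var _ _
  have hI'' : Poly (ext (ext e fun γ => (I γ).n) fun p => (I p.1).n)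
      fun p => encodeInst (I p.1.1) := hI'.lift
  have hL'' : Poly (ext (ext e fun γ => (I γ).n) fun p => (I p.1).n)
      fun p => encodeFun fun x => encodeColors (L p.1.1 x) := hL'.lift
  have hx'' : Poly (ext (ext e fun γ => (I γ).n) fun p => (I p.1).n)
      fun p => encodeNat (x p.1.1) := hx'.lift
  have ha : Poly (ext (ext e fun γ => (I γ).n) fun p => (I p.1).n) fun p => encodeNat p.1.2 :=
    hy.lift
  have hb : Poly (ext (ext e fun γ => (I γ).n) fun p => (I p.1).n) fun p => encodeNat p.2 :=
    Poly.var _ _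
  refine Dec.binary_constraints (Poly.order hI)
    (M := fun γ y c => CoreColour (I γ).G (L γ) i (x γ) y c)
    (conf := fun γ => CoreConflict (I γ).G (L γ) i (x γ))
    (fun c => ?_) (fun c d => ?_) (fun γ => exists_two_coreColour _ _ _ _)
    (fun γ _ _ _ _ => coreConflict_symm)
  · exact ((Dec.core hI' hL' hx' hy i).and (Dec.reduced hI' hL' hx' hy i c)).or
      ((Dec.core hI' hL' hx' hy i).not.and (Dec.const _ _))
  · exact (Dec.core hI'' hL'' hx'' ha i).and ((Dec.core hI'' hL'' hx'' hb i).and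
      (((Dec.adj hI'' ha hb).and (Dec.const _ _)).or
        ((Dec.diamond hI'' hx'' ha hb).and (Dec.const _ _))))

/-- A constraint problem on `U` is one on all vertices, with the value `0` outside `U`. -/
theorem exists_dummy_iff {V : Type} {U : V → Prop} {M : V → Fin 4 → Prop}
    {conf : V → Fin 4 → V → Fin 4 → Prop} :
    (∃ f : V → Fin 4, (∀ x, (U x ∧ M x (f x)) ∨ (¬ U x ∧ f x = 0)) ∧
      ∀ x y, ¬ (U x ∧ U y ∧ conf x (f x) y (f y))) ↔
    ∃ f : V → Fin 4, (∀ x, U x → M x (f x)) ∧ ∀ x y, U x → U y → ¬ conf x (f x) y (f y) := by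
  classical
  constructor
  · rintro ⟨f, hf, hc⟩
    refine ⟨f, fun x hx => ?_, fun x y hx hy h => hc x y ⟨hx, hy, h⟩⟩
    rcases hf x with h | h
    exacts [h.2, (h.1 hx).elim]
  · rintro ⟨f, hf, hc⟩
    refine ⟨fun x => if U x then f x else 0, fun x => ?_, fun x y ⟨hx, hy, h⟩ => ?_⟩
    · by_cases hx : U x
      · simp [hx, hf x hx]
      · simp [hx]
    · simp only [hx, hy, if_true] at h
      exact hc x y hx hy h

/-- The binary constraint problem on the vertices with the property `U`. -/
theorem Dec.constraints_on (hI : Poly e fun γ => encodeInst (I γ))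
    {U : ∀ γ, Fin (I γ).n → Prop} {M : ∀ γ, Fin (I γ).n → Fin 4 → Prop}
    {conf : ∀ γ, Fin (I γ).n → Fin 4 → Fin (I γ).n → Fin 4 → Prop}
    (hU : Dec (ext e fun γ => (I γ).n) fun p => U p.1 p.2)
    (hM : ∀ c, Dec (ext e fun γ => (I γ).n) fun p => M p.1 p.2 c)
    (hconf : ∀ c d, Dec (ext (ext e fun γ => (I γ).n) fun p => (I p.1).n)
      fun p => conf p.1.1 p.1.2 c p.2 d)
    (two : ∀ γ x, U γ x → ∃ i j, ∀ c, M γ x c → c = i ∨ c = j)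
    (symm : ∀ γ x c y d, conf γ x c y d → conf γ y d x c) :
    Dec e fun γ => ∃ f : Fin (I γ).n → Fin 4, (∀ x, U γ x → M γ x (f x)) ∧
      ∀ x y, U γ x → U γ y → ¬ conf γ x (f x) y (f y) := by
  refine (Dec.binary_constraints (Poly.order hI)
    (M := fun γ x c => (U γ x ∧ M γ x c) ∨ (¬ U γ x ∧ c = 0))
    (conf := fun γ x c y d => U γ x ∧ U γ y ∧ conf γ x c y d) (fun c => ?_) (fun c d => ?_) ?_
    fun γ x c y d h => ⟨h.2.1, h.1, symm γ x c y d h.2.2⟩).congr fun γ => exists_dummy_iff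
  · exact (hU.and (hM c)).or (hU.not.and (Dec.const _ _))
  · have h1 : Dec (ext (ext e fun γ => (I γ).n) fun p => (I p.1).n) fun p => U p.1.1 p.1.2 :=
      hU.lift
    have hb : Poly (ext (ext e fun γ => (I γ).n) fun p => (I p.1).n) fun p => encodeNat p.2 :=
      Poly.var _ _
    have hg : Poly (ext (ext e fun γ => (I γ).n) fun p => (I p.1).n) fun p => e p.1.1 :=
      (Poly.base e fun γ => (I γ).n).lift
    have h2 : Dec (ext (ext e fun γ => (I γ).n) fun p => (I p.1).n) fun p => U p.1.1 p.2 :=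
      Dec.subst (p := U) hU hg hb
    exact h1.and (h2.and (hconf c d))
  · intro γ x
    by_cases hx : U γ x
    · obtain ⟨i, j, h⟩ := two γ x hx
      refine ⟨i, j, fun c hc => ?_⟩
      rcases hc with hc | hc
      exacts [h c hc.2, (hc.1 hx).elim]
    · refine ⟨0, 0, fun c hc => ?_⟩
      rcases hc with hc | hc
      exacts [(hx hc.1).elim, Or.inl hc.2]

/-- Without the colours `i` and `j`, only two colours are left. -/
theorem Dec.test5 (hI : Poly e fun γ => encodeInst (I γ))
    (hL : Poly e fun γ => encodeFun fun x => encodeColors (L γ x))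
    (hx : Poly e fun γ => encodeNat (x γ)) (hy : Poly e fun γ => encodeNat (y γ)) {i j : Fin 4}
    (hij : i ≠ j) : Dec e fun γ => Test5 (I γ).G (L γ) (x γ) (y γ) i j := by
  have hI' : Poly (ext e fun γ => (I γ).n) fun p => encodeInst (I p.1) := hI.lift
  have hL' : Poly (ext e fun γ => (I γ).n) fun p => encodeFun fun x => encodeColors (L p.1 x) :=
    hL.lift
  have hx' : Poly (ext e fun γ => (I γ).n) fun p => encodeNat (x p.1) := hx.lift
  have hy' : Poly (ext e fun γ => (I γ).n) fun p => encodeNat (y p.1) := hy.lift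
  have hz : Poly (ext e fun γ => (I γ).n) fun p => encodeNat p.2 := Poly.var _ _
  have hI'' : Poly (ext (ext e fun γ => (I γ).n) fun p => (I p.1).n)
      fun p => encodeInst (I p.1.1) := hI'.lift
  have ha : Poly (ext (ext e fun γ => (I γ).n) fun p => (I p.1).n) fun p => encodeNat p.1.2 :=
    hz.lift
  have hb : Poly (ext (ext e fun γ => (I γ).n) fun p => (I p.1).n) fun p => encodeNat p.2 :=
    Poly.var _ _
  refine (Dec.constraints_on hI
    (U := fun γ a => a ∈ (I γ).G.neighborSet (x γ) ∩ (I γ).G.neighborSet (y γ))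
    (M := fun γ a c => c ∈ L γ a \ {i, j})
    (conf := fun γ a c b d => (I γ).G.Adj a b ∧ c = d)
    ((Dec.adj hI' hx' hz).and (Dec.adj hI' hy' hz)) (fun c => ?_)
    (fun c d => (Dec.adj hI'' ha hb).and (Dec.const _ _)) (fun γ a _ => ?_)
    fun γ a c b d h => ⟨h.1.symm, h.2.symm⟩).congr fun γ => ?_
  · exact ((Dec.mem_table hL' hz c).and (Dec.const _ (c ∉ ({i, j} : Finset (Fin 4))))).congr
      fun p => Finset.mem_sdiff.symm
  · obtain ⟨k, l, h⟩ := sdiff_pair_subset i j hij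
    exact ⟨k, l, fun c hc => by simpa using h _ hc⟩
  · refine exists_congr fun f => and_congr Iff.rfl ?_
    exact ⟨fun h a ha b hb hab heq => h a b ha hb ⟨hab, heq⟩,
      fun h a b ha hb hab => h a ha b hb hab.1 hab.2⟩

end Tests

section Exclusions

variable {Γ : Type} {e : Γ → Data} {I : Γ → Instance} {x y : ∀ γ, Fin (I γ).n}
  {k : Fin 7} {w : Fin 7 → Fin 4}

theorem Dec.mem_excludedColours (hI : Poly e fun γ => encodeInst (I γ))
    (hw : ∀ γ, ValidCol (I γ).v (PhaseTwo.chosenVertex (I γ)) k w)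
    (hx : Poly e fun γ => encodeNat (x γ))
    (i : Fin 4) : Dec e fun γ => i ∈ excludedColours (I γ) k w (x γ) :=
  ((Dec.mem_table (Poly.finalLists hI hw) hx i).and
    (Dec.exists_coreColour hI (Poly.finalLists hI hw) hx i).not).congr fun γ => by
      simp [excludedColours, test4_finalLists_iff (hw γ)]

theorem Dec.mem_excludedPairs (hI : Poly e fun γ => encodeInst (I γ))
    (hw : ∀ γ, ValidCol (I γ).v (PhaseTwo.chosenVertex (I γ)) k w)
    (hx : Poly e fun γ => encodeNat (x γ))
    (hy : Poly e fun γ => encodeNat (y γ)) (i j : Fin 4) :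
    Dec e fun γ => (i, j) ∈ excludedPairs (I γ) k w (x γ) (y γ) := by
  have hL := Poly.finalLists hI hw
  by_cases hij : i = j
  · exact (Dec.false e).congr fun γ => by simp [excludedPairs, hij]
  · exact ((Dec.eq hx hy).not.and ((Dec.mem_table hL hx i).and ((Dec.mem_table hL hy j).and
      (Dec.test5 hI hL hx hy hij).not))).congr fun γ => by simp [excludedPairs, hij]

theorem Dec.test6 (hI : Poly e fun γ => encodeInst (I γ))
    (hw : ∀ γ, ValidCol (I γ).v (PhaseTwo.chosenVertex (I γ)) k w) :
    Dec e fun γ => Test6 (I γ).G (I γ).v (finalLists (I γ) k w) (excludedColours (I γ) k w)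
      (excludedPairs (I γ) k w) := by
  have hI' : Poly (ext e fun γ => (I γ).n) fun p => encodeInst (I p.1) := hI.lift
  have hx : Poly (ext e fun γ => (I γ).n) fun p => encodeNat p.2 := Poly.var _ _
  have hI'' : Poly (ext (ext e fun γ => (I γ).n) fun p => (I p.1).n)
      fun p => encodeInst (I p.1.1) := hI'.lift
  have ha : Poly (ext (ext e fun γ => (I γ).n) fun p => (I p.1).n) fun p => encodeNat p.1.2 :=
    hx.lift
  have hb : Poly (ext (ext e fun γ => (I γ).n) fun p => (I p.1).n) fun p => encodeNat p.2 :=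
    Poly.var _ _
  refine (Dec.constraints_on hI
    (U := fun γ a => a ∈ setG' (I γ).G (I γ).v)
    (M := fun γ a c => c ∈ finalLists (I γ) k w a ∧ c ∉ excludedColours (I γ) k w a)
    (conf := fun γ a c b d => ((I γ).G.Adj a b ∧ c = d) ∨
      (a ≠ b ∧ ((c, d) ∈ excludedPairs (I γ) k w a b ∨ (d, c) ∈ excludedPairs (I γ) k w b a)))
    ((Dec.hasPair hI' hx).congr fun p => mem_setG'_iff.symm) (fun c => ?_) (fun c d => ?_)
    (fun γ a ha => ?_) fun γ a c b d h => ?_).congr fun γ => ?_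
  · exact (Dec.mem_table (Poly.finalLists hI' fun p => hw p.1) hx c).and
      (Dec.mem_excludedColours hI' (fun p => hw p.1) hx c).not
  · exact ((Dec.adj hI'' ha hb).and (Dec.const _ _)).or ((Dec.eq ha hb).not.and
      ((Dec.mem_excludedPairs hI'' (fun p => hw p.1.1) ha hb c d).or
        (Dec.mem_excludedPairs hI'' (fun p => hw p.1.1) hb ha d c)))
  · obtain ⟨i, j, h⟩ := (propagated_finalLists (J := I γ) (k := k) (w := w)).exists_subset_pair
      (noC5_of_not_isIndContained (I γ).adm.C5_free) (mem_setG'_iff.1 ha)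
    exact ⟨i, j, fun c hc => by simpa using h hc.1⟩
  · rcases h with h | h
    exacts [Or.inl ⟨h.1.symm, h.2.symm⟩, Or.inr ⟨h.1.symm, h.2.symm⟩]
  · constructor
    · rintro ⟨f, hf, hc⟩
      exact ⟨f, ⟨fun x hx => (hf x hx).1, fun x hx y hy hxy h => hc x y hx hy (Or.inl ⟨hxy, h⟩)⟩,
        fun x hx => (hf x hx).2, fun x hx y hy hxy h => hc x y hx hy (Or.inr ⟨hxy, Or.inl h⟩)⟩
    · rintro ⟨f, ⟨hf, hc⟩, h1, h2⟩
      refine ⟨f, fun x hx => ⟨hf x hx, h1 x hx⟩, fun x y hx hy h => ?_⟩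
      rcases h with h | ⟨hne, h | h⟩
      exacts [hc x hx y hy h.1 h.2, h2 x hx y hy hne h, h2 y hy x hx hne.symm h]

end Exclusions

/-! ### The program -/

section Program

variable {Γ : Type} {e : Γ → Data} {I : Γ → Instance} {k : Fin 7} {w : Fin 7 → Fin 4}

theorem Poly.iteration (hI : Poly e fun γ => encodeInst (I γ))
    (hw : ∀ γ, ValidCol (I γ).v (PhaseTwo.chosenVertex (I γ)) k w) :
    Poly e fun γ => encodeIteration (iteration (I γ) k w) := by
  have hI' : Poly (ext e fun γ => (I γ).n) fun p => encodeInst (I p.1) := hI.lift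
  have hx : Poly (ext e fun γ => (I γ).n) fun p => encodeNat p.2 := Poly.var _ _
  have hI'' : Poly (ext (ext e fun γ => (I γ).n) fun p => (I p.1).n)
      fun p => encodeInst (I p.1.1) := hI'.lift
  have ha : Poly (ext (ext e fun γ => (I γ).n) fun p => (I p.1).n) fun p => encodeNat p.1.2 :=
    hx.lift
  have hb : Poly (ext (ext e fun γ => (I γ).n) fun p => (I p.1).n) fun p => encodeNat p.2 :=
    Poly.var _ _
  have h4 : Poly e fun γ => encodeFun fun x => encodeColors (excludedColours (I γ) k w x) :=
    Poly.colorTable (Poly.order hI) fun i => Dec.mem_excludedColours hI' (fun p => hw p.1) hx i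
  have h5 : Poly e fun γ => encodeFun fun x => encodeFun fun y =>
      encodePairs (excludedPairs (I γ) k w x y) :=
    Poly.tabulate (Poly.order hI) (d := fun γ x => encodeFun fun y =>
      encodePairs (excludedPairs (I γ) k w x y)) (Poly.tabulate (Poly.order hI')
        (d := fun p y => encodePairs (excludedPairs (I p.1) k w p.2 y))
        (Poly.encodeFunConst fun i => Poly.encodeFunConst fun j =>
          Poly.ofDec (Dec.mem_excludedPairs hI'' (fun p => hw p.1.1) ha hb i j)))
  exact (Poly.chosenColouring hI hw).node ((Poly.finalLists hI hw).node (h4.node (h5.node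
    ((Dec.test6 hI hw).node (Poly.leaf e)))))

open Classical in
/-- The program text enumerates a fixed list and selects the elements with the property `p`. -/
theorem Poly.filterMapConst {α : Type} (l : List α) {p : α → Γ → Prop} {d : α → Γ → Data}
    (hp : ∀ a, Dec e (p a)) (hd : ∀ a, Poly (fun γ : {γ // p a γ} => e γ) fun γ => d a γ) :
    Poly e fun γ => encodeList ((l.filter fun a => decide (p a γ)).map fun a => d a γ) := by
  induction l with
  | nil => exact Poly.leaf e
  | cons a l ih =>
    have ih' : Poly (fun γ : {γ // p a γ} => e γ) fun γ =>
      encodeList ((l.filter fun a => decide (p a γ)).map fun a => d a γ) := ih.reindex Subtype.val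
    have h1 := Poly.iteOn (hp a) (d := fun γ => .node (d a γ)
      (encodeList ((l.filter fun a => decide (p a γ)).map fun a => d a γ))) ((hd a).node ih') ih
    convert h1 using 2 with γ
    by_cases h : p a γ
    · rw [List.filter_cons_of_pos (by simpa using h), if_pos h]
      rfl
    · rw [List.filter_cons_of_neg (by simpa using h), if_neg h]

theorem Poly.iterations (hI : Poly e fun γ => encodeInst (I γ)) :
    Poly e fun γ => encodeList ((fullRun (I γ)).iterations.map encodeIteration) := by
  have key := Poly.filterMapConst (e := e) (α := Fin 7 × (Fin 7 → Fin 4)) Finset.univ.toList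
    (p := fun q γ => ValidCol (I γ).v (PhaseTwo.chosenVertex (I γ)) q.1 q.2)
    (d := fun q γ => encodeIteration (PhaseTwo.iteration (I γ) q.1 q.2))
    (fun q => Dec.validCol hI q.1 q.2) fun q => by
      have hI' : Poly (fun γ : {γ // ValidCol (I γ).v (PhaseTwo.chosenVertex (I γ)) q.1 q.2} => e γ)
        fun γ => encodeInst (I γ) := hI.reindex Subtype.val
      exact Poly.iteration hI' fun γ => γ.2
  convert key using 3 with γ
  rw [fullRun, List.map_map, parameters]
  rfl

theorem Dec.answer (hI : Poly e fun γ => encodeInst (I γ)) :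
    Dec e fun γ => (fullRun (I γ)).answer = Bool.true := by
  have h : ∀ p : Fin 7 × (Fin 7 → Fin 4), Dec e fun γ =>
      ValidCol (I γ).v (PhaseTwo.chosenVertex (I γ)) p.1 p.2 ∧
        Test6 (I γ).G (I γ).v (PhaseTwo.finalLists (I γ) p.1 p.2)
          (PhaseTwo.excludedColours (I γ) p.1 p.2) (PhaseTwo.excludedPairs (I γ) p.1 p.2) := by
    intro p
    have hI' : Poly (fun γ : {γ // ValidCol (I γ).v (PhaseTwo.chosenVertex (I γ)) p.1 p.2} => e γ)
      fun γ => encodeInst (I γ) := hI.reindex Subtype.val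
    exact (Dec.validCol hI p.1 p.2).andOn (Dec.test6 hI' fun γ => γ.2)
  refine (Dec.exFixed h).congr fun γ => ?_
  rw [fullRun, List.any_eq_true]
  simp [mem_parameters, PhaseTwo.iteration]

theorem Poly.fullRun (hI : Poly e fun γ => encodeInst (I γ)) :
    Poly e fun γ => encodeRun (fullRun (I γ)) := by
  have h : Poly e fun γ => encodeBool (PhaseTwo.fullRun (I γ)).answer := by
    convert Poly.ofDec (Dec.answer hI) using 3
    simp
  exact (Poly.chosenVertex hI).node ((Poly.iterations hI).node (h.node (Poly.leaf e)))

end Program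

theorem size_encodeInput_le : ∃ q : Polynomial ℕ, ∀ (n : ℕ) (G : SimpleGraph (Fin n))
    (v : Antihole G), (encodeInput G v).size ≤ q.eval n := by
  classical
  refine ⟨1 + (.X * ((.X * (3 + 1) + 1) + 1) + 1) + (7 * ((2 * .X + 1) + 1) + 1), fun n G v => ?_⟩
  have h1 : ∀ x y, (encodeBool (decide (G.Adj x y))).size ≤ 3 := fun x y => by
    cases decide (G.Adj x y) <;> simp [encodeBool, Data.size]
  have h2 := Poly.size_encodeFun_le (fun x => encodeFun fun y => encodeBool (decide (G.Adj x y))) _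
    fun x => Poly.size_encodeFun_le _ 3 (h1 x)
  have h3 := Poly.size_encodeFun_le (fun i : Fin 7 => encodeNat (v i)) (2 * n + 1) fun i => by
    rw [Poly.size_encodeNat]
    have := (v i).isLt
    omega
  simp only [Polynomial.eval_add, Polynomial.eval_mul, Polynomial.eval_X, Polynomial.eval_one,
    Polynomial.eval_ofNat]
  exact Nat.add_le_add (Nat.add_le_add_left h2 1) h3

end PhaseTwo

theorem mainTheorem7 :
    -- a single program carries out the algorithm in polynomial time
    (∃ (P : PhaseTwo.Prog) (p : Polynomial ℕ),
      ∀ (n : ℕ) (G : SimpleGraph (Fin n)) (v : PhaseTwo.Antihole G), PhaseTwo.IsAdmissible G →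
        ∃ (ρ : PhaseTwo.Run (Fin n)) (t : ℕ),
          PhaseTwo.IsRun G v ρ ∧ ρ.iterations.length ≤ 7 * 2 ^ 6 ∧ t ≤ p.eval n ∧
          PhaseTwo.Prog.Eval P (PhaseTwo.encodeInput G v) (PhaseTwo.encodeRun ρ) t) ∧
    ∀ (n : ℕ) (G : SimpleGraph (Fin n)) (v : PhaseTwo.Antihole G), PhaseTwo.IsAdmissible G →
      ∀ r : Fin 7 → Option (Fin n), PhaseTwo.IsStep1 G v r →
        -- up to permuting colours, there are at most `7 * 2 ^ 6` colourings of `G[C ∪ R]`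
        (∃ l : List (Fin n → Option (Fin 4)), l.length ≤ 7 * 2 ^ 6 ∧
          ∀ c, PhaseTwo.IsColoringOf G (PhaseTwo.setCR G v r) c →
            ∃ c' ∈ l, PhaseTwo.SameUpToColors c' c) ∧
        ∀ it : PhaseTwo.Iteration (Fin n), PhaseTwo.IsIteration G v r it →
          -- the tests of Step 4 are instances of list 3-colouring of `P₆`-free graphs
          (∀ (x : Fin n) (i : Fin 4),
            ¬ (SimpleGraph.pathGraph 6).IsIndContained (G.induce (G.neighborSet x)) ∧
            ∃ T : Finset (Fin 4), T.card = 3 ∧ ∀ w, it.L w \ {i} ⊆ T) ∧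
          -- the tests of Step 5 are 2SAT instances
          (∀ (x y : Fin n) (i j : Fin 4), x ≠ y → i ≠ j →
            (PhaseTwo.Test5 G it.L x y i j ↔
              (PhaseTwo.coloringFormula G (G.neighborSet x ∩ G.neighborSet y)
                (fun w => it.L w \ {i, j}) (fun _ => ∅) (fun _ _ => ∅)).Satisfiable)) ∧
          -- the test of Step 6 is a 2SAT instance
          (PhaseTwo.Test6 G v it.L it.Q₁ it.Q₂ ↔
            (PhaseTwo.coloringFormula G (PhaseTwo.setG' G v) it.L it.Q₁ it.Q₂).Satisfiable) := by
  constructor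
  · obtain ⟨P, p, hP⟩ := PhaseTwo.Poly.fullRun (PhaseTwo.Poly.id PhaseTwo.encodeInst)
    obtain ⟨q, hq⟩ := PhaseTwo.size_encodeInput_le
    refine ⟨P, p.comp q, fun n G v hG => ?_⟩
    let J : PhaseTwo.Instance := ⟨n, G, v, hG⟩
    obtain ⟨t, ht, hE⟩ := hP J
    refine ⟨_, t, PhaseTwo.isRun_fullRun J, PhaseTwo.length_iterations_fullRun J, ?_, hE⟩
    rw [Polynomial.eval_comp]
    exact ht.trans (PhaseTwo.eval_mono_nat p (hq n G v))
  · intro n G v hG r hr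
    refine ⟨PhaseTwo.exists_list_colorings hr, fun it hit => ⟨fun x i => ⟨fun h => ?_, ?_⟩,
      fun x y i j _ hij => PhaseTwo.test5_iff_satisfiable it.L x y hij,
      PhaseTwo.test6_iff_satisfiable (PhaseTwo.noC5_of_not_isIndContained hG.C5_free) hit⟩⟩
    · exact hG.P6_free (h.trans ⟨SimpleGraph.Embedding.induce _⟩)
    · refine ⟨Finset.univ.erase i, by simp, fun w m hm => ?_⟩
      simp only [Finset.mem_sdiff, Finset.mem_singleton] at hm
      simpa using hm.2
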